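/- **Proposition 1.** *Setting.* Let $\mathcal F h(\xi)=\int_{\mathbf R^d}e^{-i2\pi\xi\cdot x}h(x)\,dx$. For $\sigma\in(0,2)$ let $\mathfrak A^\sigma$ be the class of nonnegative measures $\pi$ on $\mathbf R^d\setminus\{0\}$ with $\int(|y|^2\wedge1)\,d\pi<\infty$ and $\sigma=\inf\{\alpha<2:\int_{|y|\le1}|y|^\alpha d\pi<\infty\}$, such that $\int_{|y|>1}|y|\,d\pi<\infty$ if $\sigma\in(1,2)$ and $\int_{R<|y|\le R'}y\,d\pi=0$ for all $0<R<R'<\infty$ if $\sigma=1$; put $\mathfrak A=\bigcup_{\sigma\in(0,2)}\mathfrak A^\sigma$. Let $\chi_\sigma(y)=0$ if $\sigma<1$, $\chi_\sigma(y)=1_{\{|y|\le1\}}$ if $\sigma=1$, $\chi_\sigma(y)=1$ if $\sigma>1$, and $\psi^\pi(\xi)=\int[e^{i2\pi\xi\cdot y}-1-i2\pi\chi_\sigma(y)\,\xi\cdot y]\,\pi(dy)$ for $\pi\in\mathfrak A^\sigma$. A scaling function is a continuous $\kappa:(0,\infty)\to(0,\infty)$ with $\kappa(R)\to0$ as $R\to0$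 and $\kappa(R)\to\infty$ as $R\to\infty$, for which there is a nondecreasing continuous function $l$ on $(0,\infty)$ (a scaling factor of $\kappa$) with $l(\varepsilon)\to0$ as $\varepsilon\to0$ and $\kappa(\varepsilon r)\le l(\varepsilon)\kappa(r)$ for all $\varepsilon,r>0$. For $\pi\in\mathfrak A^\sigma$ and $R>0$ put $\tilde\pi_R(\Gamma)=\kappa(R)\int1_\Gamma(y/R)\,\pi(dy)$, and consider the following assumptions. * **D**$(\kappa,l)$: there are a measure $\mu^0\in\mathfrak A$ concentrated on $\{|y|\le1\}$ and constants $n_0$ and $c_1>0$ such that $\tilde\pi_R\ge1_{\{|y|\le1\}}\mu^0$ for every $R>0$; $$\int|y|^2\mu^0(dy)+\int|\xi|^4[1+\lambda(\xi)]^{d+3}e^{-\psi_0(\xi)}\,d\xi\le n_0,$$ where $\psi_0(\xi)=\int_{|y|\le1}[1-\cos(2\pi\xi\cdot y)]\mu^0(dy)$ and $\lambda(\xi)=\int_{|y|\le1}\chi_\sigma(y)|y|[(|\xi||y|)\wedge1]\mu^0(dy)$; $\int_{|y|\le1}|\xi\cdot y|^2\mu^0(dy)\ge c_1$ whenever $|\xi|=1$;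 and, if $\sigma=1$, $\int_{R<|y|\le R'}y\,\mu^0(dy)=0$ for all $0<R<R'\le1$. * **B**$(\kappa,l)$: there are $\alpha_1,\alpha_2$ and $N_0>0$ with $\int_{|z|\le1}|z|^{\alpha_1}\tilde\pi_R(dz)+\int_{|z|>1}|z|^{\alpha_2}\tilde\pi_R(dz)\le N_0$ for all $R>0$, where $\alpha_1,\alpha_2\in(0,1]$ if $\sigma\in(0,1)$; $\alpha_1,\alpha_2\in(1,2]$ if $\sigma\in(1,2)$; $\alpha_1\in(1,2]$ and $\alpha_2\in[0,1)$ if $\sigma=1$. Let $N>1$ be an integer and let $\phi\in C_0^\infty(\mathbf R^d)$ satisfy $\operatorname{supp}\phi=\{1/N\le|\xi|\le N\}$, $\phi>0$ on $\{1/N<|\xi|<N\}$ and $\sum_{j\in\mathbf Z}\phi(N^{-j}\xi)=1$ for $\xi\ne0$. Put $\varphi_j=\mathcal F^{-1}[\phi(N^{-j}\cdot)]$ for $j\ge1$ and $\varphi_0=\mathcal F^{-1}[1-\sum_{k\ge1}\phi(N^{-k}\cdot)]$. Let $\mathcal S(\mathbf R^d)$ be the space of real-valued Schwartz functions and $\mathcal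 S'(\mathbf R^d)$ the space of (real) tempered distributions. For $\mu\in\mathfrak A^\sigma$ let $\mu_{sym}(dy)=\frac12[\mu(dy)+\mu(-dy)]$ and $J^sv=(I-L^{\mu_{sym}})^sv=\mathcal F^{-1}[(1-\psi^{\mu_{sym}})^s\mathcal Fv]$. For $s\in\mathbf R$ and $p,q\in(1,\infty)$ the space $B^{\mu,N;s}_{pq}(\mathbf R^d)$ is the closure of $\mathcal S(\mathbf R^d)$ in the norm $$|v|_{B^{\mu,N;s}_{pq}}=\Big(\sum_{j\ge0}|J^s\varphi_j*v|_{L_p}^q\Big)^{1/q},\qquad v\in\mathcal S(\mathbf R^d),$$ and $\tilde B^{\kappa,N;s}_{pq}(\mathbf R^d)$ is the space of $v\in\mathcal S'(\mathbf R^d)$ with $$|v|_{\tilde B^{\kappa,N;s}_{pq}}=\Big(\sum_{j\ge0}\kappa(N^{-j})^{-sq}|\varphi_j*v|_{L_p}^q\Big)^{1/q}<\infty.$$ *Statement.* Let $\kappa$ be a scaling function with scaling factor $l$, let **D**$(\kappa,l)$ and **B**$(\kappa,l)$ hold for $\mu\in\mathfrak A^\sigma$, and let $s\in\mathbf R$,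 $p,q\in(1,\infty)$, $N>1$ and $l(N^{-1})<1$. Then $\tilde B^{\kappa,N;s}_{pq}(\mathbf R^d)=B^{\mu,N;s}_{pq}(\mathbf R^d)$ and the norms are equivalent. Here the closure is realized in $\mathcal S'(\mathbf R^d)$: $|\cdot|_{B^{\mu,N;s}_{pq}}$ is finite on $\mathcal S(\mathbf R^d)$; every sequence in $\mathcal S(\mathbf R^d)$ that is Cauchy in this norm converges in $\mathcal S'(\mathbf R^d)$; $B^{\mu,N;s}_{pq}(\mathbf R^d)$ is the set of the limits; and the norm of a limit is the limit of the norms, which depends only on the limit. -/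

import Mathlib

open MeasureTheory Filter Topology Set
open scoped ENNReal NNReal SchwartzMap FourierTransform ContDiff RealInnerProductSpace

noncomputable section

namespace LevyBesov

/-- `ℝ^d` with its Euclidean norm. -/
abbrev Rd (d : ℕ) : Type := EuclideanSpace ℝ (Fin d)

/-! ### Lévy measures and their symbols -/

/-- The class `𝔄^σ` of Lévy measures of order `σ ∈ (0, 2)`. A measure on `ℝ^d \ {0}` is encoded as
a Borel measure on `ℝ^d` which does not charge the origin. -/
structure LevyClass {d : ℕ} (σ : ℝ) (π : Measure (Rd d)) : Prop where
  order_mem : σ ∈ Ioo (0 : ℝ) 2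
  zero_null : π {0} = 0
  levy : ∫⁻ y, ENNReal.ofReal (min (‖y‖ ^ 2) 1) ∂π < ⊤
  order : IsGLB {α : ℝ | α < 2 ∧ ∫⁻ y in {y | ‖y‖ ≤ 1}, ENNReal.ofReal (‖y‖ ^ α) ∂π < ⊤} σ
  first_moment : σ ∈ Ioo (1 : ℝ) 2 → ∫⁻ y in {y | 1 < ‖y‖}, ENNReal.ofReal ‖y‖ ∂π < ⊤
  centered : σ = 1 → ∀ R R' : ℝ, 0 < R → R < R' → ∫ y in {y | R < ‖y‖ ∧ ‖y‖ ≤ R'}, y ∂π = 0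

open Classical in
/-- The truncation `χ_σ`: it is `0` for `σ < 1`, the indicator of the closed unit ball for `σ = 1`,
and `1` for `σ > 1`. -/
def chi {d : ℕ} (σ : ℝ) (y : Rd d) : ℝ :=
  if σ < 1 then 0 else if σ = 1 then (if ‖y‖ ≤ 1 then 1 else 0) else 1

/-- The symbol `ψ^π(ξ) = ∫ [e^{i2πξ·y} - 1 - i2π χ_σ(y) ξ·y] π(dy)` of `L^π`, `π ∈ 𝔄^σ`. -/
def levySymbol {d : ℕ} (σ : ℝ) (π : Measure (Rd d)) (ξ : Rd d) : ℂ :=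
  ∫ y, (Complex.exp (Complex.I * (2 * Real.pi * ⟪ξ, y⟫ : ℝ)) - 1
    - Complex.I * (2 * Real.pi * chi σ y * ⟪ξ, y⟫ : ℝ)) ∂π

/-- `μ_sym(dy) = (μ(dy) + μ(-dy)) / 2`. -/
def symmetrization {d : ℕ} (μ : Measure (Rd d)) : Measure (Rd d) :=
  (2⁻¹ : ℝ≥0∞) • (μ + μ.map (fun y => -y))

/-- The rescaled measure `π̃_R(Γ) = κ(R) ∫ 1_Γ(y / R) π(dy)`. -/
def rescaled {d : ℕ} (κ : ℝ → ℝ) (π : Measure (Rd d)) (R : ℝ) : Measure (Rd d) :=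
  ENNReal.ofReal (κ R) • π.map (fun y => R⁻¹ • y)

/-! ### Scaling functions and the assumptions D and B -/

/-- `κ : (0, ∞) → (0, ∞)` is a scaling function with scaling factor `l`. Only the values of `κ`
and `l` on `(0, ∞)` matter. -/
structure IsScaling (κ l : ℝ → ℝ) : Prop where
  continuousOn : ContinuousOn κ (Ioi 0)
  pos : ∀ r, 0 < r → 0 < κ r
  tendsto_zero : Tendsto κ (𝓝[>] 0) (𝓝 0)
  tendsto_atTop : Tendsto κ atTop atTop
  factor_continuousOn : ContinuousOn l (Ioi 0)
  factor_mono : MonotoneOn l (Ioi 0)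
  factor_tendsto_zero : Tendsto l (𝓝[>] 0) (𝓝 0)
  scaling : ∀ ε r, 0 < ε → 0 < r → κ (ε * r) ≤ l ε * κ r

/-- `ψ_0(ξ) = ∫_{|y| ≤ 1} [1 - cos(2πξ·y)] μ⁰(dy)`. -/
def psiZero {d : ℕ} (μ₀ : Measure (Rd d)) (ξ : Rd d) : ℝ :=
  ∫ y in {y | ‖y‖ ≤ 1}, (1 - Real.cos (2 * Real.pi * ⟪ξ, y⟫)) ∂μ₀

/-- `λ(ξ) = ∫_{|y| ≤ 1} χ_σ(y) |y| [(|ξ| |y|) ∧ 1] μ⁰(dy)`. -/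
def lambdaZero {d : ℕ} (σ : ℝ) (μ₀ : Measure (Rd d)) (ξ : Rd d) : ℝ≥0∞ :=
  ∫⁻ y in {y | ‖y‖ ≤ 1}, ENNReal.ofReal (chi σ y * ‖y‖ * min (‖ξ‖ * ‖y‖) 1) ∂μ₀

/-- Assumption `A₀(σ)` on the auxiliary Lévy measure `μ⁰`, with constants `n₀` and `c₁`. -/
structure AssumptionA0 {d : ℕ} (σ n₀ c₁ : ℝ) (μ₀ : Measure (Rd d)) : Prop where
  mem : ∃ σ', LevyClass σ' μ₀
  supported : μ₀.restrict {y | ‖y‖ ≤ 1} = μ₀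
  bound : ∫⁻ y, ENNReal.ofReal (‖y‖ ^ 2) ∂μ₀
      + ∫⁻ ξ : Rd d, ENNReal.ofReal (‖ξ‖ ^ 4) * (1 + lambdaZero σ μ₀ ξ) ^ (d + 3)
          * ENNReal.ofReal (Real.exp (-psiZero μ₀ ξ)) ≤ ENNReal.ofReal n₀
  const_pos : 0 < c₁
  nondegenerate : ∀ ξ : Rd d, ‖ξ‖ = 1 → c₁ ≤ ∫ y in {y | ‖y‖ ≤ 1}, ⟪ξ, y⟫ ^ 2 ∂μ₀

/-- Assumption `D(κ, l)` for `π ∈ 𝔄^σ`. -/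
def AssumptionD {d : ℕ} (σ : ℝ) (κ : ℝ → ℝ) (π : Measure (Rd d)) : Prop :=
  ∃ (μ₀ : Measure (Rd d)) (n₀ c₁ : ℝ), AssumptionA0 σ n₀ c₁ μ₀ ∧
    (∀ R : ℝ, 0 < R → μ₀.restrict {y | ‖y‖ ≤ 1} ≤ rescaled κ π R) ∧
    (σ = 1 → ∀ R R' : ℝ, 0 < R → R < R' → R' ≤ 1 →
      ∫ y in {y | R < ‖y‖ ∧ ‖y‖ ≤ R'}, y ∂μ₀ = 0)

/-- Assumption `B(κ, l)` for `π ∈ 𝔄^σ`. -/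
def AssumptionB {d : ℕ} (σ : ℝ) (κ : ℝ → ℝ) (π : Measure (Rd d)) : Prop :=
  ∃ α₁ α₂ N₀ : ℝ, 0 < N₀ ∧
    (σ ∈ Ioo (0 : ℝ) 1 → α₁ ∈ Ioc (0 : ℝ) 1 ∧ α₂ ∈ Ioc (0 : ℝ) 1) ∧
    (σ ∈ Ioo (1 : ℝ) 2 → α₁ ∈ Ioc (1 : ℝ) 2 ∧ α₂ ∈ Ioc (1 : ℝ) 2) ∧
    (σ = 1 → α₁ ∈ Ioc (1 : ℝ) 2 ∧ α₂ ∈ Ico (0 : ℝ) 1) ∧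
    ∀ R : ℝ, 0 < R →
      ∫⁻ z in {z | ‖z‖ ≤ 1}, ENNReal.ofReal (‖z‖ ^ α₁) ∂(rescaled κ π R)
        + ∫⁻ z in {z | 1 < ‖z‖}, ENNReal.ofReal (‖z‖ ^ α₂) ∂(rescaled κ π R)
        ≤ ENNReal.ofReal N₀

/-! ### Littlewood–Paley systems -/

/-- A function `φ ∈ C_0^∞(ℝ^d)` generating an `N`-adic Littlewood–Paley partition of unity. -/
structure LittlewoodPaley (d N : ℕ) where
  phi : Rd d → ℝ
  one_lt : 1 < N
  smooth : ContDiff ℝ ∞ phi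
  tsupport_eq : tsupport phi = {ξ | (N : ℝ)⁻¹ ≤ ‖ξ‖ ∧ ‖ξ‖ ≤ N}
  pos : ∀ ξ, (N : ℝ)⁻¹ < ‖ξ‖ → ‖ξ‖ < N → 0 < phi ξ
  hasSum : ∀ ξ, ξ ≠ 0 → HasSum (fun j : ℤ => phi ((N : ℝ) ^ (-j) • ξ)) 1

namespace LittlewoodPaley

variable {d N : ℕ}

/-- The Fourier transforms of the functions `φ_j`: `φ(N^{-j} ·)` for `j ≥ 1`, and
`1 - ∑_{k ≥ 1} φ(N^{-k} ·)` for `j = 0`. -/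
def hat (P : LittlewoodPaley d N) : ℕ → Rd d → ℝ
  | 0 => fun ξ => 1 - ∑' k : ℕ, P.phi ((N : ℝ) ^ (-((k : ℤ) + 1)) • ξ)
  | j + 1 => fun ξ => P.phi ((N : ℝ) ^ (-((j : ℤ) + 1)) • ξ)

theorem phi_eq_zero (P : LittlewoodPaley d N) {ξ : Rd d}
    (h : ‖ξ‖ < (N : ℝ)⁻¹ ∨ (N : ℝ) < ‖ξ‖) : P.phi ξ = 0 := by
  apply image_eq_zero_of_notMem_tsupport
  rw [P.tsupport_eq]
  rintro ⟨h1, h2⟩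
  rcases h with h | h <;> linarith

theorem cast_pos (P : LittlewoodPaley d N) : (0 : ℝ) < N := by
  have := P.one_lt
  positivity

theorem one_lt_cast (P : LittlewoodPaley d N) : (1 : ℝ) < N := by
  exact_mod_cast P.one_lt

theorem norm_zpow_smul (P : LittlewoodPaley d N) (m : ℤ) (ξ : Rd d) :
    ‖(N : ℝ) ^ m • ξ‖ = (N : ℝ) ^ m * ‖ξ‖ := by
  rw [norm_smul, Real.norm_of_nonneg (zpow_nonneg P.cast_pos.le _)]

theorem hat_zero_eq_finsum (P : LittlewoodPaley d N) (M : ℕ) {ξ : Rd d}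
    (h : ‖ξ‖ < (N : ℝ) ^ M) :
    P.hat 0 ξ = 1 - ∑ k ∈ Finset.range M, P.phi ((N : ℝ) ^ (-((k : ℤ) + 1)) • ξ) := by
  have hN := P.cast_pos
  simp only [hat]
  rw [tsum_eq_sum]
  intro k hk
  have hk' : M ≤ k := by simpa using hk
  apply P.phi_eq_zero
  left
  rw [P.norm_zpow_smul]
  calc (N : ℝ) ^ (-((k : ℤ) + 1)) * ‖ξ‖ < (N : ℝ) ^ (-((k : ℤ) + 1)) * (N : ℝ) ^ M := by gcongr
    _ = (N : ℝ) ^ (-((k : ℤ) + 1) + (M : ℤ)) := by rw [zpow_add₀ hN.ne', zpow_natCast]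
    _ ≤ (N : ℝ) ^ (-1 : ℤ) := zpow_le_zpow_right₀ P.one_lt_cast.le (by omega)
    _ = (N : ℝ)⁻¹ := zpow_neg_one _

theorem contDiff_hat (P : LittlewoodPaley d N) (j : ℕ) : ContDiff ℝ ∞ (P.hat j) := by
  cases j with
  | succ j => exact P.smooth.comp (contDiff_const_smul _)
  | zero =>
    rw [contDiff_iff_contDiffAt]
    intro ξ
    obtain ⟨M, hM⟩ := pow_unbounded_of_one_lt ‖ξ‖ P.one_lt_cast
    have hev : P.hat 0 =ᶠ[𝓝 ξ] fun ξ =>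
        1 - ∑ k ∈ Finset.range M, P.phi ((N : ℝ) ^ (-((k : ℤ) + 1)) • ξ) := by
      filter_upwards [(isOpen_lt continuous_norm continuous_const).mem_nhds hM] with η hη
      exact P.hat_zero_eq_finsum M hη
    refine ContDiffAt.congr_of_eventuallyEq ?_ hev
    refine ContDiff.contDiffAt (contDiff_const.sub (ContDiff.sum fun k _ => ?_))
    exact P.smooth.comp (contDiff_const_smul _)

theorem hat_zero_eq_zero (P : LittlewoodPaley d N) {ξ : Rd d} (h : (N : ℝ) < ‖ξ‖) : P.hat 0 ξ = 0 := by
  have hξ : ξ ≠ 0 := by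
    rintro rfl
    have := P.cast_pos
    simp at h
    linarith
  have hinj : Function.Injective (fun k : ℕ => (k : ℤ) + 1) := by
    intro a b hab
    simpa using hab
  have hs : HasSum (fun k : ℕ => P.phi ((N : ℝ) ^ (-((k : ℤ) + 1)) • ξ)) 1 := by
    refine (hinj.hasSum_iff (f := fun j : ℤ => P.phi ((N : ℝ) ^ (-j) • ξ)) ?_).2 (P.hasSum ξ hξ)
    intro j hj
    have hj' : j ≤ 0 := by
      by_contra hcon
      exact hj ⟨(j - 1).toNat, by simp only []; omega⟩
    apply P.phi_eq_zero
    right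
    rw [P.norm_zpow_smul]
    have h1 : (1 : ℝ) ≤ (N : ℝ) ^ (-j) := one_le_zpow₀ P.one_lt_cast.le (by omega)
    nlinarith [norm_nonneg ξ]
  simp only [hat]
  rw [hs.tsum_eq, sub_self]

theorem hasCompactSupport_hat (P : LittlewoodPaley d N) (j : ℕ) : HasCompactSupport (P.hat j) := by
  cases j with
  | succ j =>
    refine HasCompactSupport.intro (isCompact_closedBall (0 : Rd d) ((N : ℝ) ^ (j + 2))) ?_
    intro ξ hξ
    have hξ' : (N : ℝ) ^ (j + 2) < ‖ξ‖ := by simpa using hξ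
    apply P.phi_eq_zero
    right
    have hN := P.cast_pos
    rw [P.norm_zpow_smul]
    calc (N : ℝ) = (N : ℝ) ^ (-((j : ℤ) + 1)) * (N : ℝ) ^ (j + 2) := by
          rw [← zpow_natCast, ← zpow_add₀ hN.ne']
          have : -((j : ℤ) + 1) + ((j + 2 : ℕ) : ℤ) = 1 := by push_cast; ring
          rw [this, zpow_one]
      _ < (N : ℝ) ^ (-((j : ℤ) + 1)) * ‖ξ‖ := by gcongr
  | zero =>
    refine HasCompactSupport.intro (isCompact_closedBall (0 : Rd d) (N : ℝ)) ?_
    intro ξ hξ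
    exact P.hat_zero_eq_zero (by simpa using hξ)

/-- `P.hat j` as a (complex-valued) Schwartz function. -/
def hatSchwartz (P : LittlewoodPaley d N) (j : ℕ) : 𝓢(Rd d, ℂ) :=
  HasCompactSupport.toSchwartzMap (f := fun ξ => (P.hat j ξ : ℂ))
    ((P.hasCompactSupport_hat j).comp_left Complex.ofReal_zero)
    (Complex.ofRealCLM.contDiff.comp (P.contDiff_hat j))

/-- The functions `φ_j ∈ 𝓢(ℝ^d)`, `j ≥ 0`. -/
def kernel (P : LittlewoodPaley d N) (j : ℕ) : 𝓢(Rd d, ℂ) := 𝓕⁻ (P.hatSchwartz j)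

end LittlewoodPaley

/-! ### Besov spaces

The Schwartz space of real-valued functions is `𝓢(ℝ^d, ℝ)`. Real tempered distributions are those
elements of `𝓢'(ℝ^d, ℂ)` which take real values on real test functions. -/

/-- A real Schwartz function viewed as a complex one. -/
def toComplex {d : ℕ} (u : 𝓢(Rd d, ℝ)) : 𝓢(Rd d, ℂ) :=
  u.postcompCLM Complex.ofRealCLM

/-- The tempered distribution `f ↦ ∫ f u dx` of a real Schwartz function `u`. -/
def toDistribution {d : ℕ} (u : 𝓢(Rd d, ℝ)) : 𝓢'(Rd d, ℂ) :=
  SchwartzMap.toTemperedDistributionCLM (Rd d) ℂ volume (toComplex u)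

/-- The tempered distribution `v` is real. -/
def IsRealDistribution {d : ℕ} (v : 𝓢'(Rd d, ℂ)) : Prop :=
  ∀ f : 𝓢(Rd d, ℝ), (v (toComplex f)).im = 0

/-- The Schwartz function `y ↦ f (x - y)`. -/
def reflectTranslate {d : ℕ} (f : 𝓢(Rd d, ℂ)) (x : Rd d) : 𝓢(Rd d, ℂ) :=
  SchwartzMap.compSubConstCLM ℂ x
    (SchwartzMap.compCLMOfContinuousLinearEquiv ℂ (ContinuousLinearEquiv.neg ℝ) f)

theorem reflectTranslate_apply {d : ℕ} (f : 𝓢(Rd d, ℂ)) (x y : Rd d) :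
    reflectTranslate f x y = f (x - y) := by
  simp [reflectTranslate]

/-- The convolution `f * v` of a Schwartz function and a tempered distribution; it is the function
`x ↦ v(f(x - ·))`. -/
def convolution {d : ℕ} (f : 𝓢(Rd d, ℂ)) (v : 𝓢'(Rd d, ℂ)) (x : Rd d) : ℂ :=
  v (reflectTranslate f x)

/-- `J^s φ_j * u = 𝓕⁻¹[(1 - ψ^{μ_sym})^s 𝓕φ_j 𝓕u]` with `J = I - L^{μ_sym}`, for a Schwartz
function `u`. The power is the complex one; its base is a real number `≥ 1`. -/
def besselConvolution {d N : ℕ} (σ : ℝ) (μ : Measure (Rd d)) (P : LittlewoodPaley d N)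
    (s : ℝ) (j : ℕ) (u : 𝓢(Rd d, ℝ)) : Rd d → ℂ :=
  𝓕⁻ (fun ξ : Rd d => (1 - levySymbol σ (symmetrization μ) ξ) ^ (s : ℂ) * (P.hat j ξ : ℂ)
    * 𝓕 (toComplex u) ξ)

/-- The norm `|u|_{B_{pq}^{μ,N;s}} = (∑_j |J^s φ_j * u|_{L_p}^q)^{1/q}` of a Schwartz function. -/
def besovSchwartzNorm {d N : ℕ} (σ : ℝ) (μ : Measure (Rd d)) (P : LittlewoodPaley d N)
    (s p q : ℝ) (u : 𝓢(Rd d, ℝ)) : ℝ≥0∞ :=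
  (∑' j : ℕ, eLpNorm (besselConvolution σ μ P s j u) (ENNReal.ofReal p) volume ^ q) ^ (1 / q)

/-- `(u_n)` is a Cauchy sequence of Schwartz functions in the norm of `B_{pq}^{μ,N;s}`. -/
def IsBesovCauchy {d N : ℕ} (σ : ℝ) (μ : Measure (Rd d)) (P : LittlewoodPaley d N)
    (s p q : ℝ) (u : ℕ → 𝓢(Rd d, ℝ)) : Prop :=
  ∀ ε : ℝ≥0∞, 0 < ε → ∃ n₀ : ℕ, ∀ m n : ℕ, n₀ ≤ m → n₀ ≤ n →
    besovSchwartzNorm σ μ P s p q (u m - u n) < ε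

/-- `(u_n)` is a Cauchy sequence of Schwartz functions in the norm of `B_{pq}^{μ,N;s}` and converges
to `v` in the space of tempered distributions. -/
def BesovApproximates {d N : ℕ} (σ : ℝ) (μ : Measure (Rd d)) (P : LittlewoodPaley d N)
    (s p q : ℝ) (u : ℕ → 𝓢(Rd d, ℝ)) (v : 𝓢'(Rd d, ℂ)) : Prop :=
  IsBesovCauchy σ μ P s p q u ∧ Tendsto (fun n => toDistribution (u n)) atTop (𝓝 v)

/-- The space `B_{pq}^{μ,N;s}`: the closure of the Schwartz space in the norm
`besovSchwartzNorm`, realized in the space of tempered distributions. -/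
def besovSpace {d N : ℕ} (σ : ℝ) (μ : Measure (Rd d)) (P : LittlewoodPaley d N)
    (s p q : ℝ) : Set 𝓢'(Rd d, ℂ) :=
  {v | ∃ u : ℕ → 𝓢(Rd d, ℝ), BesovApproximates σ μ P s p q u v}

/-- The norm of `B_{pq}^{μ,N;s}`, extended from the Schwartz functions to the closure as the limit
of the norms of an approximating sequence. (That this limit exists and does not depend on the
sequence is not part of the definition, hence the infimum and the upper limit.) -/
def besovNorm {d N : ℕ} (σ : ℝ) (μ : Measure (Rd d)) (P : LittlewoodPaley d N)
    (s p q : ℝ) (v : 𝓢'(Rd d, ℂ)) : ℝ≥0∞ :=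
  ⨅ (u : ℕ → 𝓢(Rd d, ℝ)) (_ : BesovApproximates σ μ P s p q u v),
    limsup (fun n => besovSchwartzNorm σ μ P s p q (u n)) atTop

/-- The norm `|v|_{B̃_{pq}^{κ,N;s}} = (∑_j κ(N^{-j})^{-sq} |φ_j * v|_{L_p}^q)^{1/q}` of a tempered
distribution. -/
def genBesovNorm {d N : ℕ} (κ : ℝ → ℝ) (P : LittlewoodPaley d N) (s p q : ℝ)
    (v : 𝓢'(Rd d, ℂ)) : ℝ≥0∞ :=
  (∑' j : ℕ, ENNReal.ofReal (κ ((N : ℝ) ^ (-(j : ℤ))) ^ (-(s * q)))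
    * eLpNorm (convolution (P.kernel j) v) (ENNReal.ofReal p) volume ^ q) ^ (1 / q)

/-- The Besov space of generalized smoothness `B̃_{pq}^{κ,N;s}`. -/
def genBesovSpace {d N : ℕ} (κ : ℝ → ℝ) (P : LittlewoodPaley d N) (s p q : ℝ) :
    Set 𝓢'(Rd d, ℂ) :=
  {v | IsRealDistribution v ∧ genBesovNorm κ P s p q v < ⊤}

end LevyBesov

end

/-! Symmetrizing `μ` removes the imaginary part of the symbol, so `J` is the multiplier `1 + ψ` with
`ψ(ξ) = ∫ [1 - cos(2πξ·y)] μ(dy) ≥ 0` (`levyExp`). By change of variables `ψ(ξ/R) = κ(R)⁻¹ ψ_R(ξ)`,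
where `ψ_R` is the exponent of the rescaled measure. Assumption B bounds `ψ_R` from above and D
bounds it from below on a fixed annulus, uniformly in `R`. Hence `J^s` should act on frequencies of
order `N^j` like the scalar `κ(N^{-j})^{-s}`, and the two norms should agree piece by piece.

The difficulty is that `ψ` need not be smooth, since `μ` may have heavy tails, so multiplier
theorems based on derivatives do not apply. Multipliers are measured instead by the `L¹` norm of
their kernel (`kernelNorm`). It controls the action on every `L_p` by Young's inequality, is
submultiplicative, and is invariant under dilations. In this norm `exp(-tψ)` is a contraction, as
the transform of a probability law. D provides a finite, boundedly supported measure below every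
rescaled measure (`AssumptionD.exists_minorant`). Its exponent is smooth and positive on the
annulus, so its exponential decays in `t`, and the remaining measure only contracts. Negative powers
follow from the Gamma integral over `t`. Positive powers follow by multiplying repeatedly by the
localized symbol, whose kernel is bounded through B (`exists_kernelNorm_rpow_mul_le`,
`exists_kernelNorm_rpow_dilate_le`). This gives the norm equivalence on Schwartz functions.

The passage to the closure takes place in the generalized space and rests on three facts. Its norm
dominates the pairing with each test function, by duality of the pieces (`exists_enorm_apply_le`).
It is lower semicontinuous under convergence of distributions, by Fatou
(`genBesovNorm_le_of_tendsto`). Real Schwartz functions are dense in it, by truncating frequencies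
and then approximating in `L_p` (`exists_genBesovNorm_sub_lt`). The first makes Cauchy sequences
converge in `𝓢'`, the second makes the extended norm independent of the sequence
(`BesovApproximates.tendsto_sub`), and the third identifies the two spaces. -/

namespace LevyBesov

set_option linter.unusedSectionVars false

/-! ### The `L¹` norm of a multiplier's kernel, and Young's inequality -/

section KernelNorm

variable {V : Type*} [NormedAddCommGroup V] [InnerProductSpace ℝ V] [FiniteDimensional ℝ V]
  [MeasurableSpace V] [BorelSpace V]

/-- Hölder's inequality after writing `a = a^{1/p} · a^{1/q}`, with `q` conjugate to `p`. Only one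
factor of the weight stays next to `b ^ p`, which is what Young's inequality needs. -/
theorem rpow_lintegral_mul_le {α : Type*} [MeasurableSpace α] {μ : Measure α} {a b : α → ℝ≥0∞}
    (ha : AEMeasurable a μ) (hb : AEMeasurable b μ) {p : ℝ} (hp : 1 ≤ p) :
    (∫⁻ y, a y * b y ∂μ) ^ p ≤ (∫⁻ y, a y ∂μ) ^ (p - 1) * ∫⁻ y, a y * b y ^ p ∂μ := by
  rcases hp.eq_or_lt with rfl | hp
  · simp
  have hpq := Real.HolderConjugate.conjExponent hp
  set q := p.conjExponent with hq
  have hp0 : 0 < p := by linarith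
  have hq0 : 0 < q := hpq.symm.pos
  have hsum : 1 / p + 1 / q = 1 := by simpa using hpq.inv_add_inv_eq_one
  have h1 : ∫⁻ y, a y * b y ∂μ ≤
      (∫⁻ y, a y * b y ^ p ∂μ) ^ (1 / p) * (∫⁻ y, a y ∂μ) ^ (1 / q) := by
    have := ENNReal.lintegral_mul_le_Lp_mul_Lq μ hpq (f := fun y => a y ^ (1 / p) * b y)
      (g := fun y => a y ^ (1 / q)) ((ha.pow_const _).mul hb) (ha.pow_const _)
    refine le_trans (le_of_eq ?_) (this.trans (le_of_eq ?_))
    · refine lintegral_congr fun y => ?_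
      simp only [Pi.mul_apply]
      rw [mul_right_comm, ← ENNReal.rpow_add_of_nonneg _ _ (by positivity) (by positivity), hsum,
        ENNReal.rpow_one]
    · congr 2
      · refine lintegral_congr fun y => ?_
        rw [ENNReal.mul_rpow_of_nonneg _ _ hp0.le, ← ENNReal.rpow_mul, one_div_mul_cancel hp0.ne',
          ENNReal.rpow_one]
      · refine lintegral_congr fun y => ?_
        rw [← ENNReal.rpow_mul, one_div_mul_cancel hq0.ne', ENNReal.rpow_one]
  calc (∫⁻ y, a y * b y ∂μ) ^ p
      ≤ ((∫⁻ y, a y * b y ^ p ∂μ) ^ (1 / p) * (∫⁻ y, a y ∂μ) ^ (1 / q)) ^ p := by gcongr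
    _ = _ := by
      rw [ENNReal.mul_rpow_of_nonneg _ _ hp0.le, ← ENNReal.rpow_mul, ← ENNReal.rpow_mul,
        one_div_mul_cancel hp0.ne', ENNReal.rpow_one, mul_comm]
      congr 2
      have : 1 / q = 1 - 1 / p := by linarith
      rw [this]; field_simp

/-- Young's inequality `‖F ⋆ w‖_p ≤ ‖F‖_1 ‖w‖_p`. -/
theorem eLpNorm_integral_sub_mul_le {F w : V → ℂ} (hF : Continuous F) (hw : Continuous w) {p : ℝ}
    (hp : 1 ≤ p) :
    eLpNorm (fun x => ∫ y, F (x - y) * w y) (ENNReal.ofReal p) volume ≤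
      (∫⁻ x, ‖F x‖ₑ) * eLpNorm w (ENNReal.ofReal p) volume := by
  have hp0 : 0 < p := by linarith
  rw [eLpNorm_eq_lintegral_rpow_enorm_toReal (by simpa using hp0) (by simp),
    eLpNorm_eq_lintegral_rpow_enorm_toReal (by simpa using hp0) (by simp),
    ENNReal.toReal_ofReal hp0.le]
  have hA : ∀ x, ∫⁻ y, ‖F (x - y)‖ₑ = ∫⁻ y, ‖F y‖ₑ := fun x =>
    lintegral_sub_left_eq_self (fun y => ‖F y‖ₑ) x
  have h1 : ∀ x, ‖∫ y, F (x - y) * w y‖ₑ ^ p ≤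
      (∫⁻ y, ‖F y‖ₑ) ^ (p - 1) * ∫⁻ y, ‖F (x - y)‖ₑ * ‖w y‖ₑ ^ p := by
    intro x
    rw [← hA x]
    refine le_trans ?_ (rpow_lintegral_mul_le (by fun_prop) (by fun_prop) hp)
    gcongr
    refine (enorm_integral_le_lintegral_enorm _).trans (le_of_eq ?_)
    simp
  have h2 : ∫⁻ x, ‖∫ y, F (x - y) * w y‖ₑ ^ p ≤ (∫⁻ y, ‖F y‖ₑ) ^ p * ∫⁻ y, ‖w y‖ₑ ^ p := by
    calc ∫⁻ x, ‖∫ y, F (x - y) * w y‖ₑ ^ p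
        ≤ ∫⁻ x, (∫⁻ y, ‖F y‖ₑ) ^ (p - 1) * ∫⁻ y, ‖F (x - y)‖ₑ * ‖w y‖ₑ ^ p := lintegral_mono h1
      _ = (∫⁻ y, ‖F y‖ₑ) ^ (p - 1) * ∫⁻ x, ∫⁻ y, ‖F (x - y)‖ₑ * ‖w y‖ₑ ^ p := by
          rw [lintegral_const_mul]
          refine Measurable.lintegral_prod_right' (f := fun z : V × V => ‖F (z.1 - z.2)‖ₑ * ‖w z.2‖ₑ ^ p) ?_
          fun_prop
      _ = (∫⁻ y, ‖F y‖ₑ) ^ (p - 1) * ∫⁻ y, (∫⁻ x, ‖F x‖ₑ) * ‖w y‖ₑ ^ p := by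
          rw [lintegral_lintegral_swap (by fun_prop)]
          congr 1
          refine lintegral_congr fun y => ?_
          rw [lintegral_mul_const _ (Continuous.measurable (by fun_prop)),
            lintegral_sub_right_eq_self (fun x => ‖F x‖ₑ) y]
      _ = (∫⁻ y, ‖F y‖ₑ) ^ p * ∫⁻ y, ‖w y‖ₑ ^ p := by
          rw [lintegral_const_mul _ (by fun_prop), ← mul_assoc]
          congr 1
          conv_rhs => rw [← sub_add_cancel p 1]
          rw [ENNReal.rpow_add_of_nonneg _ _ (by linarith) zero_le_one, ENNReal.rpow_one]
  calc (∫⁻ x, ‖∫ y, F (x - y) * w y‖ₑ ^ p) ^ (1 / p)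
      ≤ ((∫⁻ y, ‖F y‖ₑ) ^ p * ∫⁻ y, ‖w y‖ₑ ^ p) ^ (1 / p) := by gcongr
    _ = _ := by
      rw [ENNReal.mul_rpow_of_nonneg _ _ (by positivity), ← ENNReal.rpow_mul,
        mul_one_div_cancel hp0.ne', ENNReal.rpow_one]

theorem continuous_fourierInv {g : V → ℂ} (hg : Integrable g) : Continuous (𝓕⁻ g) := by
  have : Continuous (𝓕 g) := VectorFourier.fourierIntegral_continuous Real.continuous_fourierChar
    (by exact continuous_inner) hg
  have h2 : 𝓕⁻ g = fun w => 𝓕 g (-w) := funext fun w => Real.fourierInv_eq_fourier_neg g w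
  rw [h2]
  exact this.comp continuous_neg

theorem norm_fourierChar (a : ℝ) : ‖(Real.fourierChar a : ℂ)‖ = 1 := Circle.norm_coe _

theorem integrable_char_mul {g : V → ℂ} (hg : Integrable g) (x : V) :
    Integrable (fun ξ => (Real.fourierChar ⟪ξ, x⟫ : ℂ) * g ξ) := by
  refine (hg.bdd_mul (c := 1) ?_ ?_)
  · exact (Continuous.aestronglyMeasurable (by fun_prop))
  · exact ae_of_all _ fun ξ => (norm_fourierChar _).le

theorem fourierInv_apply (g : V → ℂ) (x : V) :
    𝓕⁻ g x = ∫ ξ, (Real.fourierChar ⟪ξ, x⟫ : ℂ) * g ξ := by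
  rw [Real.fourierInv_eq]; rfl

/-- The multiplication formula `∫ 𝓕w · G = ∫ w · 𝓕G`, applied to `g` modulated by the character of
`x`. No regularity of `g` beyond integrability enters. -/
theorem fourierInv_mul_fourier {g w : V → ℂ} (hg : Integrable g) (hw : Integrable w) (x : V) :
    𝓕⁻ (fun ξ => g ξ * 𝓕 w ξ) x = ∫ y, 𝓕⁻ g (x - y) * w y := by
  have h := VectorFourier.integral_fourierIntegral_smul_eq_flip (L := innerₗ V)
    (μ := (volume : Measure V)) (ν := (volume : Measure V)) (f := w)
    (g := fun ξ => (Real.fourierChar ⟪ξ, x⟫ : ℂ) * g ξ)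
    Real.continuous_fourierChar (by exact continuous_inner) hw (integrable_char_mul hg x)
  rw [fourierInv_apply]
  refine Eq.trans ?_ (h.trans ?_)
  · refine integral_congr_ae (ae_of_all _ fun ξ => ?_)
    simp only [smul_eq_mul]
    change _ = 𝓕 w ξ * _
    ring
  · refine integral_congr_ae (ae_of_all _ fun y => ?_)
    simp only [smul_eq_mul]
    rw [mul_comm, fourierInv_apply]
    congr 1
    simp only [VectorFourier.fourierIntegral, LinearMap.flip_apply, innerₗ_apply_apply]
    refine integral_congr_ae (ae_of_all _ fun ξ => ?_)
    simp only [Circle.smul_def, smul_eq_mul]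
    rw [← mul_assoc, ← Circle.coe_mul, ← AddChar.map_add_eq_mul, inner_sub_right,
      real_inner_comm ξ y]
    ring_nf

/-- The `L¹` norm of the inverse Fourier transform of `g`, i.e. of the kernel of the Fourier
multiplier `g`. -/
noncomputable def kernelNorm (g : V → ℂ) : ℝ≥0∞ := ∫⁻ x, ‖𝓕⁻ g x‖ₑ

theorem integrable_fourierInv {g : V → ℂ} (hg : Integrable g) (hK : kernelNorm g ≠ ⊤) :
    Integrable (𝓕⁻ g) :=
  ⟨(continuous_fourierInv hg).aestronglyMeasurable, hK.lt_top⟩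

theorem fourier_fourierInv_of_kernelNorm {g : V → ℂ} (hc : Continuous g) (hg : Integrable g)
    (hK : kernelNorm g ≠ ⊤) : 𝓕 (𝓕⁻ g) = g := by
  refine hc.fourier_fourierInv_eq hg ?_
  have := (integrable_fourierInv hg hK).comp_neg
  refine this.congr (ae_of_all _ fun x => ?_)
  simp [Real.fourierInv_eq_fourier_neg]

theorem eLpNorm_fourierInv_mul_fourier_le {g w : V → ℂ} (hg : Integrable g) (hw : Integrable w)
    (hwc : Continuous w) {p : ℝ} (hp : 1 ≤ p) :
    eLpNorm (𝓕⁻ (fun ξ => g ξ * 𝓕 w ξ)) (ENNReal.ofReal p) volume ≤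
      kernelNorm g * eLpNorm w (ENNReal.ofReal p) volume := by
  have : 𝓕⁻ (fun ξ => g ξ * 𝓕 w ξ) = fun x => ∫ y, 𝓕⁻ g (x - y) * w y :=
    funext fun x => fourierInv_mul_fourier hg hw x
  rw [this]
  exact eLpNorm_integral_sub_mul_le (continuous_fourierInv hg) hwc hp

/-- A continuous integrable `h` with finite kernel norm is the transform of the integrable function
`𝓕⁻ h`, so Young's inequality applies. Finiteness of `kernelNorm h` is used only qualitatively and
does not enter the bound. -/
theorem eLpNorm_fourierInv_mul_le {g h : V → ℂ} (hg : Integrable g) (hc : Continuous h)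
    (hh : Integrable h) (hK : kernelNorm h ≠ ⊤) {p : ℝ} (hp : 1 ≤ p) :
    eLpNorm (𝓕⁻ (fun ξ => g ξ * h ξ)) (ENNReal.ofReal p) volume ≤
      kernelNorm g * eLpNorm (𝓕⁻ h) (ENNReal.ofReal p) volume := by
  have := eLpNorm_fourierInv_mul_fourier_le hg (integrable_fourierInv hh hK)
    (continuous_fourierInv hh) hp
  rwa [fourier_fourierInv_of_kernelNorm hc hh hK] at this

theorem eLpNorm_fourierInv_one (g : V → ℂ) :
    eLpNorm (𝓕⁻ g) (ENNReal.ofReal 1) volume = kernelNorm g := by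
  rw [ENNReal.ofReal_one, eLpNorm_one_eq_lintegral_enorm, kernelNorm]

theorem kernelNorm_mul_le {g h : V → ℂ} (hg : Integrable g) (hc : Continuous h)
    (hh : Integrable h) (hK : kernelNorm h ≠ ⊤) :
    kernelNorm (fun ξ => g ξ * h ξ) ≤ kernelNorm g * kernelNorm h := by
  simpa only [eLpNorm_fourierInv_one] using eLpNorm_fourierInv_mul_le hg hc hh hK le_rfl

theorem fourierInv_add {g h : V → ℂ} (hg : Integrable g) (hh : Integrable h) (x : V) :
    𝓕⁻ (fun ξ => g ξ + h ξ) x = 𝓕⁻ g x + 𝓕⁻ h x := by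
  simp only [fourierInv_apply, mul_add]
  exact integral_add (integrable_char_mul hg x) (integrable_char_mul hh x)

theorem fourierInv_const_mul (c : ℂ) (g : V → ℂ) (x : V) :
    𝓕⁻ (fun ξ => c * g ξ) x = c * 𝓕⁻ g x := by
  simp only [fourierInv_apply]
  rw [← integral_const_mul]
  congr 1; ext ξ; ring

theorem kernelNorm_add_le {g h : V → ℂ} (hg : Integrable g) (hh : Integrable h) :
    kernelNorm (fun ξ => g ξ + h ξ) ≤ kernelNorm g + kernelNorm h := by
  simp only [kernelNorm, fourierInv_add hg hh]
  rw [← lintegral_add_left (continuous_fourierInv hg).measurable.enorm]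
  exact lintegral_mono fun x => enorm_add_le _ _

theorem kernelNorm_sum_le {ι : Type*} (s : Finset ι) {g : ι → V → ℂ}
    (hg : ∀ i ∈ s, Integrable (g i)) :
    kernelNorm (fun ξ => ∑ i ∈ s, g i ξ) ≤ ∑ i ∈ s, kernelNorm (g i) := by
  classical
  induction s using Finset.induction_on with
  | empty => simp [kernelNorm, fourierInv_apply]
  | insert a s ha ih =>
    simp only [Finset.sum_insert ha]
    refine (kernelNorm_add_le (hg a (by simp))
      (integrable_finsetSum s fun i hi => hg i (by simp [hi]))).trans ?_
    gcongr
    exact ih fun i hi => hg i (by simp [hi])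

theorem kernelNorm_const_mul (c : ℂ) (g : V → ℂ) :
    kernelNorm (fun ξ => c * g ξ) = ‖c‖ₑ * kernelNorm g := by
  simp only [kernelNorm, fourierInv_const_mul, enorm_mul]
  rw [lintegral_const_mul' _ _ (by simp)]

theorem fourierInv_char_mul (y : V) (g : V → ℂ) (x : V) :
    𝓕⁻ (fun ξ => (Real.fourierChar ⟪ξ, y⟫ : ℂ) * g ξ) x = 𝓕⁻ g (x + y) := by
  simp only [fourierInv_apply]
  congr 1; ext ξ
  rw [inner_add_right, AddChar.map_add_eq_mul, Circle.coe_mul]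
  ring

theorem kernelNorm_char_mul (y : V) (g : V → ℂ) :
    kernelNorm (fun ξ => (Real.fourierChar ⟪ξ, y⟫ : ℂ) * g ξ) = kernelNorm g := by
  simp only [kernelNorm, fourierInv_char_mul]
  exact lintegral_add_right_eq_self (fun x => ‖𝓕⁻ g x‖ₑ) y

theorem cos_eq_fourierChar (a : ℝ) :
    ((Real.cos (2 * Real.pi * a) : ℝ) : ℂ) =
      2⁻¹ * ((Real.fourierChar a : ℂ) + (Real.fourierChar (-a) : ℂ)) := by
  rw [Real.fourierChar_apply, Real.fourierChar_apply, Complex.ofReal_cos, Complex.cos]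
  push_cast
  ring_nf

/-- A cosine is the mean of two characters, and a character only translates the kernel. -/
theorem kernelNorm_cos_mul_le (y : V) {g : V → ℂ} (hg : Integrable g) :
    kernelNorm (fun ξ => (Real.cos (2 * Real.pi * ⟪ξ, y⟫) : ℂ) * g ξ) ≤ kernelNorm g := by
  have h : (fun ξ => (Real.cos (2 * Real.pi * ⟪ξ, y⟫) : ℂ) * g ξ) = fun ξ =>
      2⁻¹ * ((Real.fourierChar ⟪ξ, y⟫ : ℂ) * g ξ + (Real.fourierChar ⟪ξ, -y⟫ : ℂ) * g ξ) := by
    ext ξ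
    rw [cos_eq_fourierChar, inner_neg_right]; ring
  rw [h, kernelNorm_const_mul]
  refine (mul_le_mul_right (kernelNorm_add_le (integrable_char_mul hg _)
    (integrable_char_mul hg _)) _).trans ?_
  rw [kernelNorm_char_mul, kernelNorm_char_mul, ← two_mul, ← mul_assoc]
  have : ‖(2⁻¹ : ℂ)‖ₑ * 2 = 1 := by
    rw [enorm_inv (by simp)]
    have : ‖(2 : ℂ)‖ₑ = 2 := by
      rw [← ofReal_norm]; simp
    rw [this]
    exact ENNReal.inv_mul_cancel (by simp) (by simp)
  rw [this, one_mul]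

/-- Minkowski's inequality for `kernelNorm`. -/
theorem kernelNorm_integral_le {Y : Type*} [MeasurableSpace Y] (ρ : Measure Y) [SFinite ρ]
    {F : Y → V → ℂ} (hm : StronglyMeasurable (Function.uncurry F))
    (hF : Integrable (Function.uncurry F) (ρ.prod volume)) :
    kernelNorm (fun ξ => ∫ y, F y ξ ∂ρ) ≤ ∫⁻ y, kernelNorm (F y) ∂ρ := by
  have hms : StronglyMeasurable (fun z : (Y × V) × V =>
      (Real.fourierChar ⟪z.2, z.1.2⟫ : ℂ) * F z.1.1 z.2) := by
    refine StronglyMeasurable.mul ?_ ?_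
    · exact (Continuous.stronglyMeasurable (f := fun w : V × V =>
        (Real.fourierChar ⟪w.2, w.1⟫ : ℂ)) (by fun_prop)).comp_measurable
        (g := fun z : (Y × V) × V => (z.1.2, z.2)) (by fun_prop)
    · exact hm.comp_measurable (g := fun z : (Y × V) × V => (z.1.1, z.2)) (by fun_prop)
  have hmeas : Measurable (fun z : Y × V => ‖𝓕⁻ (F z.1) z.2‖ₑ) := by
    refine Measurable.enorm ?_
    simp only [fourierInv_apply]
    exact (hms.integral_prod_right (ν := (volume : Measure V))).measurable
  have h1 : ∀ x, 𝓕⁻ (fun ξ => ∫ y, F y ξ ∂ρ) x = ∫ y, 𝓕⁻ (F y) x ∂ρ := by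
    intro x
    simp only [fourierInv_apply]
    simp_rw [← integral_const_mul]
    rw [integral_integral_swap]
    refine (hF.swap.bdd_mul (c := 1) (f := fun z : V × Y => (Real.fourierChar ⟪z.1, x⟫ : ℂ))
      ?_ ?_)
    · exact ((Continuous.stronglyMeasurable (f := fun w : V =>
        (Real.fourierChar ⟪w, x⟫ : ℂ)) (by fun_prop)).comp_measurable
          measurable_fst).aestronglyMeasurable
    · exact ae_of_all _ fun z => (norm_fourierChar _).le
  simp only [kernelNorm, h1]
  calc ∫⁻ x, ‖∫ y, 𝓕⁻ (F y) x ∂ρ‖ₑ ≤ ∫⁻ x, ∫⁻ y, ‖𝓕⁻ (F y) x‖ₑ ∂ρ :=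
        lintegral_mono fun x => enorm_integral_le_lintegral_enorm _
    _ = _ := by
      rw [lintegral_lintegral_swap]
      exact (hmeas.comp measurable_swap).aemeasurable

/-- Fatou's lemma for `kernelNorm`. -/
theorem kernelNorm_le_of_tendsto {G : V → ℝ} (hG : Integrable G) {g : ℕ → V → ℂ} {g' : V → ℂ}
    (hm : ∀ n, AEStronglyMeasurable (g n)) (hb : ∀ n ξ, ‖g n ξ‖ ≤ G ξ)
    (hlim : ∀ ξ, Tendsto (fun n => g n ξ) atTop (𝓝 (g' ξ))) {C : ℝ≥0∞}
    (hC : ∀ᶠ n in atTop, kernelNorm (g n) ≤ C) : kernelNorm g' ≤ C := by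
  have hi : ∀ n, Integrable (g n) := fun n => hG.mono' (hm n) (ae_of_all _ (hb n))
  have h1 : ∀ x, Tendsto (fun n => 𝓕⁻ (g n) x) atTop (𝓝 (𝓕⁻ g' x)) := by
    intro x
    simp only [fourierInv_apply]
    refine tendsto_integral_of_dominated_convergence G
      (fun n => (integrable_char_mul (hi n) x).aestronglyMeasurable) hG
      (fun n => ae_of_all _ fun ξ => by simpa [norm_fourierChar] using hb n ξ)
      (ae_of_all _ fun ξ => (hlim ξ).const_mul _)
  calc kernelNorm g' = ∫⁻ x, liminf (fun n => ‖𝓕⁻ (g n) x‖ₑ) atTop :=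
        lintegral_congr fun x => ((h1 x).enorm.liminf_eq).symm
    _ ≤ liminf (fun n => kernelNorm (g n)) atTop :=
        lintegral_liminf_le fun n => (continuous_fourierInv (hi n)).measurable.enorm
    _ ≤ C := liminf_le_of_frequently_le' hC.frequently

/-- Dilating a multiplier dilates its kernel with the `L¹` normalization. This invariance reduces
every frequency annulus to a single fixed one. -/
theorem kernelNorm_comp_smul {c : ℝ} (hc : 0 < c) (g : V → ℂ) :
    kernelNorm (fun ξ => g (c • ξ)) = kernelNorm g := by
  have h1 : ∀ x, 𝓕⁻ (fun ξ => g (c • ξ)) x =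
      ((c ^ Module.finrank ℝ V)⁻¹ : ℝ) • 𝓕⁻ g (c⁻¹ • x) := by
    intro x
    simp only [fourierInv_apply]
    have := Measure.integral_comp_smul (volume : Measure V)
      (fun ξ => (Real.fourierChar ⟪ξ, c⁻¹ • x⟫ : ℂ) * g ξ) c
    rw [abs_of_pos (by positivity)] at this
    rw [← this]
    congr 1; ext ξ
    rw [inner_smul_left, inner_smul_right]
    simp [hc.ne']
  have h3 : ∫⁻ x, ‖𝓕⁻ g (c⁻¹ • x)‖ₑ = ENNReal.ofReal (c ^ Module.finrank ℝ V) * kernelNorm g := by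
    refine (lintegral_map_equiv (μ := volume) (fun x => ‖𝓕⁻ g x‖ₑ)
      (Homeomorph.smulOfNeZero (c⁻¹) (inv_ne_zero hc.ne')).toMeasurableEquiv).symm.trans ?_
    have : (volume : Measure V).map (Homeomorph.smulOfNeZero (c⁻¹)
        (inv_ne_zero hc.ne')).toMeasurableEquiv = ENNReal.ofReal (c ^ Module.finrank ℝ V) • volume := by
      have h4 := Measure.map_addHaar_smul (volume : Measure V) (inv_ne_zero hc.ne')
      rw [inv_pow, inv_inv, abs_of_pos (by positivity)] at h4
      exact h4
    rw [this, lintegral_smul_measure, kernelNorm, smul_eq_mul]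
  simp only [kernelNorm, h1, enorm_smul]
  rw [lintegral_const_mul' _ _ (by simp), h3, ← mul_assoc, kernelNorm]
  have : ‖((c ^ Module.finrank ℝ V)⁻¹ : ℝ)‖ₑ * ENNReal.ofReal (c ^ Module.finrank ℝ V) = 1 := by
    rw [Real.enorm_eq_ofReal (by positivity), ← ENNReal.ofReal_mul (by positivity),
      inv_mul_cancel₀ (by positivity), ENNReal.ofReal_one]
  rw [this, one_mul]

theorem continuous_schwartzSeminorm_sup {F : Type*} [NormedAddCommGroup F] [NormedSpace ℝ F]
    (S : Finset (ℕ × ℕ)) :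
    Continuous fun f : 𝓢(V, F) => (S.sup (schwartzSeminormFamily ℝ V F)) f := by
  classical
  induction S using Finset.induction_on with
  | empty => simpa using continuous_const
  | insert a s ha ih =>
    simp only [Finset.sup_insert, Seminorm.sup_apply]
    exact ((schwartz_withSeminorms ℝ V F).continuous_seminorm a).sup ih

/-- For Schwartz functions, `kernelNorm` is bounded by finitely many Schwartz seminorms. -/
theorem exists_kernelNorm_le_seminorm :
    ∃ (S : Finset (ℕ × ℕ)) (C : ℝ≥0), ∀ f : 𝓢(V, ℂ),
      kernelNorm f ≤ C * ENNReal.ofReal (S.sup (schwartzSeminormFamily ℝ V ℂ) f) := by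
  obtain ⟨k, C, hC⟩ := SchwartzMap.eLpNorm_le_seminorm ℝ ℂ (E := V) 1 volume
  -- The `L¹` norm is bounded by Schwartz seminorms of `𝓕⁻ f`. Pulled back along the continuous map
  -- `𝓕⁻` they stay continuous, hence are bounded by finitely many seminorms of `f`.
  set q : Seminorm ℝ 𝓢(V, ℂ) := ((Finset.Iic (k, 0)).sup (schwartzSeminormFamily ℝ V ℂ)).comp
    ((FourierTransform.fourierInvCLM ℝ 𝓢(V, ℂ)).toLinearMap) with hq
  have hqc : Continuous q := by
    exact (continuous_schwartzSeminorm_sup (F := ℂ) (Finset.Iic (k, 0))).comp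
      (FourierTransform.fourierInvCLM ℝ 𝓢(V, ℂ)).continuous
  obtain ⟨S, C', -, hS⟩ := Seminorm.bound_of_continuous (schwartz_withSeminorms ℝ V ℂ) q hqc
  refine ⟨S, C * C', fun f => ?_⟩
  have h1 := hC (𝓕⁻ f)
  rw [eLpNorm_one_eq_lintegral_enorm, SchwartzMap.fourierInv_coe] at h1
  refine h1.trans ?_
  have h2 : ((Finset.Iic (k, 0)).sup (schwartzSeminormFamily ℝ V ℂ)) (𝓕⁻ f) ≤
      C' * (S.sup (schwartzSeminormFamily ℝ V ℂ)) f := by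
    have := hS f
    simpa [hq, NNReal.smul_def] using this
  rw [ENNReal.coe_mul, mul_assoc]
  gcongr
  refine (ENNReal.ofReal_le_ofReal h2).trans ?_
  rw [ENNReal.ofReal_mul (by positivity)]
  simp

theorem kernelNorm_schwartz_ne_top (f : 𝓢(V, ℂ)) : kernelNorm f ≠ ⊤ := by
  obtain ⟨S, C, h⟩ := exists_kernelNorm_le_seminorm (V := V)
  exact ne_top_of_le_ne_top (ENNReal.mul_ne_top (by simp) (by simp)) (h f)

end KernelNorm

/-! ### Lévy exponents as multipliers: contraction and size bounds -/

section LevyExponent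

variable {V : Type*} [NormedAddCommGroup V] [InnerProductSpace ℝ V] [FiniteDimensional ℝ V]
  [MeasurableSpace V] [BorelSpace V]

/-- The exponent `∫ [1 - cos(2πξ·y)] ρ(dy)` of the symmetrization of `ρ`. -/
noncomputable def levyExp (ρ : Measure V) (ξ : V) : ℝ :=
  ∫ y, (1 - Real.cos (2 * Real.pi * ⟪ξ, y⟫)) ∂ρ

theorem one_sub_cos_nonneg (a : ℝ) : 0 ≤ 1 - Real.cos a := by
  linarith [Real.cos_le_one a]

theorem one_sub_cos_inner_le (ξ y : V) :
    1 - Real.cos (2 * Real.pi * ⟪ξ, y⟫) ≤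
      (2 * Real.pi ^ 2 * ‖ξ‖ ^ 2 + 2) * min (‖y‖ ^ 2) 1 := by
  have h1 := Real.one_sub_sq_div_two_le_cos (x := 2 * Real.pi * ⟪ξ, y⟫)
  have h2 := Real.neg_one_le_cos (2 * Real.pi * ⟪ξ, y⟫)
  have h3 : ⟪ξ, y⟫ ^ 2 ≤ ‖ξ‖ ^ 2 * ‖y‖ ^ 2 := by
    rw [← mul_pow]
    exact sq_le_sq' (by linarith [neg_le_of_abs_le (abs_real_inner_le_norm ξ y)])
      (real_inner_le_norm ξ y)
  have hpi : 0 ≤ 2 * Real.pi ^ 2 := by positivity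
  rcases min_cases (‖y‖ ^ 2) 1 with ⟨h, -⟩ | ⟨h, -⟩ <;> rw [h]
  · nlinarith [mul_le_mul_of_nonneg_left h3 hpi, sq_nonneg ‖y‖]
  · nlinarith [mul_nonneg hpi (sq_nonneg ‖ξ‖)]

theorem integrable_min_sq {ρ : Measure V}
    (hρ : ∫⁻ y, ENNReal.ofReal (min (‖y‖ ^ 2) 1) ∂ρ ≠ ⊤) :
    Integrable (fun y : V => min (‖y‖ ^ 2) 1) ρ := by
  refine ⟨Continuous.aestronglyMeasurable (by fun_prop), ?_⟩
  rw [hasFiniteIntegral_iff_ofReal (ae_of_all _ fun y => by positivity)]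
  exact hρ.lt_top

theorem integrable_one_sub_cos {ρ : Measure V}
    (hρ : ∫⁻ y, ENNReal.ofReal (min (‖y‖ ^ 2) 1) ∂ρ ≠ ⊤) (ξ : V) :
    Integrable (fun y : V => 1 - Real.cos (2 * Real.pi * ⟪ξ, y⟫)) ρ := by
  refine ((integrable_min_sq hρ).const_mul (2 * Real.pi ^ 2 * ‖ξ‖ ^ 2 + 2)).mono'
    (Continuous.aestronglyMeasurable (by fun_prop)) (ae_of_all _ fun y => ?_)
  rw [Real.norm_of_nonneg (one_sub_cos_nonneg _)]
  exact one_sub_cos_inner_le ξ y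

theorem levyExp_nonneg (ρ : Measure V) (ξ : V) : 0 ≤ levyExp ρ ξ :=
  integral_nonneg fun _ => one_sub_cos_nonneg _

theorem continuous_levyExp {ρ : Measure V}
    (hρ : ∫⁻ y, ENNReal.ofReal (min (‖y‖ ^ 2) 1) ∂ρ ≠ ⊤) : Continuous (levyExp ρ) := by
  rw [continuous_iff_continuousAt]
  intro ξ₀
  refine continuousAt_of_dominated
    (bound := fun y => (2 * Real.pi ^ 2 * (‖ξ₀‖ + 1) ^ 2 + 2) * min (‖y‖ ^ 2) 1) ?_ ?_
    ((integrable_min_sq hρ).const_mul _) ?_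
  · exact Eventually.of_forall fun ξ => Continuous.aestronglyMeasurable (by fun_prop)
  · filter_upwards [Metric.ball_mem_nhds ξ₀ one_pos] with ξ hξ
    have hξ' : ‖ξ‖ ≤ ‖ξ₀‖ + 1 := by
      have := norm_sub_norm_le ξ ξ₀
      rw [Metric.mem_ball, dist_eq_norm] at hξ
      linarith
    refine ae_of_all _ fun y => ?_
    rw [Real.norm_of_nonneg (one_sub_cos_nonneg _)]
    refine (one_sub_cos_inner_le ξ y).trans ?_
    gcongr
  · exact ae_of_all _ fun y => Continuous.continuousAt (by fun_prop)

theorem levyExp_add {ρ ν : Measure V}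
    (hρ : ∫⁻ y, ENNReal.ofReal (min (‖y‖ ^ 2) 1) ∂ρ ≠ ⊤)
    (hν : ∫⁻ y, ENNReal.ofReal (min (‖y‖ ^ 2) 1) ∂ν ≠ ⊤) (ξ : V) :
    levyExp (ρ + ν) ξ = levyExp ρ ξ + levyExp ν ξ :=
  integral_add_measure (integrable_one_sub_cos hρ ξ) (integrable_one_sub_cos hν ξ)

theorem levyExp_mono {ρ ν : Measure V} (h : ν ≤ ρ)
    (hρ : ∫⁻ y, ENNReal.ofReal (min (‖y‖ ^ 2) 1) ∂ρ ≠ ⊤) (ξ : V) :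
    levyExp ν ξ ≤ levyExp ρ ξ :=
  integral_mono_measure h (ae_of_all _ fun _ => one_sub_cos_nonneg _) (integrable_one_sub_cos hρ ξ)

/-- The part of `ρ` outside the ball of radius `1 / (n + 1)`. -/
noncomputable def outerPart (ρ : Measure V) (n : ℕ) : Measure V :=
  ρ.restrict {y | ((n : ℝ) + 1)⁻¹ < ‖y‖}

theorem measurableSet_lt_norm (r : ℝ) : MeasurableSet {y : V | r < ‖y‖} :=
  (isOpen_lt continuous_const continuous_norm).measurableSet

theorem isFiniteMeasure_restrict_lt_norm {ρ : Measure V}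
    (hρ : ∫⁻ y, ENNReal.ofReal (min (‖y‖ ^ 2) 1) ∂ρ ≠ ⊤) {r : ℝ} (hr : 0 < r) :
    IsFiniteMeasure (ρ.restrict {y | r < ‖y‖}) := by
  refine ⟨?_⟩
  rw [Measure.restrict_apply_univ]
  have h1 := meas_ge_le_lintegral_div (μ := ρ)
    (f := fun y => ENNReal.ofReal (min (‖y‖ ^ 2) 1)) (by fun_prop)
    (ε := ENNReal.ofReal (min (r ^ 2) 1)) (by simpa using hr.ne') (by simp)
  refine lt_of_le_of_lt ((measure_mono ?_).trans h1)
    (ENNReal.div_lt_top hρ (by simpa using hr.ne'))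
  intro y (hy : r < ‖y‖)
  simp only [mem_ofPred_eq]
  gcongr

theorem lintegral_min_sq_restrict_ne_top {ρ : Measure V}
    (hρ : ∫⁻ y, ENNReal.ofReal (min (‖y‖ ^ 2) 1) ∂ρ ≠ ⊤) (s : Set V) :
    ∫⁻ y, ENNReal.ofReal (min (‖y‖ ^ 2) 1) ∂(ρ.restrict s) ≠ ⊤ :=
  ne_top_of_le_ne_top hρ (lintegral_mono' Measure.restrict_le_self le_rfl)

theorem tendsto_levyExp_outerPart {ρ : Measure V}
    (hρ : ∫⁻ y, ENNReal.ofReal (min (‖y‖ ^ 2) 1) ∂ρ ≠ ⊤) (ξ : V) :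
    Tendsto (fun n => levyExp (outerPart ρ n) ξ) atTop (𝓝 (levyExp ρ ξ)) := by
  have h1 : ∀ n, levyExp (outerPart ρ n) ξ = ∫ y, ({y : V | ((n : ℝ) + 1)⁻¹ < ‖y‖}).indicator
      (fun y => 1 - Real.cos (2 * Real.pi * ⟪ξ, y⟫)) y ∂ρ := fun n =>
    (integral_indicator (measurableSet_lt_norm _)).symm
  simp only [h1]
  refine tendsto_integral_of_dominated_convergence
    (fun y => 1 - Real.cos (2 * Real.pi * ⟪ξ, y⟫)) (fun n => ?_) (integrable_one_sub_cos hρ ξ)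
    (fun n => ae_of_all _ fun y => ?_) (ae_of_all _ fun y => ?_)
  · exact (Continuous.aestronglyMeasurable (by fun_prop)).indicator (measurableSet_lt_norm _)
  · rw [Set.indicator_apply]
    split_ifs
    · rw [Real.norm_of_nonneg (one_sub_cos_nonneg _)]
    · simpa using one_sub_cos_nonneg _
  -- The origin lies in no truncation, but the integrand vanishes there.
  · rcases eq_or_ne y 0 with rfl | hy
    · simp [Set.indicator_apply]
    · refine tendsto_const_nhds.congr' ?_
      have h2 : Tendsto (fun n : ℕ => ((n : ℝ) + 1)⁻¹) atTop (𝓝 0) := by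
        simpa using tendsto_one_div_add_atTop_nhds_zero_nat (𝕜 := ℝ)
      filter_upwards [h2.eventually_lt_const (norm_pos_iff.2 hy)] with n hn
      rw [Set.indicator_of_mem (show y ∈ {y : V | ((n : ℝ) + 1)⁻¹ < ‖y‖} from hn)]

theorem kernelNorm_integral_cos_mul_le (ρ : Measure V) [IsFiniteMeasure ρ] {g : V → ℂ}
    (hc : Continuous g) (hg : Integrable g) :
    kernelNorm (fun ξ => (∫ y, Real.cos (2 * Real.pi * ⟪ξ, y⟫) ∂ρ : ℝ) * g ξ) ≤
      ρ univ * kernelNorm g := by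
  have h1 : (fun ξ => ((∫ y, Real.cos (2 * Real.pi * ⟪ξ, y⟫) ∂ρ : ℝ) : ℂ) * g ξ) =
      fun ξ => ∫ y, (Real.cos (2 * Real.pi * ⟪ξ, y⟫) : ℂ) * g ξ ∂ρ := by
    ext ξ
    rw [integral_mul_const, integral_complex_ofReal]
  have hcont : Continuous (Function.uncurry fun (y ξ : V) =>
      (Real.cos (2 * Real.pi * ⟪ξ, y⟫) : ℂ) * g ξ) := by
    simp only [Function.uncurry_def]
    fun_prop
  rw [h1]
  refine (kernelNorm_integral_le ρ hcont.stronglyMeasurable ?_).trans ?_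
  · refine (hg.comp_snd ρ).bdd_mul (c := 1)
      (f := fun z : V × V => (Real.cos (2 * Real.pi * ⟪z.2, z.1⟫) : ℂ)) ?_ ?_
    · exact Continuous.aestronglyMeasurable (by fun_prop)
    · refine ae_of_all _ fun z => ?_
      rw [Complex.norm_real]
      exact Real.abs_cos_le_one _
  · refine (lintegral_mono fun y => kernelNorm_cos_mul_le y hg).trans ?_
    rw [lintegral_const, mul_comm]

theorem levyExp_eq_sub (ρ : Measure V) [IsFiniteMeasure ρ] (ξ : V) :
    levyExp ρ ξ = ρ.real univ - ∫ y, Real.cos (2 * Real.pi * ⟪ξ, y⟫) ∂ρ := by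
  rw [levyExp, integral_sub (integrable_const _)]
  · simp
  · refine Integrable.of_bound (Continuous.aestronglyMeasurable (by fun_prop)) 1
      (ae_of_all _ fun y => Real.abs_cos_le_one _)

theorem lintegral_min_sq_ne_top_of_finite (ρ : Measure V) [IsFiniteMeasure ρ] :
    ∫⁻ y, ENNReal.ofReal (min (‖y‖ ^ 2) 1) ∂ρ ≠ ⊤ := by
  refine ne_top_of_le_ne_top (b := ∫⁻ y, 1 ∂ρ) (by simp) (lintegral_mono fun y => ?_)
  rw [← ENNReal.ofReal_one]
  exact ENNReal.ofReal_le_ofReal (min_le_right _ _)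

theorem levyExp_le_of_finite (ρ : Measure V) [IsFiniteMeasure ρ] (ξ : V) :
    levyExp ρ ξ ≤ 2 * ρ.real univ := by
  rw [levyExp_eq_sub]
  have : ‖∫ y, Real.cos (2 * Real.pi * ⟪ξ, y⟫) ∂ρ‖ ≤ 1 * ρ.real univ :=
    norm_integral_le_of_norm_le_const (ae_of_all _ fun y => Real.abs_cos_le_one _)
  rw [Real.norm_eq_abs] at this
  linarith [neg_le_of_abs_le this]

/-- With `m` the total mass, `1 - aψ = (1 - am) + a ∫ cos`. The condition `am ≤ 1` makes both
coefficients nonnegative, so the costs of the two terms add up to exactly one. -/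
theorem kernelNorm_one_sub_levyExp_mul_le (ρ : Measure V) [IsFiniteMeasure ρ] {a : ℝ} (ha : 0 ≤ a)
    (ham : a * ρ.real univ ≤ 1) {g : V → ℂ} (hc : Continuous g) (hg : Integrable g) :
    kernelNorm (fun ξ => ((1 - a * levyExp ρ ξ : ℝ) : ℂ) * g ξ) ≤ kernelNorm g := by
  set m := ρ.real univ with hm
  have hm0 : 0 ≤ m := measureReal_nonneg
  have hC : Continuous fun ξ => ∫ y, Real.cos (2 * Real.pi * ⟪ξ, y⟫) ∂ρ := by
    have h := continuous_levyExp (lintegral_min_sq_ne_top_of_finite ρ)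
    have : (fun ξ => ∫ y, Real.cos (2 * Real.pi * ⟪ξ, y⟫) ∂ρ) = fun ξ => m - levyExp ρ ξ := by
      ext ξ; rw [levyExp_eq_sub]; ring
    rw [this]; fun_prop
  have h1 : (fun ξ => ((1 - a * levyExp ρ ξ : ℝ) : ℂ) * g ξ) = fun ξ =>
      ((1 - a * m : ℝ) : ℂ) * g ξ +
        (a : ℂ) * ((∫ y, Real.cos (2 * Real.pi * ⟪ξ, y⟫) ∂ρ : ℝ) * g ξ) := by
    ext ξ
    rw [levyExp_eq_sub]
    push_cast
    ring
  have hi : Integrable fun ξ => ((∫ y, Real.cos (2 * Real.pi * ⟪ξ, y⟫) ∂ρ : ℝ) : ℂ) * g ξ := by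
    refine hg.bdd_mul (c := 1 * m) (Continuous.aestronglyMeasurable (by fun_prop))
      (ae_of_all _ fun ξ => ?_)
    rw [Complex.norm_real]
    exact norm_integral_le_of_norm_le_const (ae_of_all _ fun y => Real.abs_cos_le_one _)
  rw [h1]
  refine (kernelNorm_add_le (hg.const_mul _) (hi.const_mul _)).trans ?_
  rw [kernelNorm_const_mul, kernelNorm_const_mul]
  refine (add_le_add_right (mul_le_mul_right (kernelNorm_integral_cos_mul_le ρ hc hg) _) _).trans ?_
  rw [← mul_assoc, ← add_mul]
  have h2 : ‖((1 - a * m : ℝ) : ℂ)‖ₑ + ‖(a : ℂ)‖ₑ * ρ univ = 1 := by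
    have h3 : ρ univ = ENNReal.ofReal m := by simp [hm]
    rw [← ofReal_norm, ← ofReal_norm, Complex.norm_real, Complex.norm_real,
      Real.norm_of_nonneg (by linarith), Real.norm_of_nonneg ha, h3, ← ENNReal.ofReal_mul ha,
      ← ENNReal.ofReal_add (by linarith) (by positivity), sub_add_cancel, ENNReal.ofReal_one]
  rw [h2, one_mul]

/-- Euler's limit `exp(-tψ) = lim (1 - tψ/n)^n`: each factor is a contraction once `n ≥ tm`, and
Fatou's lemma passes to the limit. -/
theorem kernelNorm_exp_neg_levyExp_mul_le_of_finite (ρ : Measure V) [IsFiniteMeasure ρ] {t : ℝ}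
    (ht : 0 ≤ t) {g : V → ℂ} (hc : Continuous g) (hg : Integrable g) :
    kernelNorm (fun ξ => (Real.exp (-t * levyExp ρ ξ) : ℂ) * g ξ) ≤ kernelNorm g := by
  set m := ρ.real univ with hm
  have hm0 : 0 ≤ m := measureReal_nonneg
  -- Shifting the index to `n + n₀ + 1` makes `tm/n ≤ 1` hold for every term of the sequence, and
  -- keeps the denominator positive.
  obtain ⟨n₀, hn₀⟩ := exists_nat_ge (t * m)
  have hψ := continuous_levyExp (lintegral_min_sq_ne_top_of_finite ρ)
  have hbd : ∀ (n : ℕ) (ξ : V), |1 - t / ((n + n₀ + 1 : ℕ) : ℝ) * levyExp ρ ξ| ≤ 1 := by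
    intro n ξ
    have h1 := levyExp_nonneg ρ ξ
    have h2 : levyExp ρ ξ ≤ 2 * m := levyExp_le_of_finite ρ ξ
    have h3 : t / ((n + n₀ + 1 : ℕ) : ℝ) * m ≤ 1 := by
      rw [div_mul_eq_mul_div, div_le_one (by positivity)]
      push_cast
      linarith [(Nat.cast_nonneg n : (0 : ℝ) ≤ n)]
    have h4 : 0 ≤ t / ((n + n₀ + 1 : ℕ) : ℝ) := by positivity
    rw [abs_le]
    constructor <;> nlinarith [mul_le_mul_of_nonneg_left h2 h4, mul_nonneg h4 h1]
  have key : ∀ (n k : ℕ), kernelNorm (fun ξ =>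
      (((1 - t / ((n + n₀ + 1 : ℕ) : ℝ) * levyExp ρ ξ) ^ k : ℝ) : ℂ) * g ξ) ≤ kernelNorm g := by
    intro n k
    induction k with
    | zero => simp
    | succ k ih =>
      refine le_trans (le_trans (le_of_eq ?_) (kernelNorm_one_sub_levyExp_mul_le ρ
        (a := t / ((n + n₀ + 1 : ℕ) : ℝ)) (by positivity) ?_ (g := fun ξ =>
        (((1 - t / ((n + n₀ + 1 : ℕ) : ℝ) * levyExp ρ ξ) ^ k : ℝ) : ℂ) * g ξ) ?_ ?_)) ih
      · congr 1; ext ξ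
        rw [← mul_assoc, ← Complex.ofReal_mul, ← pow_succ']
      · rw [div_mul_eq_mul_div, div_le_one (by positivity)]
        push_cast
        linarith [(Nat.cast_nonneg n : (0 : ℝ) ≤ n)]
      · fun_prop
      · refine hg.bdd_mul (c := 1) (Continuous.aestronglyMeasurable (by fun_prop))
          (ae_of_all _ fun ξ => ?_)
        rw [Complex.norm_real, norm_pow]
        exact pow_le_one₀ (norm_nonneg _) (hbd n ξ)
  refine kernelNorm_le_of_tendsto hg.norm (g := fun n ξ =>
    (((1 - t / ((n + n₀ + 1 : ℕ) : ℝ) * levyExp ρ ξ) ^ (n + n₀ + 1) : ℝ) : ℂ) * g ξ)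
    (fun n => Continuous.aestronglyMeasurable (by fun_prop)) (fun n ξ => ?_) (fun ξ => ?_)
    (Eventually.of_forall fun n => key n _)
  · rw [norm_mul, Complex.norm_real, norm_pow]
    exact mul_le_of_le_one_left (norm_nonneg _) (pow_le_one₀ (norm_nonneg _) (hbd n ξ))
  · refine Tendsto.mul_const _ ((Complex.continuous_ofReal.tendsto _).comp ?_)
    have h1 := (Real.tendsto_one_add_div_pow_exp (-t * levyExp ρ ξ)).comp
      (tendsto_add_atTop_nat (n₀ + 1))
    refine h1.congr fun n => ?_
    simp only [Function.comp_apply, ← add_assoc]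
    congr 1
    ring

/-- The multiplier `exp(-tψ)` is a contraction for `kernelNorm`. -/
theorem kernelNorm_exp_neg_levyExp_mul_le {ρ : Measure V}
    (hρ : ∫⁻ y, ENNReal.ofReal (min (‖y‖ ^ 2) 1) ∂ρ ≠ ⊤) {t : ℝ}
    (ht : 0 ≤ t) {g : V → ℂ} (hc : Continuous g) (hg : Integrable g) :
    kernelNorm (fun ξ => (Real.exp (-t * levyExp ρ ξ) : ℂ) * g ξ) ≤ kernelNorm g := by
  have hfin : ∀ n, IsFiniteMeasure (outerPart ρ n) := fun n =>
    isFiniteMeasure_restrict_lt_norm hρ (by positivity)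
  refine kernelNorm_le_of_tendsto hg.norm (g := fun n ξ =>
    (Real.exp (-t * levyExp (outerPart ρ n) ξ) : ℂ) * g ξ)
    (fun n => ?_) (fun n ξ => ?_) (fun ξ => ?_)
    (Eventually.of_forall fun n => kernelNorm_exp_neg_levyExp_mul_le_of_finite _ ht hc hg)
  · have := continuous_levyExp (lintegral_min_sq_restrict_ne_top hρ
      {y : V | ((n : ℝ) + 1)⁻¹ < ‖y‖})
    have h2 : Continuous (levyExp (outerPart ρ n)) := this
    exact Continuous.aestronglyMeasurable (by fun_prop)
  · rw [norm_mul, Complex.norm_real]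
    refine mul_le_of_le_one_left (norm_nonneg _) ?_
    rw [Real.norm_of_nonneg (Real.exp_nonneg _), Real.exp_le_one_iff]
    nlinarith [mul_nonneg ht (levyExp_nonneg (outerPart ρ n) ξ)]
  · refine Tendsto.mul_const _ ((Complex.continuous_ofReal.tendsto _).comp ?_)
    exact (Real.continuous_exp.tendsto _).comp ((tendsto_levyExp_outerPart hρ ξ).const_mul _)

/-- Taylor's formula with integral remainder. It displays `1 - cos` as `a²` times an average of
cosines, which are harmless as multipliers. -/
theorem one_sub_cos_eq_integral (a : ℝ) :
    1 - Real.cos a = ∫ θ in (0 : ℝ)..1, (1 - θ) * a ^ 2 * Real.cos (θ * a) := by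
  have h : ∀ θ ∈ uIcc (0 : ℝ) 1, HasDerivAt
      (fun θ => (1 - θ) * (a * Real.sin (θ * a)) - Real.cos (θ * a))
      ((1 - θ) * a ^ 2 * Real.cos (θ * a)) θ := by
    intro θ _
    have h0 : HasDerivAt (fun θ : ℝ => θ * a) a θ := by simpa using (hasDerivAt_id θ).mul_const a
    have h1 : HasDerivAt (fun θ : ℝ => 1 - θ) (-1) θ := by
      simpa using (hasDerivAt_id θ).const_sub 1
    have h2 := (h1.mul (h0.sin.const_mul a)).sub h0.cos
    refine h2.congr_deriv ?_
    ring
  rw [intervalIntegral.integral_eq_sub_of_hasDerivAt h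
    (Continuous.intervalIntegrable (by fun_prop) _ _)]
  simp
  ring

theorem kernelNorm_compactSupport_ne_top {g : V → ℂ} (h1 : ContDiff ℝ ∞ g)
    (h2 : HasCompactSupport g) : kernelNorm g ≠ ⊤ :=
  kernelNorm_schwartz_ne_top (h2.toSchwartzMap h1)

/-- In an orthonormal basis `⟪ξ, y⟫²` is a combination of finitely many fixed symbols `ξ_i ξ_j ζ`,
with coefficients bounded by `‖y‖²`. -/
theorem exists_kernelNorm_inner_sq_mul_le {ζ : V → ℂ} (h1 : ContDiff ℝ ∞ ζ)
    (h2 : HasCompactSupport ζ) :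
    ∃ C : ℝ≥0, ∀ y : V, kernelNorm (fun ξ => ((⟪ξ, y⟫ ^ 2 : ℝ) : ℂ) * ζ ξ) ≤
      C * ENNReal.ofReal (‖y‖ ^ 2) := by
  set b := stdOrthonormalBasis ℝ V
  set h : Fin (Module.finrank ℝ V) → Fin (Module.finrank ℝ V) → V → ℂ := fun i j ξ =>
    ((⟪ξ, b i⟫ * ⟪ξ, b j⟫ : ℝ) : ℂ) * ζ ξ with hh
  have hcd : ∀ i j, ContDiff ℝ ∞ (h i j) := by
    intro i j
    refine ContDiff.mul (Complex.ofRealCLM.contDiff.comp (ContDiff.mul ?_ ?_)) h1 <;>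
    exact contDiff_id.inner ℝ contDiff_const
  have hcs : ∀ i j, HasCompactSupport (h i j) := fun i j => h2.mul_left
  have hK : ∀ i j, kernelNorm (h i j) ≠ ⊤ := fun i j =>
    kernelNorm_compactSupport_ne_top (hcd i j) (hcs i j)
  have hI : ∀ i j, Integrable (h i j) := fun i j =>
    (hcd i j).continuous.integrable_of_hasCompactSupport (hcs i j)
  refine ⟨∑ i, ∑ j, (kernelNorm (h i j)).toNNReal, fun y => ?_⟩
  have hexp : (fun ξ => ((⟪ξ, y⟫ ^ 2 : ℝ) : ℂ) * ζ ξ) = fun ξ =>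
      ∑ i, ∑ j, ((⟪b i, y⟫ * ⟪b j, y⟫ : ℝ) : ℂ) * h i j ξ := by
    ext ξ
    have : ⟪ξ, y⟫ = ∑ i, ⟪ξ, b i⟫ * ⟪b i, y⟫ := (b.sum_inner_mul_inner ξ y).symm
    rw [this, sq, Finset.sum_mul_sum]
    push_cast
    rw [Finset.sum_mul]
    refine Finset.sum_congr rfl fun i _ => ?_
    rw [Finset.sum_mul]
    refine Finset.sum_congr rfl fun j _ => ?_
    simp only [hh]
    push_cast
    ring
  rw [hexp]
  refine (kernelNorm_sum_le _ fun i _ => integrable_finsetSum _ fun j _ =>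
    (hI i j).const_mul _).trans ?_
  push_cast
  rw [Finset.sum_mul]
  refine Finset.sum_le_sum fun i _ => ?_
  refine (kernelNorm_sum_le _ fun j _ => (hI i j).const_mul _).trans ?_
  rw [Finset.sum_mul]
  refine Finset.sum_le_sum fun j _ => ?_
  rw [kernelNorm_const_mul, ENNReal.coe_toNNReal (hK i j), mul_comm]
  gcongr
  rw [← ofReal_norm, norm_mul, Complex.norm_real, Complex.norm_real]
  refine ENNReal.ofReal_le_ofReal ?_
  rw [sq]
  have : ∀ i, ‖⟪b i, y⟫‖ ≤ ‖y‖ := fun i => by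
    simpa [b.norm_eq_one i] using norm_inner_le_norm (𝕜 := ℝ) (b i) y
  exact mul_le_mul (this i) (this j) (norm_nonneg _) (norm_nonneg _)

/-- The bound `‖y‖²` comes from the Taylor remainder, the bound by a constant from the two terms
separately. Their minimum is the weight against which a Lévy measure is integrable. -/
theorem exists_kernelNorm_one_sub_cos_mul_le {ζ : V → ℂ} (h1 : ContDiff ℝ ∞ ζ)
    (h2 : HasCompactSupport ζ) :
    ∃ C : ℝ≥0, ∀ y : V, kernelNorm (fun ξ =>
      ((1 - Real.cos (2 * Real.pi * ⟪ξ, y⟫) : ℝ) : ℂ) * ζ ξ) ≤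
        C * ENNReal.ofReal (min (‖y‖ ^ 2) 1) := by
  obtain ⟨C, hC⟩ := exists_kernelNorm_inner_sq_mul_le h1 h2
  have hζi : Integrable ζ := h1.continuous.integrable_of_hasCompactSupport h2
  have hKζ := kernelNorm_compactSupport_ne_top h1 h2
  have hζc := h1.continuous
  -- The factor `(2π)²` is the second derivative of `cos(2π·)`; the weight `1 - θ` is bounded by one
  -- on an interval of length one. The constant `B` counts `ζ` and `cos · ζ` once each.
  set A : ℝ≥0 := Real.toNNReal ((2 * Real.pi) ^ 2) * C
  set B : ℝ≥0 := 2 * (kernelNorm ζ).toNNReal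
  have hsmall : ∀ y : V, kernelNorm (fun ξ =>
      ((1 - Real.cos (2 * Real.pi * ⟪ξ, y⟫) : ℝ) : ℂ) * ζ ξ) ≤ A * ENNReal.ofReal (‖y‖ ^ 2) := by
    intro y
    set H : V → ℂ := fun ξ => ((⟪ξ, y⟫ ^ 2 : ℝ) : ℂ) * ζ ξ with hH
    have hHc : Continuous H := by simp only [hH]; fun_prop
    have hHi : Integrable H := hHc.integrable_of_hasCompactSupport h2.mul_left
    set F : ℝ → V → ℂ := fun θ ξ => (((1 - θ) * (2 * Real.pi) ^ 2 : ℝ) : ℂ) *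
      ((Real.cos (2 * Real.pi * ⟪ξ, θ • y⟫) : ℂ) * H ξ) with hF
    have hFc : Continuous (Function.uncurry F) := by
      simp only [hF, Function.uncurry_def]; fun_prop
    have hFi : Integrable (Function.uncurry F)
        ((volume.restrict (Ioc (0 : ℝ) 1)).prod (volume : Measure V)) := by
      refine ((hHi.comp_snd (volume.restrict (Ioc (0 : ℝ) 1))).norm.const_mul
        ((2 * Real.pi) ^ 2)).mono' hFc.aestronglyMeasurable ?_
      have hae : ∀ᵐ z : ℝ × V ∂((volume.restrict (Ioc (0 : ℝ) 1)).prod (volume : Measure V)),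
          z.1 ∈ Ioc (0 : ℝ) 1 :=
        Measure.quasiMeasurePreserving_fst.ae (ae_restrict_mem measurableSet_Ioc)
      filter_upwards [hae] with z hz
      simp only [hF, Function.uncurry_def]
      rw [norm_mul, norm_mul, Complex.norm_real, Complex.norm_real, norm_mul,
        Real.norm_of_nonneg (by linarith [hz.2] : 0 ≤ 1 - z.1), Real.norm_of_nonneg (by positivity)]
      have h3 : ‖Real.cos (2 * Real.pi * ⟪z.2, z.1 • y⟫)‖ ≤ 1 := Real.abs_cos_le_one _
      have h4 : 1 - z.1 ≤ 1 := by linarith [hz.1]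
      have h5 : 0 ≤ 1 - z.1 := by linarith [hz.2]
      calc (1 - z.1) * (2 * Real.pi) ^ 2 * (‖Real.cos (2 * Real.pi * ⟪z.2, z.1 • y⟫)‖ * ‖H z.2‖)
          ≤ 1 * (2 * Real.pi) ^ 2 * (1 * ‖H z.2‖) := by gcongr
        _ = _ := by ring
    have heq : (fun ξ => ((1 - Real.cos (2 * Real.pi * ⟪ξ, y⟫) : ℝ) : ℂ) * ζ ξ) =
        fun ξ => ∫ θ in Ioc (0 : ℝ) 1, F θ ξ := by
      ext ξ
      rw [one_sub_cos_eq_integral, intervalIntegral.integral_of_le zero_le_one,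
        ← integral_complex_ofReal, ← integral_mul_const]
      refine integral_congr_ae (ae_of_all _ fun θ => ?_)
      simp only [hF, hH, inner_smul_right]
      push_cast
      ring_nf
    rw [heq]
    refine (kernelNorm_integral_le _ hFc.stronglyMeasurable hFi).trans ?_
    have hpt : ∀ θ ∈ Ioc (0 : ℝ) 1, kernelNorm (F θ) ≤ A * ENNReal.ofReal (‖y‖ ^ 2) := by
      intro θ hθ
      simp only [hF]
      rw [kernelNorm_const_mul]
      have h6 : ‖(((1 - θ) * (2 * Real.pi) ^ 2 : ℝ) : ℂ)‖ₑ ≤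
          ENNReal.ofReal ((2 * Real.pi) ^ 2) := by
        rw [← ofReal_norm, Complex.norm_real, norm_mul,
          Real.norm_of_nonneg (by linarith [hθ.2] : 0 ≤ 1 - θ),
          Real.norm_of_nonneg (by positivity)]
        refine ENNReal.ofReal_le_ofReal (mul_le_of_le_one_left (by positivity) ?_)
        linarith [hθ.1]
      calc _ ≤ ENNReal.ofReal ((2 * Real.pi) ^ 2) * (C * ENNReal.ofReal (‖y‖ ^ 2)) := by
            refine mul_le_mul' h6 ((kernelNorm_cos_mul_le (θ • y) hHi).trans (hC y))
        _ = _ := by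
            rw [← mul_assoc, ENNReal.coe_mul]; rfl
    refine (setLIntegral_mono measurable_const hpt).trans ?_
    simp
  have hlarge : ∀ y : V, kernelNorm (fun ξ =>
      ((1 - Real.cos (2 * Real.pi * ⟪ξ, y⟫) : ℝ) : ℂ) * ζ ξ) ≤ B := by
    intro y
    have heq : (fun ξ => ((1 - Real.cos (2 * Real.pi * ⟪ξ, y⟫) : ℝ) : ℂ) * ζ ξ) = fun ξ =>
        ζ ξ + (-1) * ((Real.cos (2 * Real.pi * ⟪ξ, y⟫) : ℂ) * ζ ξ) := by
      ext ξ; push_cast; ring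
    have hci : Integrable fun ξ => (Real.cos (2 * Real.pi * ⟪ξ, y⟫) : ℂ) * ζ ξ :=
      Continuous.integrable_of_hasCompactSupport (by fun_prop) h2.mul_left
    rw [heq]
    refine (kernelNorm_add_le hζi (hci.const_mul _)).trans ?_
    rw [kernelNorm_const_mul]
    refine (add_le_add_right (mul_le_mul_right (kernelNorm_cos_mul_le y hζi) _) _).trans ?_
    have : ‖(-1 : ℂ)‖ₑ = 1 := by simp
    rw [this, one_mul, ← two_mul]
    simp only [B]
    push_cast
    rw [ENNReal.coe_toNNReal hKζ]
  refine ⟨max A B, fun y => ?_⟩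
  rcases min_cases (‖y‖ ^ 2) 1 with ⟨h, -⟩ | ⟨h, -⟩ <;> rw [h]
  · exact (hsmall y).trans (by gcongr; exact le_max_left _ _)
  · rw [ENNReal.ofReal_one, mul_one]
    exact (hlarge y).trans (by gcongr; exact le_max_right _ _)

/-- For finite measures this is Minkowski's inequality over `y`. The general case removes small
balls around the origin and uses Fatou's lemma. The constant depends on the cutoff only, which gives
uniformity over all rescaled measures. -/
theorem exists_kernelNorm_levyExp_mul_le {ζ : V → ℂ} (h1 : ContDiff ℝ ∞ ζ)
    (h2 : HasCompactSupport ζ) :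
    ∃ C : ℝ≥0, ∀ ρ : Measure V, ∫⁻ y, ENNReal.ofReal (min (‖y‖ ^ 2) 1) ∂ρ ≠ ⊤ →
      kernelNorm (fun ξ => (levyExp ρ ξ : ℂ) * ζ ξ) ≤
        C * ∫⁻ y, ENNReal.ofReal (min (‖y‖ ^ 2) 1) ∂ρ := by
  obtain ⟨C, hC⟩ := exists_kernelNorm_one_sub_cos_mul_le h1 h2
  have hζc := h1.continuous
  have hζi : Integrable ζ := hζc.integrable_of_hasCompactSupport h2
  have hfinite : ∀ ρ : Measure V, IsFiniteMeasure ρ →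
      kernelNorm (fun ξ => (levyExp ρ ξ : ℂ) * ζ ξ) ≤
        C * ∫⁻ y, ENNReal.ofReal (min (‖y‖ ^ 2) 1) ∂ρ := by
    intro ρ hfin
    have heq : (fun ξ => (levyExp ρ ξ : ℂ) * ζ ξ) = fun ξ =>
        ∫ y, ((1 - Real.cos (2 * Real.pi * ⟪ξ, y⟫) : ℝ) : ℂ) * ζ ξ ∂ρ := by
      ext ξ
      rw [integral_mul_const, integral_complex_ofReal, levyExp]
    have hcont : Continuous (Function.uncurry fun (y ξ : V) =>
        ((1 - Real.cos (2 * Real.pi * ⟪ξ, y⟫) : ℝ) : ℂ) * ζ ξ) := by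
      simp only [Function.uncurry_def]; fun_prop
    rw [heq]
    refine (kernelNorm_integral_le ρ hcont.stronglyMeasurable ?_).trans ?_
    · refine (hζi.comp_snd ρ).bdd_mul (c := 2)
        (f := fun z : V × V => ((1 - Real.cos (2 * Real.pi * ⟪z.2, z.1⟫) : ℝ) : ℂ)) ?_ ?_
      · exact Continuous.aestronglyMeasurable (by fun_prop)
      · refine ae_of_all _ fun z => ?_
        rw [Complex.norm_real, Real.norm_of_nonneg (one_sub_cos_nonneg _)]
        linarith [Real.neg_one_le_cos (2 * Real.pi * ⟪z.2, z.1⟫)]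
    · refine (lintegral_mono hC).trans ?_
      rw [lintegral_const_mul _ (by fun_prop)]
  refine ⟨C, fun ρ hρ => ?_⟩
  have hψ := continuous_levyExp hρ
  have hGi : Integrable fun ξ => levyExp ρ ξ * ‖ζ ξ‖ :=
    Continuous.integrable_of_hasCompactSupport (by fun_prop) h2.norm.mul_left
  refine kernelNorm_le_of_tendsto hGi (g := fun n ξ => (levyExp (outerPart ρ n) ξ : ℂ) * ζ ξ)
    (fun n => ?_) (fun n ξ => ?_) (fun ξ => ?_) (Eventually.of_forall fun n => ?_)
  · have h3 : Continuous (levyExp (outerPart ρ n)) :=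
      continuous_levyExp (lintegral_min_sq_restrict_ne_top hρ _)
    exact Continuous.aestronglyMeasurable (by fun_prop)
  · rw [norm_mul, Complex.norm_real, Real.norm_of_nonneg (levyExp_nonneg _ _)]
    gcongr
    exact levyExp_mono Measure.restrict_le_self hρ ξ
  · exact Tendsto.mul_const _ ((Complex.continuous_ofReal.tendsto _).comp
      (tendsto_levyExp_outerPart hρ ξ))
  · refine (hfinite _ (isFiniteMeasure_restrict_lt_norm hρ (by positivity))).trans ?_
    gcongr
    exact Measure.restrict_le_self

end LevyExponent

/-! ### Exponential decay of semigroups, and powers of symbols -/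

section Multipliers

variable {V : Type*} [NormedAddCommGroup V] [InnerProductSpace ℝ V] [FiniteDimensional ℝ V]
  [MeasurableSpace V] [BorelSpace V]

/-- Up to a constant the exponent is minus the real part of the characteristic function at `2πξ`,
and bounded support gives moments of all orders. -/
theorem contDiff_levyExp_of_bounded (ν : Measure V) [IsFiniteMeasure ν] {r : ℝ}
    (hr : ∀ᵐ y ∂ν, ‖y‖ ≤ r) : ContDiff ℝ ∞ (levyExp ν) := by
  have h1 : ContDiff ℝ ∞ (charFun ν) :=
    contDiff_charFun' (n := ⊤) fun k => MemLp.of_bound aestronglyMeasurable_id r hr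
  have h2 : levyExp ν = fun ξ => ν.real univ - (charFun ν ((2 * Real.pi) • ξ)).re := by
    ext ξ
    rw [levyExp_eq_sub, charFun_apply]
    congr 1
    have hi : Integrable (fun y : V => Complex.exp ((⟪y, (2 * Real.pi) • ξ⟫ : ℝ) * Complex.I)) ν := by
      refine Integrable.of_bound (Continuous.aestronglyMeasurable (by fun_prop)) 1
        (ae_of_all _ fun y => ?_)
      rw [Complex.norm_exp_ofReal_mul_I]
    have h3 := integral_re hi
    simp only [RCLike.re_to_complex] at h3
    rw [← h3]
    refine integral_congr_ae (ae_of_all _ fun y => ?_)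
    simp only []
    rw [Complex.exp_ofReal_mul_I_re, inner_smul_right, real_inner_comm]
  rw [h2]
  exact contDiff_const.sub (Complex.reCLM.contDiff.comp (h1.comp (contDiff_const_smul _)))

theorem norm_iteratedFDeriv_realExp (n : ℕ) (x : ℝ) :
    ‖iteratedFDeriv ℝ n Real.exp x‖ = Real.exp x := by
  rw [norm_iteratedFDeriv_eq_norm_iteratedDeriv, iteratedDeriv_eq_iterate, Real.iter_deriv_exp,
    Real.norm_of_nonneg (Real.exp_nonneg _)]

theorem one_add_mul_pow_le_exp (n : ℕ) {M c : ℝ} (hM : 0 ≤ M) (hc : 0 < c) :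
    ∃ A : ℝ, 0 ≤ A ∧ ∀ t : ℝ, 0 ≤ t → (1 + t * M) ^ n ≤ A * Real.exp (c * t) := by
  set δ := c / (M + 1) with hδ
  have hδ0 : 0 < δ := by positivity
  -- From `x^n / n! ≤ e^x` at `x = (1 + tM)δ`, where `δ = c/(M + 1)` is small enough for `Mδ ≤ c`.
  refine ⟨n.factorial * δ⁻¹ ^ n * Real.exp δ, by positivity, fun t ht => ?_⟩
  have h1 := Real.pow_div_factorial_le_exp ((1 + t * M) * δ) (by positivity) n
  have h2 : (1 + t * M) * δ ≤ δ + c * t := by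
    have : M * δ ≤ c := by
      rw [hδ, mul_div_assoc', div_le_iff₀ (by positivity)]; nlinarith
    nlinarith
  have h3 := h1.trans (Real.exp_le_exp.2 h2)
  rw [div_le_iff₀ (by positivity), mul_pow, Real.exp_add] at h3
  calc (1 + t * M) ^ n = ((1 + t * M) ^ n * δ ^ n) * δ⁻¹ ^ n := by
        rw [mul_assoc, ← mul_pow, mul_inv_cancel₀ hδ0.ne', one_pow, mul_one]
    _ ≤ (Real.exp δ * Real.exp (c * t) * n.factorial) * δ⁻¹ ^ n := by gcongr
    _ = _ := by ring

/-- Each derivative of `exp(-tψ)` costs at most a power of `t`. Half of the decay `e^{-ct}`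
available on the support of `ζ` pays for these powers, hence the rate `c/2`. -/
theorem exists_seminorm_exp_smul_le {ψ : V → ℝ} (hψ : ContDiff ℝ ∞ ψ) {ζ : V → ℂ}
    (h1 : ContDiff ℝ ∞ ζ) (h2 : HasCompactSupport ζ) {c : ℝ} (hc : 0 < c)
    (hle : ∀ ξ ∈ tsupport ζ, c ≤ ψ ξ) (k n : ℕ) :
    ∃ A : ℝ, 0 ≤ A ∧ ∀ t : ℝ, 0 ≤ t → ∀ ξ : V,
      ‖ξ‖ ^ k * ‖iteratedFDeriv ℝ n (fun ξ => Real.exp (-t * ψ ξ) • ζ ξ) ξ‖ ≤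
        A * Real.exp (-(c / 2) * t) := by
  have hbdd : ∀ {F : Type _} [NormedAddCommGroup F] (f : V → F), Continuous f →
      ∃ M : ℝ, 0 ≤ M ∧ ∀ ξ ∈ tsupport ζ, ‖f ξ‖ ≤ M := by
    intro F _ f hf
    obtain ⟨M, hM⟩ := h2.isCompact.exists_bound_of_continuousOn hf.continuousOn
    exact ⟨max M 0, le_max_right _ _, fun ξ hξ => (hM ξ hξ).trans (le_max_left _ _)⟩
  have hψi : ∀ i : ℕ, Continuous (iteratedFDeriv ℝ i ψ) := fun i =>
    hψ.continuous_iteratedFDeriv (by exact_mod_cast le_top)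
  have hζi : ∀ i : ℕ, Continuous (iteratedFDeriv ℝ i ζ) := fun i =>
    h1.continuous_iteratedFDeriv (by exact_mod_cast le_top)
  choose M hM0 hM using fun i => hbdd _ (hψi i)
  choose L hL0 hL using fun i => hbdd _ (hζi i)
  obtain ⟨X, hX0, hX⟩ := hbdd (fun ξ : V => ξ) continuous_id
  set MM := ∑ i ∈ Finset.range (n + 1), M i with hMM
  have hMM0 : 0 ≤ MM := Finset.sum_nonneg fun i _ => hM0 i
  choose A hA0 hA using fun i : ℕ => one_add_mul_pow_le_exp i hMM0 (half_pos hc)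
  refine ⟨X ^ k * ∑ i ∈ Finset.range (n + 1), (n.choose i) * (i.factorial * A i) * L (n - i),
    mul_nonneg (by positivity) (Finset.sum_nonneg fun i _ => mul_nonneg (mul_nonneg (by positivity)
      (mul_nonneg (by positivity) (hA0 i))) (hL0 _)), ?_⟩
  intro t ht ξ
  by_cases hξ : ξ ∈ tsupport ζ
  · have hf : ContDiff ℝ ∞ fun ξ => Real.exp (-t * ψ ξ) := (contDiff_const.mul hψ).exp
    have hd : ∀ i ≤ n, ‖iteratedFDeriv ℝ i (fun ξ => Real.exp (-t * ψ ξ)) ξ‖ ≤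
        i.factorial * A i * Real.exp (-(c / 2) * t) := by
      intro i hi
      -- The composition estimate asks for `‖D^j(tψ)‖ ≤ D^j` for `1 ≤ j ≤ i`. The choice `D = 1 +
      -- t·MM` is at least one, so its `j`-th power dominates its first.
      have hcomp := norm_iteratedFDeriv_comp_le (g := Real.exp) (f := fun ξ => -t * ψ ξ) (n := i)
        (N := ∞) Real.contDiff_exp (contDiff_const.mul hψ) (by exact_mod_cast le_top) ξ
        (C := Real.exp (-t * ψ ξ)) (D := 1 + t * MM)
        (fun j _ => (norm_iteratedFDeriv_realExp j _).le) ?_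
      · refine hcomp.trans ?_
        have h3 : Real.exp (-t * ψ ξ) ≤ Real.exp (-c * t) := by
          rw [Real.exp_le_exp]; nlinarith [hle ξ hξ]
        calc (i.factorial : ℝ) * Real.exp (-t * ψ ξ) * (1 + t * MM) ^ i
            ≤ i.factorial * Real.exp (-c * t) * (A i * Real.exp (c / 2 * t)) := by
              have := hA i t ht
              gcongr
          _ = i.factorial * A i * (Real.exp (-c * t) * Real.exp (c / 2 * t)) := by ring
          _ = _ := by rw [← Real.exp_add]; ring_nf
      · intro j hj1 hj
        have h4 : iteratedFDeriv ℝ j (fun ξ => -t * ψ ξ) ξ = (-t) • iteratedFDeriv ℝ j ψ ξ :=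
          iteratedFDeriv_const_smul_apply' (a := -t) (i := j)
            (hψ.contDiffAt.of_le (by exact_mod_cast le_top))
        rw [h4, norm_smul, Real.norm_eq_abs, abs_neg, abs_of_nonneg ht]
        have h5 : ‖iteratedFDeriv ℝ j ψ ξ‖ ≤ MM := (hM j ξ hξ).trans
          (Finset.single_le_sum (f := M) (fun i _ => hM0 i) (Finset.mem_range.2 (by omega)))
        calc t * ‖iteratedFDeriv ℝ j ψ ξ‖ ≤ 1 + t * MM := by
              nlinarith [mul_le_mul_of_nonneg_left h5 ht]
          _ ≤ (1 + t * MM) ^ j := by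
              refine le_self_pow₀ ?_ (by omega)
              nlinarith [mul_nonneg ht hMM0]
    have hprod := norm_iteratedFDeriv_smul_le hf h1 ξ (n := n) (by exact_mod_cast le_top)
    calc ‖ξ‖ ^ k * ‖iteratedFDeriv ℝ n (fun ξ => Real.exp (-t * ψ ξ) • ζ ξ) ξ‖
        ≤ X ^ k * ∑ i ∈ Finset.range (n + 1), (n.choose i) *
          (i.factorial * A i * Real.exp (-(c / 2) * t)) * L (n - i) := by
          refine mul_le_mul (pow_le_pow_left₀ (norm_nonneg _) (hX ξ hξ) _) (hprod.trans ?_)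
            (norm_nonneg _) (by positivity)
          refine Finset.sum_le_sum fun i hi => ?_
          have h6 := hd i (by simpa [Nat.lt_succ_iff] using hi)
          have h7 := hL (n - i) ξ hξ
          have h8 := hA0 i
          gcongr
      _ = _ := by
          rw [mul_assoc, Finset.sum_mul]
          congr 1
          refine Finset.sum_congr rfl fun i _ => ?_
          ring
  · have : iteratedFDeriv ℝ n (fun ξ => Real.exp (-t * ψ ξ) • ζ ξ) ξ = 0 := by
      by_contra hne
      have h3 := support_iteratedFDeriv_subset (𝕜 := ℝ) n (Function.mem_support.2 hne)
      have h4 : Function.support (fun ξ => Real.exp (-t * ψ ξ) • ζ ξ) ⊆ Function.support ζ :=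
        fun x hx h0 => hx (by simp [h0])
      exact hξ (closure_mono h4 h3)
    rw [this, norm_zero, mul_zero]
    refine mul_nonneg (mul_nonneg (by positivity) (Finset.sum_nonneg fun i _ =>
      mul_nonneg (mul_nonneg (by positivity) (mul_nonneg (by positivity) (hA0 i))) (hL0 _)))
      (Real.exp_nonneg _)

/-- Exponential decay in `t` of `exp(-tψ)ζ` where `ψ` is bounded below on the support of `ζ`. -/
theorem exists_kernelNorm_exp_mul_le {ψ : V → ℝ} (hψ : ContDiff ℝ ∞ ψ) {ζ : V → ℂ}
    (h1 : ContDiff ℝ ∞ ζ) (h2 : HasCompactSupport ζ) {c : ℝ} (hc : 0 < c)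
    (hle : ∀ ξ ∈ tsupport ζ, c ≤ ψ ξ) :
    ∃ C : ℝ≥0, ∀ t : ℝ, 0 ≤ t → kernelNorm (fun ξ => (Real.exp (-t * ψ ξ) : ℂ) * ζ ξ) ≤
      C * ENNReal.ofReal (Real.exp (-(c / 2) * t)) := by
  obtain ⟨S, C, hC⟩ := exists_kernelNorm_le_seminorm (V := V)
  have hex : ∀ i : ℕ × ℕ, ∃ A : ℝ, 0 ≤ A ∧ ∀ t : ℝ, 0 ≤ t → ∀ f : 𝓢(V, ℂ),
      (∀ ξ, f ξ = Real.exp (-t * ψ ξ) • ζ ξ) →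
      schwartzSeminormFamily ℝ V ℂ i f ≤ A * Real.exp (-(c / 2) * t) := by
    intro i
    obtain ⟨A, hA0, hA⟩ := exists_seminorm_exp_smul_le hψ h1 h2 hc hle i.1 i.2
    refine ⟨A, hA0, fun t ht f hf => ?_⟩
    refine SchwartzMap.seminorm_le_bound ℝ i.1 i.2 f (by positivity) fun ξ => ?_
    have : (f : V → ℂ) = fun ξ => Real.exp (-t * ψ ξ) • ζ ξ := funext hf
    rw [this]
    exact hA t ht ξ
  choose A hA0 hA using hex
  have hAS : 0 ≤ ∑ i ∈ S, A i := Finset.sum_nonneg fun i _ => hA0 i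
  refine ⟨C * Real.toNNReal (∑ i ∈ S, A i), fun t ht => ?_⟩
  have hexp : ContDiff ℝ ∞ fun ξ => Real.exp (-t * ψ ξ) := (contDiff_const.mul hψ).exp
  have hcd : ContDiff ℝ ∞ fun ξ => Real.exp (-t * ψ ξ) • ζ ξ := hexp.smul h1
  have hcs : HasCompactSupport fun ξ => Real.exp (-t * ψ ξ) • ζ ξ :=
    h2.mono fun x hx h0 => hx (by simp [h0])
  obtain ⟨f, hf⟩ : ∃ f : 𝓢(V, ℂ), ∀ ξ, f ξ = Real.exp (-t * ψ ξ) • ζ ξ :=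
    ⟨hcs.toSchwartzMap hcd, fun ξ => rfl⟩
  have h4 : (S.sup (schwartzSeminormFamily ℝ V ℂ)) f ≤
      (∑ i ∈ S, A i) * Real.exp (-(c / 2) * t) := by
    refine Seminorm.finset_sup_apply_le (by positivity) fun i hi => ?_
    refine (hA i t ht f hf).trans ?_
    gcongr
    exact Finset.single_le_sum (f := A) (fun i _ => hA0 i) hi
  have h5 : (fun ξ => (Real.exp (-t * ψ ξ) : ℂ) * ζ ξ) = f := by
    ext ξ
    rw [hf, Complex.real_smul]
  rw [h5]
  refine (hC f).trans ?_
  rw [ENNReal.coe_mul, mul_assoc]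
  gcongr
  refine (ENNReal.ofReal_le_ofReal h4).trans (le_of_eq ?_)
  rw [ENNReal.ofReal_mul hAS, ENNReal.ofNNReal_toNNReal]

theorem rpow_neg_eq_integral {a x : ℝ} (ha : 0 < a) (hx : 0 < x) :
    x ^ (-a) = ∫ t in Ioi (0 : ℝ), (Real.Gamma a)⁻¹ * (t ^ (a - 1) * Real.exp (-(x * t))) := by
  rw [integral_const_mul, Real.integral_rpow_mul_exp_neg_mul_Ioi ha hx, one_div,
    Real.inv_rpow hx.le, Real.rpow_neg hx.le]
  have := (Real.Gamma_pos_of_pos ha).ne'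
  field_simp

theorem integrableOn_rpow_mul_exp_neg_mul {a r : ℝ} (ha : 0 < a) (hr : 0 < r) :
    IntegrableOn (fun t : ℝ => t ^ (a - 1) * Real.exp (-(r * t))) (Ioi 0) := by
  have := integrableOn_rpow_mul_exp_neg_mul_rpow (p := 1) (s := a - 1) (b := r) (by linarith) one_pos hr
  simpa using this

/-- `Λ^{-a}` is the Gamma average over `t` of `exp(-tΛ)`. Minkowski's inequality moves the kernel
norm inside, and the same Gamma integral, now at the decay rate `r`, evaluates the bound. -/
theorem kernelNorm_rpow_neg_mul_le {Λ : V → ℝ} (hΛc : Continuous Λ) (hΛ : ∀ ξ, 1 ≤ Λ ξ)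
    {ζ : V → ℂ} (hζc : Continuous ζ) (hζi : Integrable ζ) {C : ℝ≥0} {r : ℝ} (hr : 0 < r)
    (hE : ∀ t : ℝ, 0 < t → kernelNorm (fun ξ => (Real.exp (-t * Λ ξ) : ℂ) * ζ ξ) ≤
      C * ENNReal.ofReal (Real.exp (-(r * t)))) {a : ℝ} (ha : 0 < a) :
    kernelNorm (fun ξ => ((Λ ξ ^ (-a) : ℝ) : ℂ) * ζ ξ) ≤ C * ENNReal.ofReal (r ^ (-a)) := by
  set w : ℝ → ℝ := fun t => (Real.Gamma a)⁻¹ * t ^ (a - 1) with hw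
  have hG := Real.Gamma_pos_of_pos ha
  have hwm : Measurable w := by simp only [hw]; fun_prop
  set F : ℝ → V → ℂ := fun t ξ => (w t : ℂ) * ((Real.exp (-t * Λ ξ) : ℂ) * ζ ξ) with hF
  have hFm : StronglyMeasurable (Function.uncurry F) := by
    refine StronglyMeasurable.mul ?_ ?_
    · exact (Complex.measurable_ofReal.comp (hwm.comp measurable_fst)).stronglyMeasurable
    · exact Continuous.stronglyMeasurable (by fun_prop)
  have hwi : IntegrableOn (fun t : ℝ => w t * Real.exp (-t)) (Ioi 0) := by
    have := (integrableOn_rpow_mul_exp_neg_mul ha one_pos).const_mul (Real.Gamma a)⁻¹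
    refine IntegrableOn.congr_fun this (fun t _ => ?_) measurableSet_Ioi
    simp only [hw, one_mul, mul_assoc]
  -- Joint integrability needs only `Λ ≥ 1`, through the majorant `w(t) e^{-t} ‖ζ‖`; the rate `r`
  -- plays no part here.
  have hFi : Integrable (Function.uncurry F)
      ((volume.restrict (Ioi (0 : ℝ))).prod (volume : Measure V)) := by
    refine (hwi.mul_prod hζi.norm).mono' hFm.aestronglyMeasurable ?_
    have hae : ∀ᵐ z : ℝ × V ∂((volume.restrict (Ioi (0 : ℝ))).prod (volume : Measure V)),
        z.1 ∈ Ioi (0 : ℝ) :=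
      Measure.quasiMeasurePreserving_fst.ae (ae_restrict_mem measurableSet_Ioi)
    filter_upwards [hae] with z hz
    have hz' : (0 : ℝ) < z.1 := hz
    have hw0 : 0 ≤ w z.1 := by simp only [hw]; positivity
    simp only [hF, Function.uncurry_def]
    rw [norm_mul, norm_mul, Complex.norm_real, Complex.norm_real, Real.norm_of_nonneg hw0,
      Real.norm_of_nonneg (Real.exp_nonneg _), ← mul_assoc]
    gcongr
    nlinarith [hΛ z.2]
  have heq : (fun ξ => ((Λ ξ ^ (-a) : ℝ) : ℂ) * ζ ξ) = fun ξ => ∫ t in Ioi (0 : ℝ), F t ξ := by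
    ext ξ
    rw [rpow_neg_eq_integral ha (lt_of_lt_of_le one_pos (hΛ ξ)), ← integral_complex_ofReal,
      ← integral_mul_const]
    refine integral_congr_ae (ae_of_all _ fun t => ?_)
    simp only [hF, hw]
    push_cast
    ring_nf
  rw [heq]
  refine (kernelNorm_integral_le _ hFm hFi).trans ?_
  have hpt : ∀ t ∈ Ioi (0 : ℝ), kernelNorm (F t) ≤
      C * ENNReal.ofReal ((Real.Gamma a)⁻¹ * (t ^ (a - 1) * Real.exp (-(r * t)))) := by
    intro t ht
    have ht' : (0 : ℝ) < t := ht
    have hw0 : 0 ≤ w t := by simp only [hw]; positivity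
    simp only [hF]
    rw [kernelNorm_const_mul, ← ofReal_norm, Complex.norm_real, Real.norm_of_nonneg hw0]
    refine (mul_le_mul_right (hE t ht') _).trans (le_of_eq ?_)
    rw [mul_left_comm, ← ENNReal.ofReal_mul hw0]
    simp only [hw, mul_assoc]
  refine (setLIntegral_mono (by fun_prop) hpt).trans ?_
  rw [lintegral_const_mul _ (by fun_prop), rpow_neg_eq_integral ha hr,
    ofReal_integral_eq_lintegral_ofReal]
  · exact (integrableOn_rpow_mul_exp_neg_mul ha hr).const_mul _
  · filter_upwards [ae_restrict_mem measurableSet_Ioi] with t ht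
    have ht' : (0 : ℝ) < t := ht
    positivity

/-- A family of symbols `Λ i` of size `b i` on the supports of the cutoffs `ζ ∈ Z` has real powers
`Λ i ^ s` whose localizations have kernels of size `b i ^ s`. -/
theorem exists_kernelNorm_rpow_mul_le {ι : Type*} {Λ : ι → V → ℝ} {b : ι → ℝ} {Z : Set (V → ℂ)}
    (hΛc : ∀ i, Continuous (Λ i)) (hΛ : ∀ i ξ, 1 ≤ Λ i ξ) (hb : ∀ i, 0 < b i)
    (hZc : ∀ ζ ∈ Z, Continuous ζ) (hZs : ∀ ζ ∈ Z, HasCompactSupport ζ)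
    (hZ : ∀ ζ ∈ Z, ∃ ζ' ∈ Z, ∀ ξ, ζ ξ * ζ' ξ = ζ ξ)
    (hE : ∀ ζ ∈ Z, ∃ C : ℝ≥0, ∃ c : ℝ, 0 < c ∧ ∀ i, ∀ t : ℝ, 0 < t →
      kernelNorm (fun ξ => (Real.exp (-t * Λ i ξ) : ℂ) * ζ ξ) ≤
        C * ENNReal.ofReal (Real.exp (-(c * b i * t))))
    (hL : ∀ ζ ∈ Z, ∃ C : ℝ≥0, ∀ i, kernelNorm (fun ξ => (Λ i ξ : ℂ) * ζ ξ) ≤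
      C * ENNReal.ofReal (b i)) (s : ℝ) :
    ∀ ζ ∈ Z, ∃ C : ℝ≥0, ∀ i, kernelNorm (fun ξ => ((Λ i ξ ^ s : ℝ) : ℂ) * ζ ξ) ≤
      C * ENNReal.ofReal (b i ^ s) := by
  have hpow : ∀ (s : ℝ) (i : ι), Continuous fun ξ => Λ i ξ ^ s := fun s i =>
    (hΛc i).rpow_const fun ξ => Or.inl (by linarith [hΛ i ξ])
  -- Induction on an integer strictly above `s`. For `k = 0` the exponent is negative and the Gamma
  -- integral applies; each later step raises the exponent by one.
  have key : ∀ k : ℕ, ∀ s : ℝ, s < k → ∀ ζ ∈ Z, ∃ C : ℝ≥0, ∀ i,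
      kernelNorm (fun ξ => ((Λ i ξ ^ s : ℝ) : ℂ) * ζ ξ) ≤ C * ENNReal.ofReal (b i ^ s) := by
    intro k
    induction k with
    | zero =>
      intro s hs ζ hζ
      obtain ⟨C, c, hc, hC⟩ := hE ζ hζ
      refine ⟨C * Real.toNNReal (c ^ s), fun i => ?_⟩
      have := kernelNorm_rpow_neg_mul_le (hΛc i) (hΛ i) (hZc ζ hζ)
        ((hZc ζ hζ).integrable_of_hasCompactSupport (hZs ζ hζ)) (mul_pos hc (hb i)) (hC i)
        (a := -s) (by simpa using hs)
      rw [neg_neg] at this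
      refine this.trans (le_of_eq ?_)
      rw [Real.mul_rpow hc.le (hb i).le, ENNReal.ofReal_mul (by positivity), ENNReal.coe_mul,
        mul_assoc]
      rfl
    | succ k ih =>
      intro s hs ζ hζ
      obtain ⟨ζ', hζ', hmul⟩ := hZ ζ hζ
      obtain ⟨C, hC⟩ := ih (s - 1) (by push_cast at hs; linarith) ζ hζ
      obtain ⟨C', hC'⟩ := hL ζ' hζ'
      refine ⟨C * C', fun i => ?_⟩
      have hc1 : Continuous ζ := hZc ζ hζ
      have hc2 : Continuous ζ' := hZc ζ' hζ'
      have hc3 := hpow (s - 1) i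
      have hc4 := hΛc i
      -- One factor `Λ` is split off and localized by `ζ'`, which equals one wherever `ζ` does not
      -- vanish, so that submultiplicativity can be used.
      have heq : (fun ξ => ((Λ i ξ ^ s : ℝ) : ℂ) * ζ ξ) = fun ξ =>
          (((Λ i ξ ^ (s - 1) : ℝ) : ℂ) * ζ ξ) * ((Λ i ξ : ℂ) * ζ' ξ) := by
        ext ξ
        have h1 : Λ i ξ ^ s = Λ i ξ ^ (s - 1) * Λ i ξ := by
          have h0 : 0 < Λ i ξ := by linarith [hΛ i ξ]
          rw [← Real.rpow_add_one h0.ne', sub_add_cancel]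
        rw [h1, Complex.ofReal_mul]
        linear_combination -((Λ i ξ ^ (s - 1) : ℝ) : ℂ) * (Λ i ξ) * hmul ξ
      rw [heq]
      refine (kernelNorm_mul_le
        (Continuous.integrable_of_hasCompactSupport (by fun_prop) (hZs ζ hζ).mul_left)
        (by fun_prop)
        (Continuous.integrable_of_hasCompactSupport (by fun_prop) (hZs ζ' hζ').mul_left)
        (ne_top_of_le_ne_top (ENNReal.mul_ne_top (by simp) (by simp)) (hC' i))).trans ?_
      refine (mul_le_mul' (hC i) (hC' i)).trans (le_of_eq ?_)
      have h2 : b i ^ s = b i ^ (s - 1) * b i := by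
        rw [← Real.rpow_add_one (hb i).ne', sub_add_cancel]
      rw [h2, ENNReal.ofReal_mul (Real.rpow_nonneg (hb i).le _), ENNReal.coe_mul]
      ring
  obtain ⟨k, hk⟩ := exists_nat_gt s
  exact key k s hk

/-- Smooth cutoffs. -/
theorem exists_cutoff {K U : Set V} (hK : IsCompact K) (hU : IsOpen U) (hKU : K ⊆ U) :
    ∃ ζ : V → ℂ, ContDiff ℝ ∞ ζ ∧ HasCompactSupport ζ ∧ tsupport ζ ⊆ U ∧ ∀ ξ ∈ K, ζ ξ = 1 := by
  obtain ⟨t, ht, hKt, htU⟩ := exists_compact_between hK hU hKU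
  obtain ⟨f, hf1, hf0, -⟩ := exists_contMDiffMap_one_nhds_of_subset_interior
    (modelWithCornersSelf ℝ V) (n := ⊤) hK.isClosed hKt
  have hsub : tsupport (fun ξ => (f ξ : ℂ)) ⊆ t := by
    refine closure_minimal (fun ξ hξ => ?_) ht.isClosed
    by_contra hn
    exact hξ (by simp [hf0 ξ hn])
  refine ⟨fun ξ => (f ξ : ℂ), ?_, ?_, hsub.trans htU, fun ξ hξ => ?_⟩
  · exact Complex.ofRealCLM.contDiff.comp (contMDiff_iff_contDiff.1 f.contMDiff)
  · exact ht.of_isClosed_subset (isClosed_tsupport _) hsub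
  · have h1 := hf1.self_of_nhdsSet ξ hξ
    simp only [h1, Complex.ofReal_one]

end Multipliers

/-! ### Uniform multiplier bounds for rescaled Lévy measures -/

section Scaling

variable {d : ℕ} {κ l : ℝ → ℝ}

theorem IsScaling.factor_pos (hκ : IsScaling κ l) {ε : ℝ} (hε : 0 < ε) : 0 < l ε := by
  have h1 := hκ.scaling ε 1 hε one_pos
  rw [mul_one] at h1
  have h2 := hκ.pos ε hε
  have h3 := hκ.pos 1 one_pos
  by_contra h
  nlinarith

/-- An upper bound of `κ` on `(0, 1]` is a lower bound of `κ(R)⁻¹`, which absorbs the summand `1` of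
the symbol `1 + ψ`. -/
theorem IsScaling.le_on_unit (hκ : IsScaling κ l) {R : ℝ} (hR : 0 < R) (hR1 : R ≤ 1) :
    κ R ≤ l 1 * κ 1 := by
  have h1 := hκ.scaling R 1 hR one_pos
  rw [mul_one] at h1
  have h2 := hκ.factor_mono (mem_Ioi.2 hR) (mem_Ioi.2 one_pos) hR1
  nlinarith [hκ.pos 1 one_pos]

theorem levyExp_smul_map (c R : ℝ) (hc : 0 ≤ c) (μ : Measure (Rd d)) (ξ : Rd d) :
    levyExp (ENNReal.ofReal c • μ.map (fun y => R • y)) ξ = c * levyExp μ (R • ξ) := by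
  rw [levyExp, integral_smul_measure, integral_map (by fun_prop)
    (Continuous.aestronglyMeasurable (by fun_prop)), ENNReal.toReal_ofReal hc, smul_eq_mul, levyExp]
  congr 1
  refine integral_congr_ae (ae_of_all _ fun y => ?_)
  simp only [inner_smul_left, inner_smul_right]
  rfl

theorem levyExp_rescaled (hκ : IsScaling κ l) (μ : Measure (Rd d)) {R : ℝ} (hR : 0 < R)
    (ξ : Rd d) : levyExp (rescaled κ μ R) ξ = κ R * levyExp μ (R⁻¹ • ξ) :=
  levyExp_smul_map _ _ (hκ.pos R hR).le μ ξ

/-- In every range of `σ` one has `α₁ ≤ 2` and `α₂ ≥ 0`. Thus `min(‖z‖², 1)` lies below `‖z‖^{α₁}`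
inside the unit ball and below `‖z‖^{α₂}` outside it. -/
theorem AssumptionB.exponents {σ : ℝ} {μ : Measure (Rd d)} (hσ : σ ∈ Ioo (0 : ℝ) 2)
    (hB : AssumptionB σ κ μ) : ∃ N₀ : ℝ, ∀ R : ℝ, 0 < R →
      ∫⁻ y, ENNReal.ofReal (min (‖y‖ ^ 2) 1) ∂(rescaled κ μ R) ≤ ENNReal.ofReal N₀ := by
  obtain ⟨α₁, α₂, N₀, -, h1, h2, h3, hbd⟩ := hB
  have hα : α₁ ≤ 2 ∧ 0 ≤ α₂ := by
    rcases lt_trichotomy σ 1 with h | h | h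
    · have := h1 ⟨hσ.1, h⟩
      exact ⟨by linarith [this.1.2], this.2.1.le⟩
    · have := h3 h
      exact ⟨this.1.2, this.2.1⟩
    · have := h2 ⟨h, hσ.2⟩
      exact ⟨this.1.2, by linarith [this.2.1]⟩
  refine ⟨N₀, fun R hR => le_trans ?_ (hbd R hR)⟩
  have hm : MeasurableSet {z : Rd d | ‖z‖ ≤ 1} :=
    (isClosed_le continuous_norm continuous_const).measurableSet
  rw [← lintegral_add_compl _ hm]
  have hcompl : {z : Rd d | ‖z‖ ≤ 1}ᶜ = {z : Rd d | 1 < ‖z‖} := by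
    ext z; simp
  rw [hcompl]
  refine add_le_add (setLIntegral_mono (by fun_prop) fun z hz => ?_)
    (setLIntegral_mono (by fun_prop) fun z hz => ?_)
  · refine ENNReal.ofReal_le_ofReal ((min_le_left _ _).trans ?_)
    rcases eq_or_lt_of_le (norm_nonneg z) with h0 | h0
    · rw [← h0]; simpa using Real.rpow_nonneg le_rfl _
    · rw [← Real.rpow_natCast]
      exact Real.rpow_le_rpow_of_exponent_ge h0 hz (by exact_mod_cast hα.1)
  · refine ENNReal.ofReal_le_ofReal ((min_le_right _ _).trans ?_)
    exact Real.one_le_rpow (le_of_lt hz) hα.2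

/-- A fixed finite measure with bounded support below all rescaled measures, whose exponent is
nondegenerate on a given ball. -/
theorem AssumptionD.exists_minorant {σ : ℝ} {μ : Measure (Rd d)} (hκ : IsScaling κ l)
    (hD : AssumptionD σ κ μ) {r : ℝ} (hr : 0 < r) :
    ∃ (ν : Measure (Rd d)) (c ε : ℝ), IsFiniteMeasure ν ∧ 0 < c ∧ (∀ᵐ y ∂ν, ‖y‖ ≤ ε) ∧
      (∀ R : ℝ, 0 < R → ν ≤ rescaled κ μ R) ∧
      ∀ ξ : Rd d, ‖ξ‖ ≤ r → c * ‖ξ‖ ^ 2 ≤ levyExp ν ξ := by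
  obtain ⟨μ₀, n₀, c₁, hA, hle, -⟩ := hD
  have hc₁ := hA.const_pos
  set ρ : Measure (Rd d) := μ₀.restrict {y | ‖y‖ ≤ 1} with hρ
  have hm1 : MeasurableSet {z : Rd d | ‖z‖ ≤ 1} :=
    (isClosed_le continuous_norm continuous_const).measurableSet
  have hsq : Integrable (fun y : Rd d => ‖y‖ ^ 2) ρ := by
    refine Integrable.restrict ⟨Continuous.aestronglyMeasurable (by fun_prop), ?_⟩
    rw [hasFiniteIntegral_iff_ofReal (ae_of_all _ fun y => by positivity)]
    exact lt_of_le_of_lt (le_self_add.trans hA.bound) ENNReal.ofReal_lt_top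
  have hρ1 : ∀ᵐ y ∂ρ, ‖y‖ ≤ 1 := ae_restrict_mem hm1
  have hρmin : ∫⁻ y, ENNReal.ofReal (min (‖y‖ ^ 2) 1) ∂ρ ≠ ⊤ := by
    refine ne_top_of_le_ne_top hsq.lintegral_lt_top.ne (lintegral_mono fun y => ?_)
    exact ENNReal.ofReal_le_ofReal (min_le_left _ _)
  have hinner : ∀ ξ : Rd d, Integrable (fun y => ⟪ξ, y⟫ ^ 2) ρ := by
    intro ξ
    refine (hsq.const_mul (‖ξ‖ ^ 2)).mono' (Continuous.aestronglyMeasurable (by fun_prop))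
      (ae_of_all _ fun y => ?_)
    rw [Real.norm_of_nonneg (sq_nonneg _), ← mul_pow]
    exact sq_le_sq' (by linarith [neg_le_of_abs_le (abs_real_inner_le_norm ξ y)])
      (real_inner_le_norm ξ y)
  -- the mass of `‖y‖²` near the origin is small
  obtain ⟨n, hn⟩ : ∃ n : ℕ, ∫ y in {y : Rd d | ‖y‖ ≤ ((n : ℝ) + 1)⁻¹}, ‖y‖ ^ 2 ∂ρ ≤ c₁ / 2 := by
    have hlim : Tendsto (fun n : ℕ => ∫ y, ({y : Rd d | ‖y‖ ≤ ((n : ℝ) + 1)⁻¹}).indicator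
        (fun y => ‖y‖ ^ 2) y ∂ρ) atTop (𝓝 (∫ y : Rd d, (0 : ℝ) ∂ρ)) := by
      refine tendsto_integral_of_dominated_convergence (fun y => ‖y‖ ^ 2) (fun n => ?_) hsq
        (fun n => ae_of_all _ fun y => ?_) (ae_of_all _ fun y => ?_)
      · exact (Continuous.aestronglyMeasurable (by fun_prop)).indicator
          (isClosed_le continuous_norm continuous_const).measurableSet
      · rw [Set.indicator_apply]
        split_ifs <;> simp
      · rcases eq_or_ne y 0 with rfl | hy
        · simp [Set.indicator_apply]
        · refine tendsto_const_nhds.congr' ?_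
          have h2 : Tendsto (fun n : ℕ => ((n : ℝ) + 1)⁻¹) atTop (𝓝 0) := by
            simpa using tendsto_one_div_add_atTop_nhds_zero_nat (𝕜 := ℝ)
          filter_upwards [h2.eventually_lt_const (norm_pos_iff.2 hy)] with n hn
          rw [Set.indicator_of_notMem]
          simpa using hn
    rw [integral_zero] at hlim
    obtain ⟨n, hn⟩ := (hlim.eventually_lt_const (half_pos hc₁)).exists
    refine ⟨n, ?_⟩
    rw [← integral_indicator (isClosed_le continuous_norm continuous_const).measurableSet]
    exact hn.le
  -- Removing a ball makes the measure finite. The radius is such that at most half of the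
  -- nondegeneracy constant `c₁` is lost.
  set ν₀ : Measure (Rd d) := ρ.restrict {y | ((n : ℝ) + 1)⁻¹ < ‖y‖} with hν₀
  have hν₀fin : IsFiniteMeasure ν₀ := isFiniteMeasure_restrict_lt_norm hρmin (by positivity)
  have hnd : ∀ η : Rd d, c₁ / 2 * ‖η‖ ^ 2 ≤ ∫ y, ⟪η, y⟫ ^ 2 ∂ν₀ := by
    intro η
    have h1 : c₁ * ‖η‖ ^ 2 ≤ ∫ y, ⟪η, y⟫ ^ 2 ∂ρ := by
      rcases eq_or_ne η 0 with rfl | hη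
      · simp
      · have hη' : 0 < ‖η‖ := norm_pos_iff.2 hη
        have h2 := hA.nondegenerate (‖η‖⁻¹ • η) (by
          rw [norm_smul, norm_inv, norm_norm, inv_mul_cancel₀ hη'.ne'])
        have h3 : ∫ y, ⟪‖η‖⁻¹ • η, y⟫ ^ 2 ∂ρ = (‖η‖⁻¹) ^ 2 * ∫ y, ⟪η, y⟫ ^ 2 ∂ρ := by
          rw [← integral_const_mul]
          refine integral_congr_ae (ae_of_all _ fun y => ?_)
          simp only [real_inner_smul_left, mul_pow]
        rw [← hρ, h3, inv_pow, inv_mul_eq_div, le_div_iff₀ (by positivity)] at h2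
        exact h2
    have h4 : ∫ y, ⟪η, y⟫ ^ 2 ∂ρ = ∫ y, ⟪η, y⟫ ^ 2 ∂ν₀ +
        ∫ y in {y : Rd d | ‖y‖ ≤ ((n : ℝ) + 1)⁻¹}, ⟪η, y⟫ ^ 2 ∂ρ := by
      rw [← integral_add_compl (measurableSet_lt_norm (((n : ℝ) + 1)⁻¹)) (hinner η)]
      congr 3
      ext y; simp
    have h5 : ∫ y in {y : Rd d | ‖y‖ ≤ ((n : ℝ) + 1)⁻¹}, ⟪η, y⟫ ^ 2 ∂ρ ≤ ‖η‖ ^ 2 * (c₁ / 2) := by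
      refine le_trans ?_ (mul_le_mul_of_nonneg_left hn (sq_nonneg _))
      rw [← integral_const_mul]
      refine integral_mono (hinner η).restrict (hsq.restrict.const_mul _) fun y => ?_
      simp only []
      rw [← mul_pow]
      exact sq_le_sq' (by linarith [neg_le_of_abs_le (abs_real_inner_le_norm η y)])
        (real_inner_le_norm η y)
    nlinarith
  have hν₀1 : ∀ᵐ y ∂ν₀, ‖y‖ ≤ 1 := ae_restrict_of_ae hρ1
  -- For `‖η‖ ≤ 1/2` and `‖y‖ ≤ 1` the phase lies in `[-π, π]`, where `1 - cos x ≥ 2x²/π²`. This is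
  -- the factor `8`, and `8 · c₁/2 = 4c₁`.
  have hlow : ∀ η : Rd d, ‖η‖ ≤ 1 / 2 → 4 * c₁ * ‖η‖ ^ 2 ≤ levyExp ν₀ η := by
    intro η hη
    have h1 : ∫ y, 8 * ⟪η, y⟫ ^ 2 ∂ν₀ ≤ levyExp ν₀ η := by
      refine integral_mono_ae ((hinner η).restrict.const_mul 8)
        (integrable_one_sub_cos (lintegral_min_sq_ne_top_of_finite ν₀) η) ?_
      filter_upwards [hν₀1] with y hy
      have h2 : |2 * Real.pi * ⟪η, y⟫| ≤ Real.pi := by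
        rw [abs_mul, abs_of_pos Real.two_pi_pos]
        have h3 : |⟪η, y⟫| ≤ 1 / 2 * 1 := (abs_real_inner_le_norm η y).trans
          (mul_le_mul hη hy (norm_nonneg _) (by norm_num))
        nlinarith [Real.pi_pos]
      have h4 := Real.cos_le_one_sub_mul_cos_sq h2
      have h5 : 2 / Real.pi ^ 2 * (2 * Real.pi * ⟪η, y⟫) ^ 2 = 8 * ⟪η, y⟫ ^ 2 := by
        field_simp
        ring
      linarith
    rw [integral_const_mul] at h1
    nlinarith [hnd η]
  -- dilation
  set ε : ℝ := (2 * r)⁻¹ with hε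
  have hε0 : 0 < ε := by positivity
  have hlε := hκ.factor_pos hε0
  refine ⟨ENNReal.ofReal (l ε)⁻¹ • ν₀.map (fun y => ε • y), (l ε)⁻¹ * (4 * c₁ * ε ^ 2), ε,
    ?_, by positivity, ?_, ?_, ?_⟩
  · exact Measure.smul_finite _ (by simp)
  · refine Measure.ae_smul_measure ?_ _
    rw [ae_map_iff (by fun_prop) (isClosed_le continuous_norm continuous_const).measurableSet]
    filter_upwards [hν₀1] with y hy
    rw [norm_smul, Real.norm_of_nonneg hε0.le]
    nlinarith
  -- The bound at scale `εR`, pushed forward by `ε`, reads `κ(εR) μ(R ·)` on the right. The scaling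
  -- inequality `κ(εR) ≤ l(ε) κ(R)` turns it into a bound at scale `R`, at the price of the factor
  -- `1/l(ε)`.
  · intro R hR
    have h1 : ν₀ ≤ rescaled κ μ (ε * R) :=
      Measure.restrict_le_self.trans (hle (ε * R) (by positivity))
    have h2 : ν₀.map (fun y => ε • y) ≤ (rescaled κ μ (ε * R)).map (fun y => ε • y) :=
      Measure.map_mono h1 (by fun_prop)
    have h3 : (rescaled κ μ (ε * R)).map (fun y => ε • y) =
        ENNReal.ofReal (κ (ε * R)) • μ.map (fun y => R⁻¹ • y) := by
      rw [rescaled, Measure.map_smul, Measure.map_map (by fun_prop) (by fun_prop)]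
      congr 2
      ext1 y
      simp only [Function.comp_apply, smul_smul]
      congr 1
      field_simp
    rw [h3] at h2
    have h4 : ENNReal.ofReal (l ε)⁻¹ * ENNReal.ofReal (κ (ε * R)) ≤ ENNReal.ofReal (κ R) := by
      rw [← ENNReal.ofReal_mul (by positivity)]
      refine ENNReal.ofReal_le_ofReal ?_
      rw [inv_mul_le_iff₀ hlε]
      exact hκ.scaling ε R hε0 hR
    intro s
    have h5 := h2 s
    simp only [Measure.smul_apply, smul_eq_mul, rescaled] at h5 ⊢
    calc ENNReal.ofReal (l ε)⁻¹ * (ν₀.map (fun y => ε • y)) s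
        ≤ ENNReal.ofReal (l ε)⁻¹ *
          (ENNReal.ofReal (κ (ε * R)) * (μ.map (fun y => R⁻¹ • y)) s) := by gcongr
      _ ≤ _ := by rw [← mul_assoc]; gcongr
  · intro ξ hξ
    rw [levyExp_smul_map _ _ (by positivity)]
    have h1 : ‖ε • ξ‖ = ε * ‖ξ‖ := by rw [norm_smul, Real.norm_of_nonneg hε0.le]
    -- The choice `ε = 1/(2r)` maps the ball of radius `r` into that of radius `1/2`.
    have h2 := hlow (ε • ξ) (by
      rw [h1, hε, inv_mul_le_iff₀ (by positivity)]; linarith)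
    rw [h1, mul_pow] at h2
    calc (l ε)⁻¹ * (4 * c₁ * ε ^ 2) * ‖ξ‖ ^ 2 = (l ε)⁻¹ * (4 * c₁ * (ε ^ 2 * ‖ξ‖ ^ 2)) := by ring
      _ ≤ _ := by gcongr

theorem lintegral_min_sq_rescaled_ne_top {σ : ℝ} {μ : Measure (Rd d)} (hσ : σ ∈ Ioo (0 : ℝ) 2)
    (hB : AssumptionB σ κ μ) {R : ℝ} (hR : 0 < R) :
    ∫⁻ y, ENNReal.ofReal (min (‖y‖ ^ 2) 1) ∂(rescaled κ μ R) ≠ ⊤ := by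
  obtain ⟨N₀, h⟩ := hB.exponents hσ
  exact ne_top_of_le_ne_top ENNReal.ofReal_ne_top (h R hR)

/-- Each rescaled measure is the fixed minorant `ν` plus a remainder depending on `R`. The
exponential of `ν`'s exponent is smooth and decays on the support of `ζ`, uniformly because `ν` does
not depend on `R`. The exponential of the remainder's exponent is a contraction. -/
theorem exists_kernelNorm_exp_rescaled_le {σ : ℝ} {μ : Measure (Rd d)} (hκ : IsScaling κ l)
    (hσ : σ ∈ Ioo (0 : ℝ) 2) (hD : AssumptionD σ κ μ) (hB : AssumptionB σ κ μ) {ζ : Rd d → ℂ}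
    (h1 : ContDiff ℝ ∞ ζ) (h2 : HasCompactSupport ζ) (h0 : (0 : Rd d) ∉ tsupport ζ) :
    ∃ C : ℝ≥0, ∃ c : ℝ, 0 < c ∧ ∀ R : ℝ, 0 < R → ∀ t : ℝ, 0 ≤ t →
      kernelNorm (fun ξ => (Real.exp (-t * levyExp (rescaled κ μ R) ξ) : ℂ) * ζ ξ) ≤
        C * ENNReal.ofReal (Real.exp (-(c * t))) := by
  obtain ⟨r, hr, hsub⟩ := h2.isCompact.isBounded.subset_closedBall_lt 0 (0 : Rd d)
  obtain ⟨ν, c, ε, hfin, hc, hbd, hle, hlow⟩ := hD.exists_minorant hκ hr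
  obtain ⟨δ, hδ, hball⟩ := Metric.isOpen_iff.1 (isClosed_tsupport ζ).isOpen_compl 0 h0
  have hlow' : ∀ ξ ∈ tsupport ζ, c * δ ^ 2 ≤ levyExp ν ξ := by
    intro ξ hξ
    have hr' : ‖ξ‖ ≤ r := by simpa using hsub hξ
    refine le_trans ?_ (hlow ξ hr')
    have : δ ≤ ‖ξ‖ := by
      by_contra hlt
      exact hball (by simpa using hlt : ξ ∈ Metric.ball 0 δ) hξ
    gcongr
  have hsm := contDiff_levyExp_of_bounded ν hbd
  obtain ⟨C, hC⟩ := exists_kernelNorm_exp_mul_le hsm h1 h2 (c := c * δ ^ 2) (by positivity) hlow'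
  refine ⟨C, c * δ ^ 2 / 2, by positivity, fun R hR t ht => ?_⟩
  set π := rescaled κ μ R with hπ
  have hπm := lintegral_min_sq_rescaled_ne_top hσ hB hR
  have hsub' : π - ν + ν = π := Measure.sub_add_cancel_of_le (hle R hR)
  have hdiff : ∫⁻ y, ENNReal.ofReal (min (‖y‖ ^ 2) 1) ∂(π - ν) ≠ ⊤ :=
    ne_top_of_le_ne_top hπm (lintegral_mono' Measure.sub_le le_rfl)
  have hcont := hsm.continuous
  have hζc := h1.continuous
  have heq : (fun ξ => (Real.exp (-t * levyExp π ξ) : ℂ) * ζ ξ) = fun ξ =>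
      (Real.exp (-t * levyExp (π - ν) ξ) : ℂ) * ((Real.exp (-t * levyExp ν ξ) : ℂ) * ζ ξ) := by
    ext ξ
    rw [← mul_assoc, ← Complex.ofReal_mul, ← Real.exp_add]
    congr 3
    conv_lhs => rw [← hsub']
    rw [levyExp_add hdiff (lintegral_min_sq_ne_top_of_finite ν)]
    ring
  rw [heq]
  refine (kernelNorm_exp_neg_levyExp_mul_le hdiff ht (by fun_prop)
    (Continuous.integrable_of_hasCompactSupport (by fun_prop) h2.mul_left)).trans ?_
  refine (hC t ht).trans ?_
  rw [neg_mul]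

/-- The kernels of the localized powers of `1 + ψ` at frequencies of order `R⁻¹`. -/
theorem exists_kernelNorm_rpow_dilate_le {σ : ℝ} {μ : Measure (Rd d)} (hκ : IsScaling κ l)
    (hμ : LevyClass σ μ) (hD : AssumptionD σ κ μ) (hB : AssumptionB σ κ μ) (s : ℝ) {ζ : Rd d → ℂ}
    (h1 : ContDiff ℝ ∞ ζ) (h2 : HasCompactSupport ζ) (h0 : (0 : Rd d) ∉ tsupport ζ) :
    ∃ C : ℝ≥0, ∀ R : ℝ, 0 < R → R ≤ 1 →
      kernelNorm (fun ξ => (((1 + levyExp μ ξ) ^ s : ℝ) : ℂ) * ζ (R • ξ)) ≤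
        C * ENNReal.ofReal (κ R ^ (-s)) := by
  obtain ⟨N₀, hN₀⟩ := hB.exponents hμ.order_mem
  have hcont := continuous_levyExp hμ.levy.ne
  set ι := {R : ℝ // 0 < R ∧ R ≤ 1}
  -- The family is indexed by the scales `R ∈ (0, 1]`, with symbols `1 + ψ(ξ/R)` of size `1/κ(R)`.
  -- The admissible cutoffs vanish near the origin, where the lower bound degenerates.
  have key := exists_kernelNorm_rpow_mul_le (V := Rd d) (ι := ι)
    (Λ := fun R ξ => 1 + levyExp μ ((R : ℝ)⁻¹ • ξ)) (b := fun R => (κ R)⁻¹)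
    (Z := {ζ | ContDiff ℝ ∞ ζ ∧ HasCompactSupport ζ ∧ (0 : Rd d) ∉ tsupport ζ})
    (fun R => by fun_prop) (fun R ξ => by linarith [levyExp_nonneg μ ((R : ℝ)⁻¹ • ξ)])
    (fun R => inv_pos.2 (hκ.pos R R.2.1)) (fun ζ hζ => hζ.1.continuous) (fun ζ hζ => hζ.2.1)
    (fun ζ hζ => ?_) (fun ζ hζ => ?_) (fun ζ hζ => ?_) s ζ ⟨h1, h2, h0⟩
  · obtain ⟨C, hC⟩ := key
    refine ⟨C, fun R hR hR1 => ?_⟩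
    have h3 := hC ⟨R, hR, hR1⟩
    have h4 := kernelNorm_comp_smul hR (fun ξ : Rd d =>
      (((1 + levyExp μ (R⁻¹ • ξ)) ^ s : ℝ) : ℂ) * ζ ξ)
    simp only [smul_smul, inv_mul_cancel₀ hR.ne', one_smul] at h4
    rw [h4, Real.rpow_neg (hκ.pos R hR).le, ← Real.inv_rpow (hκ.pos R hR).le]
    exact h3
  · obtain ⟨ζ', ha, hb, hc, hd⟩ := exists_cutoff (K := tsupport ζ) (U := {0}ᶜ) hζ.2.1.isCompact
      isOpen_compl_singleton (by simpa using hζ.2.2)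
    refine ⟨ζ', ⟨ha, hb, fun h => hc h rfl⟩, fun ξ => ?_⟩
    by_cases hξ : ξ ∈ tsupport ζ
    · rw [hd ξ hξ, mul_one]
    · rw [image_eq_zero_of_notMem_tsupport hξ, zero_mul]
  · obtain ⟨C, c, hc, hC⟩ := exists_kernelNorm_exp_rescaled_le hκ hμ.order_mem hD hB
      hζ.1 hζ.2.1 hζ.2.2
    refine ⟨C, c, hc, fun R t ht => ?_⟩
    have hκR := hκ.pos R R.2.1
    -- Since `ψ(ξ/R) = ψ_R(ξ)/κ(R)`, time `t` for the original symbol is time `t/κ(R)` for the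
    -- rescaled one. The spare factor `e^{-t}` is discarded.
    have h3 := hC R R.2.1 (t / κ R) (by positivity)
    have heq : (fun ξ => (Real.exp (-t * (1 + levyExp μ ((R : ℝ)⁻¹ • ξ))) : ℂ) * ζ ξ) = fun ξ =>
        (Real.exp (-t) : ℂ) *
          ((Real.exp (-(t / κ R) * levyExp (rescaled κ μ R) ξ) : ℂ) * ζ ξ) := by
      ext ξ
      rw [← mul_assoc, ← Complex.ofReal_mul, ← Real.exp_add, levyExp_rescaled hκ μ R.2.1]
      congr 3
      field_simp
      ring
    rw [heq, kernelNorm_const_mul, ← ofReal_norm, Complex.norm_real,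
      Real.norm_of_nonneg (Real.exp_nonneg _)]
    have h4 : ENNReal.ofReal (Real.exp (-t)) ≤ 1 := by
      rw [← ENNReal.ofReal_one]
      refine ENNReal.ofReal_le_ofReal ?_
      rw [Real.exp_le_one_iff]; linarith
    refine (mul_le_mul' h4 h3).trans ?_
    rw [one_mul]
    have h5 : c * (t / κ R) = c * (κ R)⁻¹ * t := by rw [div_eq_mul_inv]; ring
    rw [h5]
  · obtain ⟨C, hC⟩ := exists_kernelNorm_levyExp_mul_le hζ.1 hζ.2.1
    have hK := kernelNorm_compactSupport_ne_top hζ.1 hζ.2.1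
    have hζc := hζ.1.continuous
    -- The summand `1` costs `kernelNorm ζ · l(1)κ(1)/κ(R)`, using `R ≤ 1`. The summand `ψ(ξ/R)`
    -- costs `C N₀/κ(R)`, by B.
    refine ⟨(kernelNorm ζ).toNNReal * Real.toNNReal (l 1 * κ 1) + C * Real.toNNReal N₀,
      fun R => ?_⟩
    have hκR := hκ.pos R R.2.1
    have hcR := continuous_levyExp (lintegral_min_sq_rescaled_ne_top hμ.order_mem hB R.2.1)
    have heq : (fun ξ => ((1 + levyExp μ ((R : ℝ)⁻¹ • ξ) : ℝ) : ℂ) * ζ ξ) = fun ξ =>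
        ζ ξ + (((κ R)⁻¹ : ℝ) : ℂ) * ((levyExp (rescaled κ μ R) ξ : ℂ) * ζ ξ) := by
      ext ξ
      have h6 : levyExp μ ((R : ℝ)⁻¹ • ξ) = (κ R)⁻¹ * levyExp (rescaled κ μ R) ξ := by
        rw [levyExp_rescaled hκ μ R.2.1, ← mul_assoc, inv_mul_cancel₀ hκR.ne', one_mul]
      rw [h6]
      push_cast
      ring
    rw [heq]
    refine (kernelNorm_add_le (hζc.integrable_of_hasCompactSupport hζ.2.1)
      ((Continuous.integrable_of_hasCompactSupport (by fun_prop) hζ.2.1.mul_left).const_mul _)).trans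
        ?_
    rw [kernelNorm_const_mul, ← ofReal_norm, Complex.norm_real,
      Real.norm_of_nonneg (inv_pos.2 hκR).le]
    push_cast
    rw [ENNReal.coe_toNNReal hK, add_mul]
    refine add_le_add ?_ ?_
    · rw [mul_assoc]
      refine le_mul_of_one_le_right' ?_
      rw [ENNReal.ofNNReal_toNNReal, ← ENNReal.ofReal_mul' (inv_pos.2 hκR).le,
        ← ENNReal.ofReal_one]
      refine ENNReal.ofReal_le_ofReal ?_
      rw [← div_eq_mul_inv, le_div_iff₀ hκR, one_mul]
      exact hκ.le_on_unit R.2.1 R.2.2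
    · rw [mul_comm]
      gcongr
      refine (hC _ (lintegral_min_sq_rescaled_ne_top hμ.order_mem hB R.2.1)).trans ?_
      rw [ENNReal.ofNNReal_toNNReal]
      gcongr
      exact hN₀ R R.2.1

/-- The kernels of the localized powers of `1 + ψ` at bounded frequencies. -/
theorem kernelNorm_rpow_mul_ne_top {σ : ℝ} {μ : Measure (Rd d)} (hμ : LevyClass σ μ) (s : ℝ)
    {ζ : Rd d → ℂ} (h1 : ContDiff ℝ ∞ ζ) (h2 : HasCompactSupport ζ) :
    kernelNorm (fun ξ => (((1 + levyExp μ ξ) ^ s : ℝ) : ℂ) * ζ ξ) ≠ ⊤ := by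
  have hcont := continuous_levyExp hμ.levy.ne
  -- A single symbol of size one. The decay in `t` now comes from the summand `1` of `1 + ψ`, so the
  -- cutoffs may contain the origin, as the piece `j = 0` requires.
  have key := exists_kernelNorm_rpow_mul_le (V := Rd d) (ι := Unit)
    (Λ := fun _ ξ => 1 + levyExp μ ξ) (b := fun _ => 1)
    (Z := {ζ | ContDiff ℝ ∞ ζ ∧ HasCompactSupport ζ})
    (fun _ => by fun_prop) (fun _ ξ => by linarith [levyExp_nonneg μ ξ])
    (fun _ => one_pos) (fun ζ hζ => hζ.1.continuous) (fun ζ hζ => hζ.2)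
    (fun ζ hζ => ?_) (fun ζ hζ => ?_) (fun ζ hζ => ?_) s ζ ⟨h1, h2⟩
  · obtain ⟨C, hC⟩ := key
    exact ne_top_of_le_ne_top (ENNReal.mul_ne_top (by simp) (by simp)) (hC ())
  · obtain ⟨ζ', ha, hb, -, hd⟩ := exists_cutoff (K := tsupport ζ) (U := univ) hζ.2.isCompact
      isOpen_univ (subset_univ _)
    refine ⟨ζ', ⟨ha, hb⟩, fun ξ => ?_⟩
    by_cases hξ : ξ ∈ tsupport ζ
    · rw [hd ξ hξ, mul_one]
    · rw [image_eq_zero_of_notMem_tsupport hξ, zero_mul]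
  · have hK := kernelNorm_compactSupport_ne_top hζ.1 hζ.2
    refine ⟨(kernelNorm ζ).toNNReal, 1, one_pos, fun _ t ht => ?_⟩
    have heq : (fun ξ => (Real.exp (-t * (1 + levyExp μ ξ)) : ℂ) * ζ ξ) = fun ξ =>
        (Real.exp (-t) : ℂ) * ((Real.exp (-t * levyExp μ ξ) : ℂ) * ζ ξ) := by
      ext ξ
      rw [← mul_assoc, ← Complex.ofReal_mul, ← Real.exp_add]
      congr 3
      ring
    rw [heq, kernelNorm_const_mul, ← ofReal_norm, Complex.norm_real,
      Real.norm_of_nonneg (Real.exp_nonneg _), ENNReal.coe_toNNReal hK, mul_comm, one_mul, one_mul]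
    gcongr
    exact kernelNorm_exp_neg_levyExp_mul_le hμ.levy.ne ht.le hζ.1.continuous
      (hζ.1.continuous.integrable_of_hasCompactSupport hζ.2)
  · obtain ⟨C, hC⟩ := exists_kernelNorm_levyExp_mul_le hζ.1 hζ.2
    have hζc := hζ.1.continuous
    have hi := hζc.integrable_of_hasCompactSupport hζ.2 (μ := volume)
    have hi2 : Integrable fun ξ => (levyExp μ ξ : ℂ) * ζ ξ :=
      Continuous.integrable_of_hasCompactSupport (by fun_prop) hζ.2.mul_left
    have hK := kernelNorm_compactSupport_ne_top hζ.1 hζ.2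
    have heq : (fun ξ => ((1 + levyExp μ ξ : ℝ) : ℂ) * ζ ξ) = fun ξ =>
        ζ ξ + (levyExp μ ξ : ℂ) * ζ ξ := by
      ext ξ; push_cast; ring
    have hfin : kernelNorm (fun ξ => ((1 + levyExp μ ξ : ℝ) : ℂ) * ζ ξ) ≠ ⊤ := by
      rw [heq]
      exact ne_top_of_le_ne_top (ENNReal.add_ne_top.2 ⟨hK, ne_top_of_le_ne_top
        (ENNReal.mul_ne_top (by simp) hμ.levy.ne) (hC μ hμ.levy.ne)⟩) (kernelNorm_add_le hi hi2)
    exact ⟨(kernelNorm (fun ξ => ((1 + levyExp μ ξ : ℝ) : ℂ) * ζ ξ)).toNNReal, fun _ => by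
      rw [ENNReal.coe_toNNReal hfin]; simp⟩

end Scaling

/-! ### The symbol of the symmetrized operator -/

section Symbol

variable {d : ℕ}

theorem norm_exp_sub_one_sub_le (a : ℝ) :
    ‖Complex.exp (Complex.I * a) - 1 - Complex.I * a‖ ≤ 3 * a ^ 2 := by
  rcases le_or_gt |a| 1 with h | h
  · have h1 := Complex.norm_exp_sub_one_sub_id_le (x := Complex.I * a) (by simpa using h)
    have h2 : ‖Complex.I * (a : ℂ)‖ ^ 2 = a ^ 2 := by simp
    rw [h2] at h1
    nlinarith [sq_nonneg a]
  · have h1 : ‖Complex.exp (Complex.I * a) - 1‖ ≤ |a| := by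
      simpa using Real.norm_exp_I_mul_ofReal_sub_one_le (x := a)
    have h2 := norm_sub_le (Complex.exp (Complex.I * a) - 1) (Complex.I * a)
    have h3 : ‖Complex.I * (a : ℂ)‖ = |a| := by simp
    rw [h3] at h2
    have h4 : |a| ≤ a ^ 2 := by rw [← sq_abs]; nlinarith
    linarith [sq_nonneg a]

theorem norm_exp_sub_one_le_two (a : ℝ) : ‖Complex.exp (Complex.I * a) - 1‖ ≤ 2 := by
  have h := norm_sub_le (Complex.exp (Complex.I * a)) 1
  rw [mul_comm, Complex.norm_exp_ofReal_mul_I, mul_comm] at h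
  simpa [one_add_one_eq_two] using h

/-- The integrand of `levySymbol`. -/
noncomputable def symbolIntegrand (σ : ℝ) (ξ y : Rd d) : ℂ :=
  Complex.exp (Complex.I * (2 * Real.pi * ⟪ξ, y⟫ : ℝ)) - 1
    - Complex.I * (2 * Real.pi * chi σ y * ⟪ξ, y⟫ : ℝ)

theorem measurable_chi (σ : ℝ) : Measurable (chi σ : Rd d → ℝ) := by
  unfold chi
  refine Measurable.ite (by simp) measurable_const (Measurable.ite (by simp) ?_ measurable_const)
  exact Measurable.ite (isClosed_le continuous_norm continuous_const).measurableSet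
    measurable_const measurable_const

theorem chi_neg (σ : ℝ) (y : Rd d) : chi σ (-y) = chi σ y := by
  simp [chi]

theorem measurable_symbolIntegrand (σ : ℝ) (ξ : Rd d) : Measurable (symbolIntegrand σ ξ) := by
  have := measurable_chi (d := d) σ
  unfold symbolIntegrand
  fun_prop

theorem symbolIntegrand_neg (σ : ℝ) (ξ y : Rd d) :
    symbolIntegrand σ ξ (-y) = star (symbolIntegrand σ ξ y) := by
  simp only [symbolIntegrand, chi_neg, inner_neg_right, Complex.star_def, map_sub, map_mul,
    Complex.conj_I, Complex.conj_ofReal, map_one, ← Complex.exp_conj]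
  push_cast
  ring_nf

theorem symbolIntegrand_add_neg (σ : ℝ) (ξ y : Rd d) :
    symbolIntegrand σ ξ y + symbolIntegrand σ ξ (-y) =
      ((-2 * (1 - Real.cos (2 * Real.pi * ⟪ξ, y⟫)) : ℝ) : ℂ) := by
  rw [symbolIntegrand_neg, Complex.star_def, Complex.add_conj]
  congr 1
  simp only [symbolIntegrand, Complex.sub_re, Complex.one_re, Complex.mul_re, Complex.I_re,
    Complex.ofReal_re, Complex.I_im, Complex.ofReal_im]
  rw [mul_comm Complex.I, Complex.exp_ofReal_mul_I_re]
  ring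

/-- Near the origin the integrand is of first order for `σ < 1` and of second order otherwise. Far
away it is bounded for `σ ≤ 1` and of linear growth for `σ > 1`. Integrability is needed to split
the integral over the two halves of the symmetrization. -/
theorem integrable_symbolIntegrand {σ : ℝ} {μ : Measure (Rd d)} (hμ : LevyClass σ μ) (ξ : Rd d) :
    Integrable (symbolIntegrand σ ξ) μ := by
  have hm1 : MeasurableSet {z : Rd d | ‖z‖ ≤ 1} :=
    (isClosed_le continuous_norm continuous_const).measurableSet
  have hcompl : {z : Rd d | ‖z‖ ≤ 1}ᶜ = {z : Rd d | 1 < ‖z‖} := by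
    ext z; simp
  have hmeas := (measurable_symbolIntegrand σ ξ)
  have hfin := isFiniteMeasure_restrict_lt_norm hμ.levy.ne one_pos
  have hin : ∀ y, |2 * Real.pi * ⟪ξ, y⟫| ≤ 2 * Real.pi * ‖ξ‖ * ‖y‖ := by
    intro y
    rw [abs_mul, abs_of_pos Real.two_pi_pos, mul_assoc (2 * Real.pi)]
    exact mul_le_mul_of_nonneg_left (abs_real_inner_le_norm ξ y) Real.two_pi_pos.le
  have hsmall : IntegrableOn (symbolIntegrand σ ξ) {z : Rd d | ‖z‖ ≤ 1} μ := by
    rcases lt_or_ge σ 1 with h | h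
    -- As `σ < 1` is an infimum of exponents with finite moment near zero, some such exponent is
    -- below one, and the first moment is then finite there.
    · obtain ⟨α, ⟨-, hα⟩, hα1⟩ := (isGLB_lt_iff hμ.order).1 h
      have hi : IntegrableOn (fun y : Rd d => ‖y‖) {z : Rd d | ‖z‖ ≤ 1} μ := by
        refine ⟨Continuous.aestronglyMeasurable (by fun_prop), ?_⟩
        rw [hasFiniteIntegral_iff_ofReal (ae_of_all _ fun y => norm_nonneg y)]
        refine lt_of_le_of_lt (setLIntegral_mono (by fun_prop) fun z hz => ?_) hα
        refine ENNReal.ofReal_le_ofReal ?_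
        rcases eq_or_lt_of_le (norm_nonneg z) with h0 | h0
        · rw [← h0]; exact Real.rpow_nonneg le_rfl _
        · conv_lhs => rw [← Real.rpow_one ‖z‖]
          exact Real.rpow_le_rpow_of_exponent_ge h0 hz hα1.le
      refine (hi.const_mul (2 * Real.pi * ‖ξ‖)).mono' hmeas.aestronglyMeasurable
        (ae_of_all _ fun y => ?_)
      have h1 : symbolIntegrand σ ξ y =
          Complex.exp (Complex.I * (2 * Real.pi * ⟪ξ, y⟫ : ℝ)) - 1 := by
        simp [symbolIntegrand, chi, h]
      rw [h1]
      refine (Real.norm_exp_I_mul_ofReal_sub_one_le).trans ?_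
      exact hin y
    · have hi : IntegrableOn (fun y : Rd d => min (‖y‖ ^ 2) 1) {z : Rd d | ‖z‖ ≤ 1} μ :=
        (integrable_min_sq hμ.levy.ne).integrableOn
      refine (hi.const_mul (3 * (2 * Real.pi * ‖ξ‖) ^ 2)).mono' hmeas.aestronglyMeasurable ?_
      filter_upwards [ae_restrict_mem hm1] with y hy
      have hy' : ‖y‖ ≤ 1 := hy
      have hchi : chi σ y = 1 := by
        rw [chi, if_neg (not_lt.2 h), if_pos hy', ite_self]
      have h1 : symbolIntegrand σ ξ y =
          Complex.exp (Complex.I * (2 * Real.pi * ⟪ξ, y⟫ : ℝ)) - 1 -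
            Complex.I * (2 * Real.pi * ⟪ξ, y⟫ : ℝ) := by
        simp [symbolIntegrand, hchi]
      rw [h1, min_eq_left (pow_le_one₀ (norm_nonneg _) hy')]
      refine (norm_exp_sub_one_sub_le _).trans ?_
      rw [mul_assoc (3 : ℝ), ← mul_pow]
      refine mul_le_mul_of_nonneg_left ?_ (by norm_num)
      rw [← sq_abs]
      exact pow_le_pow_left₀ (abs_nonneg _) (hin y) 2
  have hlarge : IntegrableOn (symbolIntegrand σ ξ) {z : Rd d | 1 < ‖z‖} μ := by
    rcases le_or_gt σ 1 with h | h
    · refine Integrable.of_bound hmeas.aestronglyMeasurable 2 ?_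
      filter_upwards [ae_restrict_mem (measurableSet_lt_norm 1)] with y hy
      have hy' : 1 < ‖y‖ := hy
      have hchi : chi σ y = 0 := by
        rw [chi]
        split_ifs with h1 h2 h3
        · rfl
        · linarith
        · rfl
        · exact absurd (le_antisymm h (not_lt.1 h1)) h2
      have h1 : symbolIntegrand σ ξ y =
          Complex.exp (Complex.I * (2 * Real.pi * ⟪ξ, y⟫ : ℝ)) - 1 := by
        simp [symbolIntegrand, hchi]
      rw [h1]
      exact norm_exp_sub_one_le_two _
    · have hi : IntegrableOn (fun y : Rd d => ‖y‖) {z : Rd d | 1 < ‖z‖} μ := by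
        refine ⟨Continuous.aestronglyMeasurable (by fun_prop), ?_⟩
        rw [hasFiniteIntegral_iff_ofReal (ae_of_all _ fun y => norm_nonneg y)]
        exact hμ.first_moment ⟨h, hμ.order_mem.2⟩
      refine ((integrable_const (2 : ℝ)).add (hi.const_mul (2 * Real.pi * ‖ξ‖))).mono'
        hmeas.aestronglyMeasurable (ae_of_all _ fun y => ?_)
      have hchi : chi σ y = 1 := by
        rw [chi, if_neg (not_lt.2 h.le), if_neg h.ne']
      have h1 : symbolIntegrand σ ξ y =
          Complex.exp (Complex.I * (2 * Real.pi * ⟪ξ, y⟫ : ℝ)) - 1 -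
            Complex.I * (2 * Real.pi * ⟪ξ, y⟫ : ℝ) := by
        simp [symbolIntegrand, hchi]
      rw [h1]
      refine (norm_sub_le _ _).trans (add_le_add (norm_exp_sub_one_le_two _) ?_)
      rw [norm_mul, Complex.norm_I, one_mul, Complex.norm_real]
      exact hin y
  rw [← integrableOn_univ, ← union_compl_self {z : Rd d | ‖z‖ ≤ 1}, hcompl]
  exact hsmall.union hlarge

/-- The truncation is even, so reflecting `y` conjugates the integrand and averaging leaves its real
part `-(1 - cos)`. The compensator disappears for every `σ`. -/
theorem levySymbol_symmetrization {σ : ℝ} {μ : Measure (Rd d)} (hμ : LevyClass σ μ) (ξ : Rd d) :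
    levySymbol σ (symmetrization μ) ξ = -(levyExp μ ξ : ℂ) := by
  have hi := integrable_symbolIntegrand hμ ξ
  have hi' : Integrable (fun y => symbolIntegrand σ ξ (-y)) μ := by
    refine hi.norm.mono' ((measurable_symbolIntegrand σ ξ).comp measurable_neg).aestronglyMeasurable
      (ae_of_all _ fun y => ?_)
    rw [symbolIntegrand_neg, norm_star]
  have hmeas := (measurable_symbolIntegrand σ ξ).aestronglyMeasurable (μ := μ.map fun y => -y)
  have h1 : levySymbol σ (symmetrization μ) ξ = ∫ y, symbolIntegrand σ ξ y ∂(symmetrization μ) :=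
    rfl
  rw [h1, symmetrization, integral_smul_measure, integral_add_measure hi
    ((integrable_map_measure hmeas (by fun_prop)).2 hi'), integral_map (by fun_prop) hmeas,
    ← integral_add hi hi']
  simp only [symbolIntegrand_add_neg]
  rw [integral_complex_ofReal, integral_const_mul, levyExp]
  simp

theorem one_sub_levySymbol_cpow {σ : ℝ} {μ : Measure (Rd d)} (hμ : LevyClass σ μ) (s : ℝ)
    (ξ : Rd d) : (1 - levySymbol σ (symmetrization μ) ξ) ^ (s : ℂ) =
      (((1 + levyExp μ ξ) ^ s : ℝ) : ℂ) := by
  rw [levySymbol_symmetrization hμ, Complex.ofReal_cpow (by linarith [levyExp_nonneg μ ξ])]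
  push_cast
  ring_nf

end Symbol

/-! ### Translations and convolutions in the Schwartz space -/

section Translation

variable {V : Type*} [NormedAddCommGroup V] [InnerProductSpace ℝ V] [FiniteDimensional ℝ V]
  [MeasurableSpace V] [BorelSpace V]

open LineDeriv

theorem iteratedFDeriv_compSubConst (f : 𝓢(V, ℂ)) (a : V) (n : ℕ) (y : V) :
    iteratedFDeriv ℝ n (SchwartzMap.compSubConstCLM ℂ a f) y = iteratedFDeriv ℝ n f (y - a) := by
  have : (SchwartzMap.compSubConstCLM ℂ a f : V → ℂ) = fun y => f (y - a) := by
    ext y; simp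
  rw [this, iteratedFDeriv_comp_sub]

/-- From `‖y‖ ≤ (1 + ‖a‖)(1 + ‖y - a‖)`: seminorms grow polynomially in the translation, which a
Schwartz weight in `a` integrates. -/
theorem exists_seminorm_compSubConst_le (f : 𝓢(V, ℂ)) (k n : ℕ) :
    ∃ C : ℝ, 0 ≤ C ∧ ∀ a : V,
      SchwartzMap.seminorm ℂ k n (SchwartzMap.compSubConstCLM ℂ a f) ≤ C * (1 + ‖a‖) ^ k := by
  set C := 2 ^ k * ((Finset.Iic (k, n)).sup fun m => SchwartzMap.seminorm ℂ m.1 m.2) f with hC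
  have hC0 : 0 ≤ C := by positivity
  refine ⟨C, hC0, fun a => SchwartzMap.seminorm_le_bound ℂ k n _ (by positivity) fun y => ?_⟩
  rw [iteratedFDeriv_compSubConst]
  have h1 := SchwartzMap.one_add_le_sup_seminorm_apply (𝕜 := ℂ) (m := (k, n)) (k := k) (n := n)
    le_rfl le_rfl f (y - a)
  have h2 : ‖y‖ ≤ (1 + ‖a‖) * (1 + ‖y - a‖) := by
    have := norm_add_le (y - a) a
    rw [sub_add_cancel] at this
    nlinarith [norm_nonneg a, norm_nonneg (y - a)]
  calc ‖y‖ ^ k * ‖iteratedFDeriv ℝ n f (y - a)‖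
      ≤ ((1 + ‖a‖) * (1 + ‖y - a‖)) ^ k * ‖iteratedFDeriv ℝ n f (y - a)‖ := by gcongr
    _ = (1 + ‖a‖) ^ k * ((1 + ‖y - a‖) ^ k * ‖iteratedFDeriv ℝ n f (y - a)‖) := by
        rw [mul_pow, mul_assoc]
    _ ≤ (1 + ‖a‖) ^ k * C := by gcongr
    _ = _ := mul_comm _ _

/-- Mean value inequality along the segment from `y` to `y - a`. The weight `‖y‖^k` is comparable on
it because `‖a‖ ≤ 1`. -/
theorem exists_seminorm_compSubConst_sub_le (f : 𝓢(V, ℂ)) (k n : ℕ) :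
    ∃ C : ℝ, 0 ≤ C ∧ ∀ a : V, ‖a‖ ≤ 1 →
      SchwartzMap.seminorm ℂ k n (SchwartzMap.compSubConstCLM ℂ a f - f) ≤ C * ‖a‖ := by
  set C := 2 ^ k * ((Finset.Iic (k, n + 1)).sup fun m => SchwartzMap.seminorm ℂ m.1 m.2) f with hC
  have hC0 : 0 ≤ C := by positivity
  refine ⟨C, hC0, fun a ha => SchwartzMap.seminorm_le_bound ℂ k n _ (by positivity) fun y => ?_⟩
  have hsub : iteratedFDeriv ℝ n (SchwartzMap.compSubConstCLM ℂ a f - f : 𝓢(V, ℂ)) y =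
      iteratedFDeriv ℝ n f (y - a) - iteratedFDeriv ℝ n f y := by
    rw [← iteratedFDeriv_compSubConst]
    have : ((SchwartzMap.compSubConstCLM ℂ a f - f : 𝓢(V, ℂ)) : V → ℂ) =
      (SchwartzMap.compSubConstCLM ℂ a f : V → ℂ) - (f : V → ℂ) := rfl
    rw [this, iteratedFDeriv_sub_apply ((SchwartzMap.smooth _ n).contDiffAt)
      ((SchwartzMap.smooth _ n).contDiffAt)]
  rw [hsub]
  rcases eq_or_ne (‖y‖ ^ k) 0 with h0 | h0
  · rw [h0, zero_mul]; positivity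
  have hpos : 0 < ‖y‖ ^ k := lt_of_le_of_ne (by positivity) h0.symm
  have hseg : ∀ z ∈ segment ℝ y (y - a), ‖fderiv ℝ (iteratedFDeriv ℝ n f) z‖ ≤ C / ‖y‖ ^ k := by
    intro z hz
    rw [norm_fderiv_iteratedFDeriv, le_div_iff₀ hpos, mul_comm]
    have h1 := SchwartzMap.one_add_le_sup_seminorm_apply (𝕜 := ℂ) (m := (k, n + 1)) (k := k)
      (n := n + 1) le_rfl le_rfl f z
    refine le_trans ?_ h1
    gcongr
    have hz' : ‖y - z‖ ≤ ‖a‖ := by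
      rw [segment_eq_image'] at hz
      obtain ⟨θ, hθ, rfl⟩ := hz
      rw [show y - (y + θ • (y - a - y)) = θ • a by simp, norm_smul, Real.norm_of_nonneg hθ.1]
      exact mul_le_of_le_one_left (norm_nonneg _) hθ.2
    have := norm_sub_norm_le y z
    linarith
  have hmv := (convex_segment y (y - a)).norm_image_sub_le_of_norm_fderiv_le
    (f := iteratedFDeriv ℝ n f) (fun z _ =>
      ((f.smooth ⊤).differentiable_iteratedFDeriv (mod_cast ENat.natCast_lt_top n)) z) hseg
    (left_mem_segment ℝ y (y - a)) (right_mem_segment ℝ y (y - a))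
  rw [show y - a - y = -a by simp, norm_neg] at hmv
  calc ‖y‖ ^ k * ‖iteratedFDeriv ℝ n f (y - a) - iteratedFDeriv ℝ n f y‖
      ≤ ‖y‖ ^ k * (C / ‖y‖ ^ k * ‖a‖) := by gcongr
    _ = C * ‖a‖ := by field_simp

/-- Translations act continuously on the Schwartz space. -/
theorem continuous_compSubConst (f : 𝓢(V, ℂ)) :
    Continuous fun a : V => SchwartzMap.compSubConstCLM ℂ a f := by
  have hzero : Tendsto (fun a : V => SchwartzMap.compSubConstCLM ℂ a f) (𝓝 0) (𝓝 f) := by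
    rw [(schwartz_withSeminorms ℂ V ℂ).tendsto_nhds _ f]
    intro i ε hε
    obtain ⟨C, hC0, hC⟩ := exists_seminorm_compSubConst_sub_le f i.1 i.2
    have h1 : Tendsto (fun a : V => C * ‖a‖) (𝓝 0) (𝓝 0) := by
      have : Continuous fun a : V => C * ‖a‖ := by fun_prop
      simpa using this.tendsto 0
    filter_upwards [h1.eventually_lt_const hε, Metric.ball_mem_nhds (0 : V) one_pos] with a ha hb
    have hb' : ‖a‖ ≤ 1 := by
      have : ‖a‖ < 1 := by simpa using hb
      exact this.le
    exact (hC a hb').trans_lt ha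
  rw [continuous_iff_continuousAt]
  intro a₀
  have h2 : (fun a : V => SchwartzMap.compSubConstCLM ℂ a f) = fun a =>
      SchwartzMap.compSubConstCLM ℂ a₀ (SchwartzMap.compSubConstCLM ℂ (a - a₀) f) := by
    ext a y
    simp only [SchwartzMap.compSubConstCLM_apply]
    congr 1; abel
  rw [ContinuousAt, h2]
  refine ((SchwartzMap.compSubConstCLM ℂ a₀).continuous.tendsto _).comp ?_
  have h3 : Tendsto (fun a : V => a - a₀) (𝓝 a₀) (𝓝 0) := by
    have : Continuous fun a : V => a - a₀ := by fun_prop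
    simpa using this.tendsto a₀
  exact hzero.comp h3

theorem lineDerivOp_compSubConst (m a : V) (f : 𝓢(V, ℂ)) :
    ∂_{m} (SchwartzMap.compSubConstCLM ℂ a f) = SchwartzMap.compSubConstCLM ℂ a (∂_{m} f) := by
  ext y
  simp only [SchwartzMap.compSubConstCLM_apply, SchwartzMap.lineDerivOp_apply_eq_fderiv]
  have : (SchwartzMap.compSubConstCLM ℂ a f : V → ℂ) = fun y => f (y - a) := by
    ext y; simp
  rw [this, fderiv_comp_sub]

theorem iteratedLineDerivOp_compSubConst {n : ℕ} (m : Fin n → V) (a : V) (f : 𝓢(V, ℂ)) :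
    ∂^{m} (SchwartzMap.compSubConstCLM ℂ a f) = SchwartzMap.compSubConstCLM ℂ a (∂^{m} f) := by
  induction n with
  | zero => simp
  | succ n ih => rw [iteratedLineDerivOp_succ_left, ih, lineDerivOp_compSubConst,
      iteratedLineDerivOp_succ_left]

/-- The convolution of complex-valued Schwartz functions. -/
noncomputable abbrev schwartzConv (g h : 𝓢(V, ℂ)) : 𝓢(V, ℂ) :=
  SchwartzMap.convolution (ContinuousLinearMap.mul ℂ ℂ) g h

theorem schwartzConv_apply (g h : 𝓢(V, ℂ)) (y : V) :
    schwartzConv g h y = ∫ x, g x * h (y - x) := by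
  rw [schwartzConv, SchwartzMap.convolution_apply]
  simp [MeasureTheory.convolution]

/-- On the Fourier side a derivative is multiplication by a linear function, which can be attached
to either factor of the product. -/
theorem lineDerivOp_schwartzConv (m : V) (g h : 𝓢(V, ℂ)) :
    ∂_{m} (schwartzConv g h) = schwartzConv g (∂_{m} h) := by
  have hinj : Function.Injective (fun f : 𝓢(V, ℂ) => 𝓕 f) :=
    Function.LeftInverse.injective (g := fun f : 𝓢(V, ℂ) => 𝓕⁻ f) fun f => by simp
  apply hinj
  have ht : (inner ℝ · m : V → ℝ).HasTemperateGrowth := by fun_prop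
  simp only [SchwartzMap.fourier_convolution, SchwartzMap.fourier_lineDerivOp_eq]
  ext ξ
  simp [SchwartzMap.pairing_apply_apply, SchwartzMap.smulLeftCLM_apply_apply ht]
  ring

theorem iteratedLineDerivOp_schwartzConv {n : ℕ} (m : Fin n → V) (g h : 𝓢(V, ℂ)) :
    ∂^{m} (schwartzConv g h) = schwartzConv g (∂^{m} h) := by
  induction n with
  | zero => simp
  | succ n ih => rw [iteratedLineDerivOp_succ_left, ih, lineDerivOp_schwartzConv,
      iteratedLineDerivOp_succ_left]

end Translation

/-! ### Exchanging a tempered distribution with a convolution integral -/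

section Pairing

variable {V : Type*} [NormedAddCommGroup V] [InnerProductSpace ℝ V] [FiniteDimensional ℝ V]
  [MeasurableSpace V] [BorelSpace V]

open LineDeriv

/-- Index set of the weighted directional derivatives `‖y‖ ^ k * D^n f y m`, `(k, n) ∈ S`. -/
def DerivIndex (V : Type*) (S : Finset (ℕ × ℕ)) : Type _ := Σ i : S, V × (Fin i.1.2 → V)

/-- With the discrete topology every bounded function on the index set is continuous, so bounded
functions form a Banach space with no continuity to check. -/
instance (S : Finset (ℕ × ℕ)) : TopologicalSpace (DerivIndex V S) := ⊥

instance (S : Finset (ℕ × ℕ)) : DiscreteTopology (DerivIndex V S) := ⟨rfl⟩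

/-- The normalized weighted directional derivative of a Schwartz function. -/
noncomputable def weightedDeriv (S : Finset (ℕ × ℕ)) (f : 𝓢(V, ℂ)) (x : DerivIndex V S) : ℂ :=
  (((∏ j, ‖x.2.2 j‖)⁻¹ * ‖x.2.1‖ ^ x.1.1.1 : ℝ) : ℂ) * iteratedFDeriv ℝ x.1.1.2 f x.2.1 x.2.2

theorem norm_weightedDeriv_le (S : Finset (ℕ × ℕ)) (f : 𝓢(V, ℂ)) (x : DerivIndex V S) :
    ‖weightedDeriv S f x‖ ≤ (S.sup (schwartzSeminormFamily ℂ V ℂ)) f := by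
  have h1 : SchwartzMap.seminorm ℂ x.1.1.1 x.1.1.2 f ≤
      (S.sup (schwartzSeminormFamily ℂ V ℂ)) f :=
    Seminorm.le_finset_sup_apply x.1.2 (p := schwartzSeminormFamily ℂ V ℂ)
  refine le_trans ?_ ((SchwartzMap.le_seminorm ℂ x.1.1.1 x.1.1.2 f x.2.1).trans h1)
  have h0 : 0 ≤ ∏ j, ‖x.2.2 j‖ := Finset.prod_nonneg fun j _ => norm_nonneg _
  rw [weightedDeriv, norm_mul, Complex.norm_real, Real.norm_of_nonneg (by positivity)]
  have h2 := (iteratedFDeriv ℝ x.1.1.2 f x.2.1).le_opNorm x.2.2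
  calc _ ≤ (∏ j, ‖x.2.2 j‖)⁻¹ * ‖x.2.1‖ ^ x.1.1.1 *
        (‖iteratedFDeriv ℝ x.1.1.2 f x.2.1‖ * ∏ j, ‖x.2.2 j‖) := by gcongr
    _ = ((∏ j, ‖x.2.2 j‖)⁻¹ * ∏ j, ‖x.2.2 j‖) *
        (‖x.2.1‖ ^ x.1.1.1 * ‖iteratedFDeriv ℝ x.1.1.2 f x.2.1‖) := by ring
    _ ≤ 1 * (‖x.2.1‖ ^ x.1.1.1 * ‖iteratedFDeriv ℝ x.1.1.2 f x.2.1‖) := by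
        gcongr
        exact inv_mul_le_one
    _ = _ := one_mul _

/-- The weighted directional derivatives as a map into bounded functions. -/
noncomputable def weightedDerivCLM (S : Finset (ℕ × ℕ)) :
    𝓢(V, ℂ) →L[ℂ] BoundedContinuousFunction (DerivIndex V S) ℂ :=
  SchwartzMap.mkCLMtoNormedSpace (D := V) (E := ℂ) (𝕜 := ℂ) (𝕜' := ℂ) (σ := RingHom.id ℂ)
    (fun f => BoundedContinuousFunction.ofNormedAddCommGroupDiscrete (weightedDeriv S f)
      ((S.sup (schwartzSeminormFamily ℂ V ℂ)) f) (norm_weightedDeriv_le S f))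
    (fun f g => by
      ext x
      have h : iteratedFDeriv ℝ x.1.1.2 (f + g : V → ℂ) x.2.1 =
          iteratedFDeriv ℝ x.1.1.2 f x.2.1 + iteratedFDeriv ℝ x.1.1.2 g x.2.1 :=
        iteratedFDeriv_add_apply (f.smooth _).contDiffAt (g.smooth _).contDiffAt
      simp [weightedDeriv, h, mul_add])
    (fun a f => by
      ext x
      have h : iteratedFDeriv ℝ x.1.1.2 (a • (f : V → ℂ)) x.2.1 =
          a • iteratedFDeriv ℝ x.1.1.2 f x.2.1 :=
        iteratedFDeriv_const_smul_apply (f.smooth _).contDiffAt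
      simp [weightedDeriv, h, mul_left_comm])
    ⟨S, 1, zero_le_one, fun f => by
      rw [one_mul, BoundedContinuousFunction.norm_le (apply_nonneg _ _)]
      exact norm_weightedDeriv_le S f⟩

theorem norm_weightedDerivCLM_le (S : Finset (ℕ × ℕ)) (f : 𝓢(V, ℂ)) :
    ‖weightedDerivCLM S f‖ ≤ (S.sup (schwartzSeminormFamily ℂ V ℂ)) f := by
  rw [BoundedContinuousFunction.norm_le (apply_nonneg _ _)]
  exact norm_weightedDeriv_le S f

/-- The operator norm of a multilinear map is recovered by testing on vectors, so the embedding
loses none of the seminorms in `S`. -/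
theorem sup_seminorm_le_norm_weightedDerivCLM (S : Finset (ℕ × ℕ)) (f : 𝓢(V, ℂ)) :
    (S.sup (schwartzSeminormFamily ℂ V ℂ)) f ≤ ‖weightedDerivCLM S f‖ := by
  refine Seminorm.finset_sup_apply_le (norm_nonneg _) fun i hi => ?_
  refine SchwartzMap.seminorm_le_bound ℂ i.1 i.2 f (norm_nonneg _) fun y => ?_
  have h1 : ‖((‖y‖ ^ i.1 : ℝ)) • iteratedFDeriv ℝ i.2 f y‖ ≤ ‖weightedDerivCLM S f‖ := by
    refine ContinuousMultilinearMap.opNorm_le_bound (norm_nonneg _) fun m => ?_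
    have h0 : 0 ≤ ∏ j, ‖m j‖ := Finset.prod_nonneg fun j _ => norm_nonneg _
    rcases h0.eq_or_lt with h | h
    · obtain ⟨j, -, hj⟩ := Finset.prod_eq_zero_iff.1 h.symm
      rw [ContinuousMultilinearMap.map_coord_zero _ j (norm_eq_zero.1 hj), norm_zero, ← h,
        mul_zero]
    · have h2 : ‖(((∏ j, ‖m j‖)⁻¹ * ‖y‖ ^ i.1 : ℝ) : ℂ) * iteratedFDeriv ℝ i.2 f y m‖ ≤
          ‖weightedDerivCLM S f‖ :=
        (weightedDerivCLM S f).norm_coe_le_norm (⟨⟨i, hi⟩, y, m⟩ : DerivIndex V S)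
      rw [norm_mul, Complex.norm_real,
        Real.norm_of_nonneg (by positivity), mul_assoc, inv_mul_le_iff₀ h, mul_comm] at h2
      rw [smul_apply, norm_smul, norm_pow, norm_norm, mul_comm]
      linarith
  rwa [norm_smul, norm_pow, norm_norm] at h1

/-- A functional dominated by the norm of a linear map into a normed space factors through it. -/
theorem exists_factor_of_norm_le {M E : Type*} [AddCommGroup M] [Module ℂ M]
    [NormedAddCommGroup E] [NormedSpace ℂ E] (v : M →ₗ[ℂ] ℂ) (T : M →ₗ[ℂ] E) (C : ℝ)
    (hvT : ∀ f, ‖v f‖ ≤ C * ‖T f‖) : ∃ W : E →L[ℂ] ℂ, ∀ f, v f = W (T f) := by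
  -- The domination forces `v` to vanish on the kernel of `T`. It therefore descends to the range,
  -- where it is bounded and extends by Hahn–Banach.
  have hker : LinearMap.ker T ≤ LinearMap.ker v := fun f hf => by
    have h1 := hvT f
    rw [LinearMap.mem_ker] at hf
    rw [hf, norm_zero, mul_zero] at h1
    exact norm_le_zero_iff.1 h1
  set w : LinearMap.range T →ₗ[ℂ] ℂ :=
    ((LinearMap.ker T).liftQ v hker).comp T.quotKerEquivRange.symm.toLinearMap with hw
  have hwT : ∀ f, w ⟨T f, LinearMap.mem_range_self T f⟩ = v f := fun f => by
    simp only [hw, LinearMap.comp_apply, LinearEquiv.coe_coe]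
    rw [LinearMap.quotKerEquivRange_symm_apply_image]
    rfl
  obtain ⟨W, hW, -⟩ := exists_extension_norm_eq (LinearMap.range T) (w.mkContinuous C (by
    rintro ⟨_, f, rfl⟩
    rw [hwT]
    exact hvT f))
  refine ⟨W, fun f => ?_⟩
  rw [← hwT f]
  exact (hW ⟨T f, LinearMap.mem_range_self T f⟩).symm

theorem integrable_mul_one_add_norm_pow (g : 𝓢(V, ℂ)) (k : ℕ) :
    Integrable (fun x => ‖g x‖ * (1 + ‖x‖) ^ k) := by
  have h1 : Integrable (fun x => 2 ^ (k - 1) * (‖x‖ ^ 0 * ‖g x‖ + ‖x‖ ^ k * ‖g x‖)) :=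
    ((g.integrable_pow_mul volume 0).add (g.integrable_pow_mul volume k)).const_mul _
  refine h1.mono' (Continuous.aestronglyMeasurable (by have := g.continuous; fun_prop))
    (ae_of_all _ fun x => ?_)
  rw [Real.norm_of_nonneg (by positivity)]
  have h2 := add_pow_le (zero_le_one' ℝ) (norm_nonneg x) k
  rw [one_pow] at h2
  calc ‖g x‖ * (1 + ‖x‖) ^ k ≤ ‖g x‖ * (2 ^ (k - 1) * (1 + ‖x‖ ^ k)) := by gcongr
    _ = _ := by ring

theorem exists_sup_seminorm_compSubConst_le (S : Finset (ℕ × ℕ)) (h : 𝓢(V, ℂ)) :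
    ∃ (k : ℕ) (C : ℝ), 0 ≤ C ∧ ∀ x, (S.sup (schwartzSeminormFamily ℂ V ℂ))
      (SchwartzMap.compSubConstCLM ℂ x h) ≤ C * (1 + ‖x‖) ^ k := by
  choose D hD0 hD using fun i : ℕ × ℕ => exists_seminorm_compSubConst_le h i.1 i.2
  have hs : 0 ≤ ∑ i ∈ S, D i := Finset.sum_nonneg fun i _ => hD0 i
  refine ⟨S.sup Prod.fst, ∑ i ∈ S, D i, hs, fun x => ?_⟩
  refine Seminorm.finset_sup_apply_le (mul_nonneg hs (by positivity))
    fun i hi => (hD i x).trans ?_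
  gcongr
  · exact Finset.single_le_sum (fun i _ => hD0 i) hi
  · linarith [norm_nonneg x]
  · exact Finset.le_sup (f := Prod.fst) hi

/-- A tempered distribution commutes with the integral defining the convolution of Schwartz
functions. -/
theorem apply_schwartzConv (v : 𝓢(V, ℂ) →L[ℂ] ℂ) (g h : 𝓢(V, ℂ)) :
    Integrable (fun x => g x * v (SchwartzMap.compSubConstCLM ℂ x h)) ∧
    v (schwartzConv g h) = ∫ x, g x * v (SchwartzMap.compSubConstCLM ℂ x h) := by
  obtain ⟨S, C, -, hS⟩ := Seminorm.bound_of_continuous (schwartz_withSeminorms ℂ V ℂ)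
    ((normSeminorm ℂ ℂ).comp v.toLinearMap) (continuous_norm.comp v.continuous)
  have hv : ∀ f, ‖v f‖ ≤ C * (S.sup (schwartzSeminormFamily ℂ V ℂ)) f := fun f => by
    simpa [NNReal.smul_def] using hS f
  -- The distribution becomes a bounded functional on a Banach space, so it commutes with Bochner
  -- integrals of functions valued there.
  obtain ⟨W, hW⟩ := exists_factor_of_norm_le v.toLinearMap (weightedDerivCLM S).toLinearMap C
    fun f => (hv f).trans
      (mul_le_mul_of_nonneg_left (sup_seminorm_le_norm_weightedDerivCLM S f) C.2)
  have hWT : ∀ f, v f = W (weightedDerivCLM S f) := hW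
  have hint : Integrable fun x =>
      g x • weightedDerivCLM S (SchwartzMap.compSubConstCLM ℂ x h) := by
    obtain ⟨k, D, hD, hb⟩ := exists_sup_seminorm_compSubConst_le S h
    refine ((integrable_mul_one_add_norm_pow g k).const_mul D).mono'
      (Continuous.aestronglyMeasurable
        (g.continuous.smul ((weightedDerivCLM S).continuous.comp (continuous_compSubConst h))))
      (ae_of_all _ fun x => ?_)
    rw [norm_smul]
    calc _ ≤ ‖g x‖ * (D * (1 + ‖x‖) ^ k) := by
          gcongr
          exact (norm_weightedDerivCLM_le S _).trans (hb x)
      _ = _ := by ring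
  -- Evaluating at an index reduces the identity to the pointwise convolution formula for one
  -- iterated derivative, which falls on `h` alone.
  have key : weightedDerivCLM S (schwartzConv g h) =
      ∫ x, g x • weightedDerivCLM S (SchwartzMap.compSubConstCLM ℂ x h) := by
    ext z
    have hz : ∀ f : 𝓢(V, ℂ), weightedDerivCLM S f z =
        (((∏ j, ‖z.2.2 j‖)⁻¹ * ‖z.2.1‖ ^ z.1.1.1 : ℝ) : ℂ) * (∂^{z.2.2} f) z.2.1 := fun f => by
      rw [SchwartzMap.iteratedLineDerivOp_eq_iteratedFDeriv]
      rfl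
    have hev := (BoundedContinuousFunction.evalCLM ℂ (β := ℂ) z).integral_comp_comm hint
    simp only [BoundedContinuousFunction.evalCLM_apply] at hev
    rw [← hev, hz, iteratedLineDerivOp_schwartzConv, schwartzConv_apply, ← integral_const_mul]
    refine integral_congr_ae (ae_of_all _ fun x => ?_)
    simp only [BoundedContinuousFunction.coe_smul, hz, iteratedLineDerivOp_compSubConst,
      SchwartzMap.compSubConstCLM_apply, smul_eq_mul]
    ring
  have hWx : ∀ x, W (g x • weightedDerivCLM S (SchwartzMap.compSubConstCLM ℂ x h)) =
      g x * v (SchwartzMap.compSubConstCLM ℂ x h) := fun x => by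
    rw [map_smul, ← hWT, smul_eq_mul]
  have h1 := W.integrable_comp hint
  simp only [hWx] at h1
  refine ⟨h1, ?_⟩
  rw [hWT, key, ← W.integral_comp_comm hint]
  simp only [hWx]

end Pairing

/-! ### Fourier multipliers acting on tempered distributions -/

section Multiplier

variable {V : Type*} [NormedAddCommGroup V] [InnerProductSpace ℝ V] [FiniteDimensional ℝ V]
  [MeasurableSpace V] [BorelSpace V]

/-- The product of Schwartz functions. -/
noncomputable def schwartzMul (a b : 𝓢(V, ℂ)) : 𝓢(V, ℂ) :=
  SchwartzMap.pairing (ContinuousLinearMap.mul ℂ ℂ) a b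

@[simp]
theorem schwartzMul_apply (a b : 𝓢(V, ℂ)) (x : V) : schwartzMul a b x = a x * b x := rfl

theorem fourier_eq_fourierInv_neg (f : V → ℂ) (x : V) : 𝓕 f x = 𝓕⁻ f (-x) := by
  rw [Real.fourierInv_eq_fourier_neg, neg_neg]

theorem fourier_fourier_schwartz (a : 𝓢(V, ℂ)) (x : V) : 𝓕 (𝓕 a) x = a (-x) := by
  rw [SchwartzMap.fourier_coe, fourier_eq_fourierInv_neg, ← SchwartzMap.fourierInv_coe]
  simp

/-- Checked after one more Fourier transform: it turns the convolution into a product, and the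
transform applied twice is the reflection. -/
theorem schwartzConv_fourier (a b : 𝓢(V, ℂ)) :
    schwartzConv (𝓕 a) (𝓕 b) = 𝓕 (schwartzMul a b) := by
  have hinj : Function.Injective (fun f : 𝓢(V, ℂ) => 𝓕 f) :=
    Function.LeftInverse.injective (g := fun f : 𝓢(V, ℂ) => 𝓕⁻ f) fun f => by simp
  apply hinj
  simp only [SchwartzMap.fourier_convolution]
  ext x
  rw [SchwartzMap.pairing_apply_apply, fourier_fourier_schwartz, fourier_fourier_schwartz,
    fourier_fourier_schwartz]
  rfl

theorem schwartzConv_compSubConst (g h : 𝓢(V, ℂ)) (x : V) :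
    schwartzConv (SchwartzMap.compSubConstCLM ℂ x g) h =
      SchwartzMap.compSubConstCLM ℂ x (schwartzConv g h) := by
  ext y
  simp only [schwartzConv_apply, SchwartzMap.compSubConstCLM_apply]
  rw [← integral_sub_right_eq_self (fun z => g z * h (y - x - z)) x]
  refine integral_congr_ae (ae_of_all _ fun z => ?_)
  simp only [sub_sub_sub_cancel_right]

/-- The Fourier multiplier `a` applied to the tempered distribution `v`: the smooth function
`𝓕⁻¹ a * v`. -/
noncomputable def multiplierConv (a : 𝓢(V, ℂ)) (v : 𝓢'(V, ℂ)) (x : V) : ℂ :=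
  v (SchwartzMap.compSubConstCLM ℂ x (𝓕 a))

theorem continuous_multiplierConv (a : 𝓢(V, ℂ)) (v : 𝓢'(V, ℂ)) :
    Continuous (multiplierConv a v) :=
  (ContinuousLinearMap.continuous v).comp (continuous_compSubConst _)

theorem multiplierConv_add_left (a b : 𝓢(V, ℂ)) (v : 𝓢'(V, ℂ)) :
    multiplierConv (a + b) v = multiplierConv a v + multiplierConv b v := by
  ext x
  simp [multiplierConv, FourierTransform.fourier_add]

theorem multiplierConv_sum {ι : Type*} (s : Finset ι) (a : ι → 𝓢(V, ℂ)) (v : 𝓢'(V, ℂ)) :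
    multiplierConv (∑ i ∈ s, a i) v = ∑ i ∈ s, multiplierConv (a i) v := by
  classical
  induction s using Finset.induction_on with
  | empty => ext x; simp [multiplierConv, FourierTransform.fourier_zero]
  | insert i s hi ih => rw [Finset.sum_insert hi, Finset.sum_insert hi, multiplierConv_add_left, ih]

theorem multiplierConv_add (a : 𝓢(V, ℂ)) (v w : 𝓢'(V, ℂ)) :
    multiplierConv a (v + w) = multiplierConv a v + multiplierConv a w := rfl

theorem multiplierConv_sub (a : 𝓢(V, ℂ)) (v w : 𝓢'(V, ℂ)) :
    multiplierConv a (v - w) = multiplierConv a v - multiplierConv a w := rfl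

theorem integrable_mul_multiplierConv (g a : 𝓢(V, ℂ)) (v : 𝓢'(V, ℂ)) :
    Integrable fun x => g x * multiplierConv a v x :=
  (apply_schwartzConv v g (𝓕 a)).1

theorem apply_schwartzConv_fourier (g a : 𝓢(V, ℂ)) (v : 𝓢'(V, ℂ)) :
    v (schwartzConv g (𝓕 a)) = ∫ x, g x * multiplierConv a v x :=
  (apply_schwartzConv v g (𝓕 a)).2

/-- Composition of multipliers: `b` acts on the smooth function produced by `a` as an ordinary
convolution. This brings Young's inequality to distributions. -/
theorem multiplierConv_mul (a b : 𝓢(V, ℂ)) (v : 𝓢'(V, ℂ)) (x : V) :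
    multiplierConv (schwartzMul b a) v x = ∫ y, 𝓕⁻ (b : V → ℂ) (x - y) * multiplierConv a v y := by
  rw [multiplierConv, ← schwartzConv_fourier, ← schwartzConv_compSubConst,
    apply_schwartzConv_fourier]
  refine integral_congr_ae (ae_of_all _ fun y => ?_)
  simp only [SchwartzMap.compSubConstCLM_apply]
  rw [SchwartzMap.fourier_coe, fourier_eq_fourierInv_neg, neg_sub]

theorem eLpNorm_multiplierConv_mul_le (a b : 𝓢(V, ℂ)) (v : 𝓢'(V, ℂ)) {p : ℝ} (hp : 1 ≤ p) :
    eLpNorm (multiplierConv (schwartzMul b a) v) (ENNReal.ofReal p) volume ≤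
      kernelNorm b * eLpNorm (multiplierConv a v) (ENNReal.ofReal p) volume := by
  rw [funext (multiplierConv_mul a b v)]
  exact eLpNorm_integral_sub_mul_le (continuous_fourierInv b.integrable)
    (continuous_multiplierConv a v) hp

theorem tendsto_multiplierConv {ι : Type*} {l : Filter ι} {v : ι → 𝓢'(V, ℂ)} {w : 𝓢'(V, ℂ)}
    (h : Tendsto v l (𝓝 w)) (a : 𝓢(V, ℂ)) (x : V) :
    Tendsto (fun i => multiplierConv a (v i) x) l (𝓝 (multiplierConv a w x)) :=
  (PointwiseConvergenceCLM.tendsto_iff_forall_tendsto.1 h) _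

theorem multiplierConv_toTemperedDistribution (a u : 𝓢(V, ℂ)) (x : V) :
    multiplierConv a (SchwartzMap.toTemperedDistributionCLM V ℂ volume u) x =
      𝓕⁻ (fun ξ => a ξ * 𝓕 u ξ) x := by
  rw [SchwartzMap.fourier_coe, fourierInv_mul_fourier a.integrable u.integrable, multiplierConv]
  refine (SchwartzMap.toTemperedDistributionCLM_apply_apply volume u _).trans ?_
  refine integral_congr_ae (ae_of_all _ fun y => ?_)
  simp only [SchwartzMap.compSubConstCLM_apply, smul_eq_mul]
  rw [SchwartzMap.fourier_coe, fourier_eq_fourierInv_neg, neg_sub]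

end Multiplier

/-! ### Dilated cutoffs -/

section Cutoff

variable {V : Type*} [NormedAddCommGroup V] [InnerProductSpace ℝ V] [FiniteDimensional ℝ V]
  [MeasurableSpace V] [BorelSpace V]

theorem norm_iteratedFDeriv_comp_smul_le {f : V → ℂ} (hf : ContDiff ℝ ∞ f) (ε : ℝ) (i : ℕ) (x : V) :
    ‖iteratedFDeriv ℝ i (fun y => f (ε • y)) x‖ ≤ |ε| ^ i * ‖iteratedFDeriv ℝ i f (ε • x)‖ := by
  have h := (ε • ContinuousLinearMap.id ℝ V).iteratedFDeriv_comp_right (f := f) hf x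
    (i := i) (mod_cast le_top)
  have h' : (f ∘ (ε • ContinuousLinearMap.id ℝ V)) = fun y => f (ε • y) := rfl
  rw [h'] at h
  rw [h]
  refine (ContinuousMultilinearMap.norm_compContinuousLinearMap_le _ _).trans ?_
  rw [mul_comm]
  simp only [Finset.prod_const, Finset.card_univ, Fintype.card_fin]
  gcongr
  · exact ContinuousLinearMap.opNorm_le_bound _ (abs_nonneg _) fun y => by
      simp [norm_smul]
  · rfl

theorem exists_bound_iteratedFDeriv {f : V → ℂ} (h1 : ContDiff ℝ ∞ f) (h2 : HasCompactSupport f)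
    (i : ℕ) : ∃ B : ℝ, 0 ≤ B ∧ ∀ x, ‖iteratedFDeriv ℝ i f x‖ ≤ B := by
  obtain ⟨B, hB⟩ := (h1.continuous_iteratedFDeriv (m := i) (mod_cast le_top)).bounded_above_of_compact_support
    (h2.iteratedFDeriv i)
  exact ⟨B, (norm_nonneg _).trans (hB 0), hB⟩

/-- Dilated cutoffs approximate the identity on the Schwartz space. -/
theorem tendsto_cutoff_mul {f : V → ℂ} (h1 : ContDiff ℝ ∞ f) (h2 : HasCompactSupport f) {r : ℝ}
    (hr : 0 < r) (hf : ∀ ξ, ‖ξ‖ < r → f ξ = 1) {ε : ℕ → ℝ} (hε : Tendsto ε atTop (𝓝 0))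
    (a : ℕ → 𝓢(V, ℂ)) (ha : ∀ n ξ, a n ξ = f (ε n • ξ)) (g : 𝓢(V, ℂ)) :
    Tendsto (fun n => schwartzMul (a n) g) atTop (𝓝 g) := by
  rw [(schwartz_withSeminorms ℂ V ℂ).tendsto_nhds _ g]
  rintro ⟨k, n⟩ δ hδ
  set ψ : V → ℂ := fun ξ => f ξ - 1 with hψ
  have hψc : ContDiff ℝ ∞ ψ := h1.sub contDiff_const
  have hψ0 : ∀ i ξ, ‖ξ‖ < r → iteratedFDeriv ℝ i ψ ξ = 0 := by
    intro i ξ hξ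
    have : ψ =ᶠ[𝓝 ξ] 0 := by
      filter_upwards [(isOpen_lt continuous_norm continuous_const).mem_nhds hξ] with η hη
      simp only [hψ, hf η hη, sub_self, Pi.zero_apply]
    rw [(this.iteratedFDeriv ℝ i).self_of_nhds]
    simp
  have hB : ∀ i : ℕ, ∃ B : ℝ, 0 ≤ B ∧ ∀ ξ, ‖iteratedFDeriv ℝ i ψ ξ‖ ≤ B := by
    intro i
    obtain ⟨B, hB0, hB⟩ := exists_bound_iteratedFDeriv h1 h2 i
    refine ⟨B + 1, by linarith, fun ξ => ?_⟩
    have hd : iteratedFDeriv ℝ i ψ ξ = iteratedFDeriv ℝ i f ξ - iteratedFDeriv ℝ i (fun _ => (1 : ℂ)) ξ :=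
      iteratedFDeriv_sub_apply (h1.of_le (mod_cast le_top)).contDiffAt contDiffAt_const
    rw [hd]
    refine (norm_sub_le _ _).trans (add_le_add (hB ξ) ?_)
    rcases Nat.eq_zero_or_pos i with rfl | hi
    · simp
    · rw [iteratedFDeriv_const_of_ne hi.ne']; simp
  choose B hB0 hB using hB
  set D : ℝ := ∑ i ∈ Finset.range (n + 1), (n.choose i : ℝ) * B i *
    SchwartzMap.seminorm ℂ (k + 1) (n - i) g with hD
  have hD0 : 0 ≤ D := Finset.sum_nonneg fun i _ =>
    mul_nonneg (mul_nonneg (by positivity) (hB0 i)) (apply_nonneg _ _)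
  have hbound : ∀ m, |ε m| ≤ 1 → SchwartzMap.seminorm ℂ k n (schwartzMul (a m) g - g) ≤
      |ε m| / r * D := by
    intro m hm
    refine SchwartzMap.seminorm_le_bound ℂ k n _ (by positivity) fun x => ?_
    have hfun : ((schwartzMul (a m) g - g : 𝓢(V, ℂ)) : V → ℂ) = fun y => ψ (ε m • y) * g y := by
      ext y
      simp [hψ, ha, sub_mul]
    rw [hfun]
    have hL := norm_iteratedFDeriv_mul_le (𝕜 := ℝ) (n := n) (N := ∞)
      (f := fun y => ψ (ε m • y)) (g := g) (hψc.comp (contDiff_const_smul _))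
      (g.smooth ⊤) x (mod_cast le_top)
    calc ‖x‖ ^ k * _ ≤ ‖x‖ ^ k * _ := mul_le_mul_of_nonneg_left hL (by positivity)
      _ = ∑ i ∈ Finset.range (n + 1), ‖x‖ ^ k * ((n.choose i : ℝ) *
          ‖iteratedFDeriv ℝ i (fun y => ψ (ε m • y)) x‖ * ‖iteratedFDeriv ℝ (n - i) g x‖) := by
          rw [Finset.mul_sum]
      _ ≤ ∑ i ∈ Finset.range (n + 1), |ε m| / r * ((n.choose i : ℝ) * B i *
            SchwartzMap.seminorm ℂ (k + 1) (n - i) g) := by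
          refine Finset.sum_le_sum fun i _ => ?_
          have hs := SchwartzMap.le_seminorm ℂ (k + 1) (n - i) g x
          -- The derivatives of `f - 1` vanish on the ball of radius `r`, so where a dilated one is
          -- nonzero `1 ≤ |ε|‖x‖/r`. This gains the small factor `|ε|` for one extra power of `‖x‖`,
          -- whence the seminorm of order `k + 1`.
          have h3 : ‖iteratedFDeriv ℝ i (fun y => ψ (ε m • y)) x‖ ≤ B i * (|ε m| * ‖x‖ / r) := by
            refine (norm_iteratedFDeriv_comp_smul_le hψc (ε m) i x).trans ?_
            have h4 : |ε m| ^ i ≤ 1 := pow_le_one₀ (abs_nonneg _) hm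
            rcases lt_or_ge ‖ε m • x‖ r with h5 | h5
            · rw [hψ0 i _ h5, norm_zero, mul_zero]
              exact mul_nonneg (hB0 i) (by positivity)
            · rw [norm_smul, Real.norm_eq_abs] at h5
              have h6 : 1 ≤ |ε m| * ‖x‖ / r := (one_le_div hr).2 h5
              calc _ ≤ 1 * B i := mul_le_mul h4 (hB i _) (norm_nonneg _) zero_le_one
                _ = B i * 1 := mul_comm _ _
                _ ≤ _ := mul_le_mul_of_nonneg_left h6 (hB0 i)
          calc ‖x‖ ^ k * ((n.choose i : ℝ) *
                ‖iteratedFDeriv ℝ i (fun y => ψ (ε m • y)) x‖ * ‖iteratedFDeriv ℝ (n - i) g x‖)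
              ≤ ‖x‖ ^ k * ((n.choose i : ℝ) * (B i * (|ε m| * ‖x‖ / r)) *
                  ‖iteratedFDeriv ℝ (n - i) g x‖) := by gcongr
            _ = |ε m| / r * ((n.choose i : ℝ) * B i *
                  (‖x‖ ^ (k + 1) * ‖iteratedFDeriv ℝ (n - i) g x‖)) := by ring
            _ ≤ _ := by
              have := hB0 i
              gcongr
      _ = _ := by rw [← Finset.mul_sum]
  have habs : Tendsto (fun m => |ε m|) atTop (𝓝 0) := by simpa using hε.abs
  have hlim : Tendsto (fun m => |ε m| / r * D) atTop (𝓝 0) := by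
    simpa using (habs.div_const r).mul_const D
  filter_upwards [hlim.eventually_lt_const hδ, habs.eventually_lt_const one_pos] with m hm hm'
  exact (hbound m hm'.le).trans_lt hm

end Cutoff

/-! ### Sequences in `ℓ^q` -/

section LqNorm

/-- The `ℓ^q` norm of a sequence in `[0, ∞]`. -/
noncomputable def lqNorm (q : ℝ) (x : ℕ → ℝ≥0∞) : ℝ≥0∞ := (∑' j, x j ^ q) ^ (1 / q)

theorem lqNorm_mono {q : ℝ} (hq : 1 < q) {x y : ℕ → ℝ≥0∞} (h : ∀ j, x j ≤ y j) : lqNorm q x ≤ lqNorm q y := by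
  have : 0 < q := by linarith
  unfold lqNorm
  gcongr with j
  exact h j

theorem lqNorm_const_mul {q : ℝ} (hq : 1 < q) (c : ℝ≥0∞) (x : ℕ → ℝ≥0∞) :
    lqNorm q (fun j => c * x j) = c * lqNorm q x := by
  have h0 : 0 < q := by linarith
  simp only [lqNorm, ENNReal.mul_rpow_of_nonneg _ _ h0.le, ENNReal.tsum_mul_left]
  rw [ENNReal.mul_rpow_of_nonneg _ _ (by positivity), ← ENNReal.rpow_mul,
    mul_one_div_cancel h0.ne', ENNReal.rpow_one]

theorem lqNorm_add_le {q : ℝ} (hq : 1 < q) (x y : ℕ → ℝ≥0∞) :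
    lqNorm q (fun j => x j + y j) ≤ lqNorm q x + lqNorm q y := by
  have := ENNReal.lintegral_Lp_add_le (μ := (Measure.count : Measure ℕ)) (f := x) (g := y)
    (Measurable.of_discrete.aemeasurable) (Measurable.of_discrete.aemeasurable) hq.le
  simpa only [lintegral_count, Pi.add_apply, lqNorm] using this

theorem le_lqNorm {q : ℝ} (hq : 1 < q) (x : ℕ → ℝ≥0∞) (j : ℕ) : x j ≤ lqNorm q x := by
  have h0 : 0 < q := by linarith
  calc x j = (x j ^ q) ^ (1 / q) := by
        rw [← ENNReal.rpow_mul, mul_one_div_cancel h0.ne', ENNReal.rpow_one]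
    _ ≤ _ := ENNReal.rpow_le_rpow (ENNReal.le_tsum j) (by positivity)

theorem lqNorm_le_iff {q : ℝ} (hq : 1 < q) (x : ℕ → ℝ≥0∞) (M : ℝ≥0∞) : lqNorm q x ≤ M ↔ ∑' j, x j ^ q ≤ M ^ q := by
  have h0 : 0 < q := by linarith
  rw [lqNorm, one_div, ENNReal.rpow_inv_le_iff h0]

/-- Fatou's lemma for the counting measure; the power `q` commutes with the lower limit because it
is an order isomorphism of `[0, ∞]`. -/
theorem lqNorm_le_of_le_liminf {q : ℝ} (hq : 1 < q) {x : ℕ → ℕ → ℝ≥0∞} {y : ℕ → ℝ≥0∞} {M : ℝ≥0∞}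
    (hy : ∀ j, y j ≤ liminf (fun n => x n j) atTop) (hM : ∀ᶠ n in atTop, lqNorm q (x n) ≤ M) :
    lqNorm q y ≤ M := by
  have h0 : 0 < q := by linarith
  rw [lqNorm_le_iff hq]
  have h1 : ∀ j, y j ^ q ≤ liminf (fun n => x n j ^ q) atTop := fun j => by
    have := (ENNReal.orderIsoRpow q h0).liminf_apply (f := atTop) (u := fun n => x n j)
    simp only [ENNReal.orderIsoRpow_apply] at this
    rw [← this]
    exact ENNReal.rpow_le_rpow (hy j) h0.le
  have h2 := lintegral_liminf_le (μ := (Measure.count : Measure ℕ)) (u := atTop)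
    (f := fun n j => x n j ^ q) fun n => Measurable.of_discrete
  simp only [lintegral_count] at h2
  refine (ENNReal.tsum_le_tsum h1).trans (h2.trans ?_)
  refine liminf_le_of_frequently_le' (Eventually.frequently ?_)
  filter_upwards [hM] with n hn
  exact (lqNorm_le_iff hq _ _).1 hn

theorem lqNorm_lt_top_of_le_geometric {q : ℝ} (hq : 1 < q) {x : ℕ → ℝ≥0∞} {C : ℝ≥0∞} (hC : C ≠ ⊤)
    (h : ∀ j, x j ≤ C * 2⁻¹ ^ j) : lqNorm q x < ⊤ := by
  have h0 : 0 < q := by linarith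
  refine lt_of_le_of_lt (lqNorm_mono hq h) ?_
  rw [lqNorm_const_mul hq]
  refine ENNReal.mul_lt_top hC.lt_top ?_
  refine ENNReal.rpow_lt_top_of_nonneg (by positivity) (ne_top_of_le_ne_top
    (b := ∑' j : ℕ, (2⁻¹ : ℝ≥0∞) ^ j) ?_ (ENNReal.tsum_le_tsum fun j => ?_))
  · rw [ENNReal.tsum_geometric]
    simp
  -- The terms are at most one and `q > 1`, so raising them to the power `q` only decreases them.
  · conv_rhs => rw [← ENNReal.rpow_one (2⁻¹ ^ j)]
    exact ENNReal.rpow_le_rpow_of_exponent_ge (pow_le_one₀ (by simp) (by simp)) hq.le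

theorem tendsto_lqNorm_tail {q : ℝ} (hq : 1 < q) {x : ℕ → ℝ≥0∞} (hx : lqNorm q x < ⊤) :
    Tendsto (fun n => lqNorm q fun j => if n ≤ j then x j else 0) atTop (𝓝 0) := by
  have h0 : 0 < q := by linarith
  have hfin : ∑' j, x j ^ q ≠ ⊤ := by
    intro h
    rw [lqNorm, h, ENNReal.top_rpow_of_pos (by positivity)] at hx
    exact lt_irrefl _ hx
  have h1 := tendsto_lintegral_of_dominated_convergence (μ := (Measure.count : Measure ℕ))
    (F := fun n j => (if n ≤ j then x j else 0) ^ q) (f := fun _ => 0) (fun j => x j ^ q)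
    (fun n => Measurable.of_discrete) (fun n => ae_of_all _ fun j => by
      dsimp only
      gcongr
      split_ifs <;> simp) (by rwa [lintegral_count]) (ae_of_all _ fun j => by
      refine tendsto_const_nhds.congr' ?_
      filter_upwards [eventually_gt_atTop j] with n hn
      rw [if_neg (by omega), ENNReal.zero_rpow_of_pos h0])
  simp only [lintegral_count, tsum_zero] at h1
  have h2 := (ENNReal.continuous_rpow_const (y := 1 / q)).tendsto 0 |>.comp h1
  rw [ENNReal.zero_rpow_of_pos (by positivity)] at h2
  exact h2

end LqNorm

/-! ### Decay of frequency-localized pieces of Schwartz functions -/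

section SchwartzBound

variable {V : Type*} [NormedAddCommGroup V] [InnerProductSpace ℝ V] [FiniteDimensional ℝ V]
  [MeasurableSpace V] [BorelSpace V]

theorem continuous_sup_seminorm (S : Finset (ℕ × ℕ)) :
    Continuous fun f : 𝓢(V, ℂ) => (S.sup (schwartzSeminormFamily ℂ V ℂ)) f := by
  classical
  induction S using Finset.induction_on with
  | empty => simpa using continuous_const
  | insert a s ha ih =>
    simp only [Finset.sup_insert, Seminorm.sup_apply]
    exact ((schwartz_withSeminorms ℂ V ℂ).continuous_seminorm a).sup ih

/-- The `L^r` norm of the image of a Schwartz function under a continuous operator is controlled by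
finitely many seminorms. -/
theorem exists_eLpNorm_clm_le_seminorm (T : 𝓢(V, ℂ) →L[ℂ] 𝓢(V, ℂ)) (r : ℝ≥0∞) :
    ∃ (S : Finset (ℕ × ℕ)) (C : ℝ≥0), ∀ w : 𝓢(V, ℂ),
      eLpNorm (T w) r volume ≤ C * ENNReal.ofReal (S.sup (schwartzSeminormFamily ℂ V ℂ) w) := by
  obtain ⟨k, C, hC⟩ := SchwartzMap.eLpNorm_le_seminorm ℂ ℂ (E := V) r volume
  have hqc : Continuous (((Finset.Iic (k, 0)).sup (schwartzSeminormFamily ℂ V ℂ)).comp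
      T.toLinearMap) := by
    exact (continuous_sup_seminorm (Finset.Iic (k, 0))).comp T.continuous
  obtain ⟨S, C', -, hS⟩ := Seminorm.bound_of_continuous (schwartz_withSeminorms ℂ V ℂ) _ hqc
  refine ⟨S, C * C', fun w => (hC (T w)).trans ?_⟩
  have h2 : ((Finset.Iic (k, 0)).sup (schwartzSeminormFamily ℂ V ℂ)) (T w) ≤
      C' * (S.sup (schwartzSeminormFamily ℂ V ℂ)) w := by
    simpa [NNReal.smul_def] using hS w
  rw [ENNReal.coe_mul, mul_assoc]
  gcongr
  refine (ENNReal.ofReal_le_ofReal h2).trans ?_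
  rw [ENNReal.ofReal_mul C'.coe_nonneg, ENNReal.ofReal_coe_nnreal]

theorem sup_seminorm_mono {S S' : Finset (ℕ × ℕ)} (h : S ⊆ S') (w : 𝓢(V, ℂ)) :
    (S.sup (schwartzSeminormFamily ℂ V ℂ)) w ≤ (S'.sup (schwartzSeminormFamily ℂ V ℂ)) w :=
  Finset.sup_mono (f := schwartzSeminormFamily ℂ V ℂ) h w

theorem contDiff_mul_inv_norm_pow {ζ : V → ℂ} (h1 : ContDiff ℝ ∞ ζ) (h0 : 0 ∉ tsupport ζ) (m : ℕ) :
    ContDiff ℝ ∞ fun ξ => ζ ξ * ((((‖ξ‖ ^ 2) ^ m)⁻¹ : ℝ) : ℂ) := by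
  refine contDiff_iff_contDiffAt.2 fun ξ => ?_
  by_cases hξ' : ξ ∈ tsupport ζ
  swap
  · refine (contDiffAt_const (c := (0 : ℂ))).congr_of_eventuallyEq ?_
    filter_upwards [notMem_tsupport_iff_eventuallyEq.1 hξ'] with x hx
    simp [hx]
  have hne : ξ ≠ 0 := fun h => h0 (h ▸ hξ')
  refine h1.contDiffAt.mul (Complex.ofRealCLM.contDiff.contDiffAt.comp ξ ?_)
  refine ContDiffAt.inv ((contDiff_norm_sq ℝ).pow m).contDiffAt ?_
  positivity

/-- Frequency-localized pieces of a Schwartz function at scale `R` decay like any power of `R`. -/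
theorem exists_eLpNorm_dilate_le {ζ : V → ℂ} (h1 : ContDiff ℝ ∞ ζ) (h2 : HasCompactSupport ζ)
    (h0 : 0 ∉ tsupport ζ) (m : ℕ) {r : ℝ} (hr : 1 ≤ r) :
    ∃ (S : Finset (ℕ × ℕ)) (C : ℝ≥0), ∀ (R : ℝ), 0 < R → ∀ w : 𝓢(V, ℂ),
      eLpNorm (𝓕⁻ (fun ξ => ζ (R • ξ) * w ξ)) (ENNReal.ofReal r) volume ≤
        C * ENNReal.ofReal ((R ^ 2) ^ m) *
          ENNReal.ofReal (S.sup (schwartzSeminormFamily ℂ V ℂ) w) := by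
  set T : 𝓢(V, ℂ) →L[ℂ] 𝓢(V, ℂ) := (FourierTransform.fourierInvCLM ℂ 𝓢(V, ℂ)).comp
    (SchwartzMap.smulLeftCLM ℂ fun ξ : V => (((‖ξ‖ ^ 2) ^ m : ℝ) : ℂ)) with hT
  obtain ⟨S, C, hS⟩ := exists_eLpNorm_clm_le_seminorm T (ENNReal.ofReal r)
  have hg : Function.HasTemperateGrowth fun ξ : V => (((‖ξ‖ ^ 2) ^ m : ℝ) : ℂ) := by fun_prop
  set η : V → ℂ := fun ξ => ζ ξ * ((((‖ξ‖ ^ 2) ^ m)⁻¹ : ℝ) : ℂ) with hη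
  have hηc : ContDiff ℝ ∞ η := contDiff_mul_inv_norm_pow h1 h0 m
  have hηs : HasCompactSupport η := h2.mono fun x hx h => hx (by simp [hη, h])
  have hK := kernelNorm_compactSupport_ne_top hηc hηs
  refine ⟨S, (kernelNorm η).toNNReal * C, fun R hR w => ?_⟩
  set W := SchwartzMap.smulLeftCLM ℂ (fun ξ : V => (((‖ξ‖ ^ 2) ^ m : ℝ) : ℂ)) w with hW
  have hWa : ∀ ξ, W ξ = (((‖ξ‖ ^ 2) ^ m : ℝ) : ℂ) * w ξ := fun ξ => by
    rw [hW, SchwartzMap.smulLeftCLM_apply_apply hg, smul_eq_mul]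
  have hζ0 : ζ 0 = 0 := image_eq_zero_of_notMem_tsupport h0
  -- Multiply and divide by `‖ξ‖^{2m}`: the quotient `η` is still smooth because `ζ` vanishes near
  -- zero, dilation releases `R^{2m}`, and the weight goes to the Schwartz function.
  have hfun : (fun ξ => ζ (R • ξ) * w ξ) =
      fun ξ => ((((R ^ 2) ^ m : ℝ) : ℂ) * η (R • ξ)) * W ξ := by
    ext ξ
    rw [hWa]
    rcases eq_or_ne ξ 0 with rfl | hξ
    · simp [hζ0, hη]
    · have hξ' : (‖ξ‖ : ℂ) ≠ 0 := by simpa using hξ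
      have hR' : (R : ℂ) ≠ 0 := by simpa using hR.ne'
      simp only [hη, norm_smul, Real.norm_of_nonneg hR.le]
      push_cast
      rw [mul_pow, mul_pow]
      field_simp
  have hηR : Continuous fun ξ : V => (((R ^ 2) ^ m : ℝ) : ℂ) * η (R • ξ) :=
    continuous_const.mul (hηc.continuous.comp (continuous_const_smul R))
  have hηRs : HasCompactSupport fun ξ : V => (((R ^ 2) ^ m : ℝ) : ℂ) * η (R • ξ) := by
    have : HasCompactSupport fun ξ : V => η (R • ξ) := hηs.comp_smul hR.ne'
    exact this.mono fun x hx h => hx (by simp [h])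
  have hmain := eLpNorm_fourierInv_mul_le (hηR.integrable_of_hasCompactSupport hηRs) W.continuous
    W.integrable (kernelNorm_schwartz_ne_top W) hr
  rw [hfun]
  refine hmain.trans ?_
  rw [kernelNorm_const_mul, kernelNorm_comp_smul hR]
  have h3 : eLpNorm (𝓕⁻ (W : V → ℂ)) (ENNReal.ofReal r) volume ≤
      C * ENNReal.ofReal (S.sup (schwartzSeminormFamily ℂ V ℂ) w) := by
    rw [← SchwartzMap.fourierInv_coe]
    exact hS w
  have h4 : ‖(((R ^ 2) ^ m : ℝ) : ℂ)‖ₑ = ENNReal.ofReal ((R ^ 2) ^ m) := by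
    rw [← ofReal_norm, Complex.norm_real, Real.norm_of_nonneg (by positivity)]
  rw [h4, ENNReal.coe_mul, ENNReal.coe_toNNReal hK]
  calc _ ≤ ENNReal.ofReal ((R ^ 2) ^ m) * kernelNorm η *
        (C * ENNReal.ofReal (S.sup (schwartzSeminormFamily ℂ V ℂ) w)) := by gcongr
    _ = _ := by ring

end SchwartzBound

/-! ### The Littlewood–Paley partition and the weights `κ(N^{-j})` -/

section LittlewoodPaleyPieces

variable {d N : ℕ}

namespace LittlewoodPaley

theorem hatSchwartz_apply (P : LittlewoodPaley d N) (j : ℕ) (ξ : Rd d) :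
    P.hatSchwartz j ξ = (P.hat j ξ : ℂ) := rfl

theorem scale_pos (P : LittlewoodPaley d N) (j : ℕ) : (0 : ℝ) < (N : ℝ) ^ (-(j : ℤ)) :=
  zpow_pos P.cast_pos _

theorem scale_le_one (P : LittlewoodPaley d N) (j : ℕ) : (N : ℝ) ^ (-(j : ℤ)) ≤ 1 :=
  zpow_le_one_of_nonpos₀ P.one_lt_cast.le (by omega)

theorem scale_eq_inv_pow (_P : LittlewoodPaley d N) (j : ℕ) :
    (N : ℝ) ^ (-(j : ℤ)) = ((N : ℝ) ^ j)⁻¹ := by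
  rw [zpow_neg, zpow_natCast]

theorem hat_zero_eq_one (P : LittlewoodPaley d N) {ξ : Rd d} (h : ‖ξ‖ < 1) : P.hat 0 ξ = 1 := by
  rw [P.hat_zero_eq_finsum 0 (by simpa using h)]
  simp

theorem hat_succ_eq (P : LittlewoodPaley d N) (j : ℕ) (ξ : Rd d) :
    P.hat (j + 1) ξ = P.phi ((N : ℝ) ^ (-((j + 1 : ℕ) : ℤ)) • ξ) := by
  simp [hat]

theorem hat_zero_add_phi (P : LittlewoodPaley d N) (ξ : Rd d) :
    P.hat 0 ξ + P.phi ((N : ℝ)⁻¹ • ξ) = P.hat 0 ((N : ℝ)⁻¹ • ξ) := by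
  have hN := P.cast_pos
  obtain ⟨M, hM⟩ := pow_unbounded_of_one_lt ‖ξ‖ P.one_lt_cast
  have h1 : ‖ξ‖ < (N : ℝ) ^ (M + 1) :=
    hM.trans (pow_lt_pow_right₀ P.one_lt_cast (Nat.lt_succ_self M))
  have h2 : ‖(N : ℝ)⁻¹ • ξ‖ < (N : ℝ) ^ M := by
    rw [norm_smul, Real.norm_of_nonneg (by positivity), inv_mul_lt_iff₀ hN, ← pow_succ']
    exact h1
  rw [P.hat_zero_eq_finsum (M + 1) h1, P.hat_zero_eq_finsum M h2, Finset.sum_range_succ']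
  have h3 : ∀ k : ℕ, (N : ℝ) ^ (-((k : ℤ) + 1)) • ((N : ℝ)⁻¹ • ξ) =
      (N : ℝ) ^ (-(((k + 1 : ℕ) : ℤ) + 1)) • ξ := fun k => by
    rw [smul_smul, ← zpow_neg_one, ← zpow_add₀ hN.ne']
    have : -((k : ℤ) + 1) + -1 = -(((k + 1 : ℕ) : ℤ) + 1) := by push_cast; ring
    rw [this]
  simp only [h3]
  norm_num
  ring

/-- The partial sums of the partition of unity are dilates of its first member. -/
theorem sum_hat (P : LittlewoodPaley d N) (n : ℕ) (ξ : Rd d) :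
    ∑ j ∈ Finset.range (n + 1), P.hat j ξ = P.hat 0 ((N : ℝ) ^ (-(n : ℤ)) • ξ) := by
  have hN := P.cast_pos
  induction n with
  | zero => simp
  | succ n ih =>
    rw [Finset.sum_range_succ, ih, hat_succ_eq]
    have h3 : (N : ℝ) ^ (-((n + 1 : ℕ) : ℤ)) • ξ = (N : ℝ)⁻¹ • ((N : ℝ) ^ (-(n : ℤ)) • ξ) := by
      rw [smul_smul, ← zpow_neg_one, ← zpow_add₀ hN.ne']
      congr 2
      push_cast
      ring
    rw [h3, P.hat_zero_add_phi]

theorem hat_eq_zero (P : LittlewoodPaley d N) {j : ℕ} {ξ : Rd d} (h : (N : ℝ) ^ (j + 1) < ‖ξ‖) :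
    P.hat j ξ = 0 := by
  have hN := P.cast_pos
  cases j with
  | zero => exact P.hat_zero_eq_zero (by simpa using h)
  | succ j =>
    rw [hat_succ_eq]
    apply P.phi_eq_zero
    right
    rw [P.norm_zpow_smul, P.scale_eq_inv_pow, lt_inv_mul_iff₀ (by positivity), ← pow_succ]
    exact h

theorem hat_eq_zero_of_norm_lt (P : LittlewoodPaley d N) {j n : ℕ} {ξ : Rd d} (hj : n + 1 ≤ j)
    (h : ‖ξ‖ < (N : ℝ) ^ n) : P.hat j ξ = 0 := by
  have hN := P.cast_pos
  obtain ⟨j, rfl⟩ : ∃ i, j = i + 1 := ⟨j - 1, by omega⟩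
  rw [hat_succ_eq]
  apply P.phi_eq_zero
  left
  rw [P.norm_zpow_smul, P.scale_eq_inv_pow, inv_mul_lt_iff₀ (by positivity)]
  refine h.trans_le ?_
  rw [pow_succ, mul_assoc, mul_inv_cancel₀ hN.ne', mul_one]
  exact pow_le_pow_right₀ P.one_lt_cast.le (by omega)

/-- Smooth compactly supported functions equal to one on the supports of the Littlewood–Paley
functions; all but the first are dilates of one function vanishing near the origin. -/
structure Companion (P : LittlewoodPaley d N) where
  cutoff : ℕ → 𝓢(Rd d, ℂ)
  profile : Rd d → ℂ
  hasCompactSupport_zero : HasCompactSupport (cutoff 0)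
  contDiff_profile : ContDiff ℝ ∞ profile
  hasCompactSupport_profile : HasCompactSupport profile
  zero_notMem : 0 ∉ tsupport profile
  cutoff_succ : ∀ j ξ, cutoff (j + 1) ξ = profile ((N : ℝ) ^ (-((j + 1 : ℕ) : ℤ)) • ξ)
  cutoff_mul_hat : ∀ j ξ, cutoff j ξ * (P.hat j ξ : ℂ) = (P.hat j ξ : ℂ)

theorem exists_companion (P : LittlewoodPaley d N) : Nonempty P.Companion := by
  have hN := P.cast_pos
  have hK : IsCompact (tsupport P.phi) := by
    refine (isCompact_closedBall (0 : Rd d) N).of_isClosed_subset (isClosed_tsupport _) ?_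
    rw [P.tsupport_eq]
    intro ξ hξ
    simpa using hξ.2
  obtain ⟨ζ, h1, h2, h3, h4⟩ := exists_cutoff hK (isOpen_compl_singleton (x := (0 : Rd d))) (by
    rw [P.tsupport_eq]
    rintro ξ hξ rfl
    have := hξ.1
    rw [norm_zero] at this
    linarith [inv_pos.2 hN])
  obtain ⟨ζ₀, h1', h2', -, h4'⟩ := exists_cutoff (isCompact_closedBall (0 : Rd d) N) isOpen_univ
    (subset_univ _)
  have hcs : ∀ j : ℕ, HasCompactSupport fun ξ : Rd d => ζ ((N : ℝ) ^ (-(j : ℤ)) • ξ) := fun j =>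
    h2.comp_smul (P.scale_pos j).ne'
  have hcd : ∀ j : ℕ, ContDiff ℝ ∞ fun ξ : Rd d => ζ ((N : ℝ) ^ (-(j : ℤ)) • ξ) := fun j =>
    h1.comp (contDiff_const_smul _)
  refine ⟨⟨fun j => if j = 0 then h2'.toSchwartzMap h1' else (hcs j).toSchwartzMap (hcd j), ζ,
    by rw [if_pos rfl]; exact h2', h1, h2, fun h => h3 h rfl, fun j ξ => ?_, fun j ξ => ?_⟩⟩
  · rw [if_neg (Nat.succ_ne_zero j)]
    rfl
  · rcases eq_or_ne (P.hat j ξ) 0 with h0 | h0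
    · simp [h0]
    cases j with
    | zero =>
      rw [if_pos rfl]
      have : ζ₀ ξ = 1 := by
        refine h4' ξ ?_
        by_contra hcon
        exact h0 (P.hat_zero_eq_zero (by simpa using hcon))
      change ζ₀ ξ * _ = _
      rw [this, one_mul]
    | succ j =>
      rw [if_neg (Nat.succ_ne_zero j)]
      change ζ ((N : ℝ) ^ (-((j + 1 : ℕ) : ℤ)) • ξ) * _ = _
      rw [h4, one_mul]
      rw [hat_succ_eq] at h0
      exact subset_tsupport _ h0

theorem exists_kernelNorm_hat_le (P : LittlewoodPaley d N) :
    ∃ C : ℝ≥0, ∀ j, kernelNorm (P.hatSchwartz j) ≤ C := by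
  set f : Rd d → ℂ := fun ξ => (P.phi ξ : ℂ) with hf
  have h1 : ContDiff ℝ ∞ f := Complex.ofRealCLM.contDiff.comp P.smooth
  have h2 : HasCompactSupport f := by
    have : HasCompactSupport P.phi := by
      refine (isCompact_closedBall (0 : Rd d) N).of_isClosed_subset (isClosed_tsupport _) ?_
      rw [P.tsupport_eq]
      intro ξ hξ
      simpa using hξ.2
    exact this.mono fun x hx h => hx (by simp [hf, h])
  refine ⟨(kernelNorm (P.hatSchwartz 0)).toNNReal + (kernelNorm f).toNNReal, fun j => ?_⟩
  rw [ENNReal.coe_add, ENNReal.coe_toNNReal (kernelNorm_schwartz_ne_top _),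
    ENNReal.coe_toNNReal (kernelNorm_compactSupport_ne_top h1 h2)]
  cases j with
  | zero => exact le_self_add
  | succ j =>
    have : (P.hatSchwartz (j + 1) : Rd d → ℂ) = fun ξ => f ((N : ℝ) ^ (-((j + 1 : ℕ) : ℤ)) • ξ) := by
      ext ξ
      rw [hatSchwartz_apply, hat_succ_eq]
    rw [this, kernelNorm_comp_smul (P.scale_pos (j + 1))]
    exact le_add_self

end LittlewoodPaley

open LittlewoodPaley

variable {κ l : ℝ → ℝ} {σ : ℝ} {μ : Measure (Rd d)}

/-- The weights grow at most geometrically in `j`, for either sign of `t`. For `t ≥ 0`, `κ` is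
bounded on `(0, 1]`. For `t < 0`, iterating the scaling inequality with `ε = N` bounds `κ(N^{-j})`
from below by `κ(1) l(N)^{-j}`. -/
theorem exists_rpow_scale_le (P : LittlewoodPaley d N) (hκ : IsScaling κ l) (t : ℝ) :
    ∃ (A : ℝ) (C : ℝ), 0 < A ∧ 0 < C ∧ ∀ j : ℕ, κ ((N : ℝ) ^ (-(j : ℤ))) ^ t ≤ C * A ^ j := by
  have hN := P.cast_pos
  have hκ1 := hκ.pos 1 one_pos
  rcases le_or_gt 0 t with ht | ht
  · refine ⟨1, (l 1 * κ 1) ^ t, one_pos, Real.rpow_pos_of_pos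
      (mul_pos (hκ.factor_pos one_pos) hκ1) _, fun j => ?_⟩
    rw [one_pow, mul_one]
    exact Real.rpow_le_rpow (hκ.pos _ (P.scale_pos j)).le
      (hκ.le_on_unit (P.scale_pos j) (P.scale_le_one j)) ht
  · have hl := hκ.factor_pos hN
    have hlow : ∀ j : ℕ, κ 1 / l N ^ j ≤ κ ((N : ℝ) ^ (-(j : ℤ))) := by
      intro j
      induction j with
      | zero => simp
      | succ j ih =>
        have h1 := hκ.scaling N ((N : ℝ) ^ (-((j + 1 : ℕ) : ℤ))) hN (P.scale_pos _)
        have h2 : (N : ℝ) * (N : ℝ) ^ (-((j + 1 : ℕ) : ℤ)) = (N : ℝ) ^ (-(j : ℤ)) := by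
          rw [← zpow_one_add₀ hN.ne']
          congr 1
          push_cast
          ring
        rw [h2] at h1
        rw [pow_succ, ← div_div, div_le_iff₀ hl, mul_comm]
        exact ih.trans h1
    refine ⟨l N ^ (-t), κ 1 ^ t, Real.rpow_pos_of_pos hl _, Real.rpow_pos_of_pos hκ1 _,
      fun j => ?_⟩
    refine (Real.rpow_le_rpow_of_nonpos (by positivity) (hlow j) ht.le).trans_eq ?_
    rw [Real.div_rpow hκ1.le (by positivity), ← Real.rpow_natCast, ← Real.rpow_natCast,
      ← Real.rpow_mul hl.le, ← Real.rpow_mul hl.le, div_eq_mul_inv, ← Real.rpow_neg hl.le]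
    congr 2
    ring

/-- The central estimate at the scales `R = N^{-j}`. The piece `j = 0` contains the origin and is
only known to be finite; it is absorbed into the constant after dividing by its weight `κ(1)^{-s}`.
-/
theorem exists_kernelNorm_rpow_cutoff_le {P : LittlewoodPaley d N} (Z : P.Companion)
    (hκ : IsScaling κ l) (hμ : LevyClass σ μ) (hD : AssumptionD σ κ μ) (hB : AssumptionB σ κ μ)
    (s : ℝ) : ∃ C : ℝ≥0, ∀ j : ℕ, kernelNorm (fun ξ => (((1 + levyExp μ ξ) ^ s : ℝ) : ℂ) * Z.cutoff j ξ)
      ≤ C * ENNReal.ofReal (κ ((N : ℝ) ^ (-(j : ℤ))) ^ (-s)) := by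
  obtain ⟨C, hC⟩ := exists_kernelNorm_rpow_dilate_le hκ hμ hD hB s Z.contDiff_profile
    Z.hasCompactSupport_profile Z.zero_notMem
  have hK := kernelNorm_rpow_mul_ne_top hμ s ((Z.cutoff 0).smooth ⊤) Z.hasCompactSupport_zero
  have hpos : 0 < ENNReal.ofReal (κ 1 ^ (-s)) :=
    ENNReal.ofReal_pos.2 (Real.rpow_pos_of_pos (hκ.pos 1 one_pos) _)
  set K := kernelNorm (fun ξ => (((1 + levyExp μ ξ) ^ s : ℝ) : ℂ) * Z.cutoff 0 ξ) with hKdef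
  refine ⟨C + (K / ENNReal.ofReal (κ 1 ^ (-s))).toNNReal, fun j => ?_⟩
  have hdiv : K / ENNReal.ofReal (κ 1 ^ (-s)) ≠ ⊤ := (ENNReal.div_lt_top hK hpos.ne').ne
  rw [ENNReal.coe_add, ENNReal.coe_toNNReal hdiv, add_mul]
  cases j with
  | zero =>
    refine le_trans ?_ le_add_self
    simp only [Nat.cast_zero, neg_zero, zpow_zero]
    rw [ENNReal.div_mul_cancel hpos.ne' ENNReal.ofReal_ne_top]
  | succ j =>
    refine le_trans ?_ le_self_add
    simp only [Z.cutoff_succ]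
    exact hC _ (P.scale_pos _) (P.scale_le_one _)

/-- Weighted Littlewood–Paley pieces of a Schwartz function decay geometrically. -/
theorem exists_eLpNorm_cutoff_le {P : LittlewoodPaley d N} (Z : P.Companion)
    (hκ : IsScaling κ l) (t : ℝ) {r : ℝ} (hr : 1 ≤ r) :
    ∃ (S : Finset (ℕ × ℕ)) (C : ℝ≥0), ∀ (j : ℕ) (w : 𝓢(Rd d, ℂ)),
      ENNReal.ofReal (κ ((N : ℝ) ^ (-(j : ℤ))) ^ t) *
        eLpNorm (𝓕⁻ (fun ξ => Z.cutoff j ξ * w ξ)) (ENNReal.ofReal r) volume ≤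
        C * 2⁻¹ ^ j * ENNReal.ofReal (S.sup (schwartzSeminormFamily ℂ (Rd d) ℂ) w) := by
  have hN := P.cast_pos
  obtain ⟨A, C, hA, hC, hAC⟩ := exists_rpow_scale_le P hκ t
  -- The order of decay is chosen with `N^{2m} > 2A`, so that it beats the growth `A^j` of the
  -- weights and leaves `2^{-j}`.
  obtain ⟨m, hm⟩ := pow_unbounded_of_one_lt (2 * A)
    (one_lt_pow₀ P.one_lt_cast two_ne_zero)
  obtain ⟨S₁, C₁, h₁⟩ := exists_eLpNorm_dilate_le Z.contDiff_profile Z.hasCompactSupport_profile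
    Z.zero_notMem m hr
  obtain ⟨S₀, C₀, h₀⟩ := exists_eLpNorm_clm_le_seminorm
    (FourierTransform.fourierInvCLM ℂ 𝓢(Rd d, ℂ)) (ENNReal.ofReal r)
  have hK := kernelNorm_schwartz_ne_top (Z.cutoff 0)
  refine ⟨S₀ ∪ S₁, C.toNNReal * ((kernelNorm (Z.cutoff 0)).toNNReal * C₀ + C₁), fun j w => ?_⟩
  have hC' : ((C.toNNReal : ℝ≥0) : ℝ≥0∞) = ENNReal.ofReal C := rfl
  rw [ENNReal.coe_mul, ENNReal.coe_add, ENNReal.coe_mul, ENNReal.coe_toNNReal hK, hC']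
  set Q := ENNReal.ofReal ((S₀ ∪ S₁).sup (schwartzSeminormFamily ℂ (Rd d) ℂ) w) with hQ
  have hQ₀ : ENNReal.ofReal (S₀.sup (schwartzSeminormFamily ℂ (Rd d) ℂ) w) ≤ Q :=
    ENNReal.ofReal_le_ofReal (sup_seminorm_mono Finset.subset_union_left w)
  have hQ₁ : ENNReal.ofReal (S₁.sup (schwartzSeminormFamily ℂ (Rd d) ℂ) w) ≤ Q :=
    ENNReal.ofReal_le_ofReal (sup_seminorm_mono Finset.subset_union_right w)
  cases j with
  | zero =>
    have h2 := eLpNorm_fourierInv_mul_le (Z.cutoff 0).integrable w.continuous w.integrable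
      (kernelNorm_schwartz_ne_top w) hr
    have h3 : eLpNorm (𝓕⁻ (w : Rd d → ℂ)) (ENNReal.ofReal r) volume ≤ C₀ * Q := by
      rw [← SchwartzMap.fourierInv_coe]
      exact (h₀ w).trans (by gcongr)
    have h4 : ENNReal.ofReal (κ ((N : ℝ) ^ (-((0 : ℕ) : ℤ))) ^ t) ≤ ENNReal.ofReal C :=
      ENNReal.ofReal_le_ofReal (by simpa using hAC 0)
    calc _ ≤ ENNReal.ofReal C * (kernelNorm (Z.cutoff 0) * (C₀ * Q)) := by
          gcongr
          exact h2.trans (by gcongr)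
      _ = ENNReal.ofReal C * (kernelNorm (Z.cutoff 0) * C₀) * 2⁻¹ ^ 0 * Q := by ring
      _ ≤ _ := by gcongr; exact le_self_add
  | succ j =>
    set R : ℝ := (N : ℝ) ^ (-((j + 1 : ℕ) : ℤ)) with hR
    have h2 := h₁ R (P.scale_pos _) w
    have h5 : C * A ^ (j + 1) * (R ^ 2) ^ m ≤ C * (1 / 2) ^ (j + 1) := by
      have hRm : (R ^ 2) ^ m = ((((N : ℝ) ^ 2) ^ m) ^ (j + 1))⁻¹ := by
        rw [hR, P.scale_eq_inv_pow, inv_pow, inv_pow]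
        congr 1
        ring
      rw [hRm, mul_assoc, ← inv_pow, ← mul_pow]
      gcongr
      rw [← div_eq_mul_inv, div_le_div_iff₀ (by positivity) two_pos]
      linarith
    have h6 : ENNReal.ofReal (κ R ^ t) * ENNReal.ofReal ((R ^ 2) ^ m) ≤
        ENNReal.ofReal C * 2⁻¹ ^ (j + 1) := by
      rw [← ENNReal.ofReal_mul (Real.rpow_nonneg (hκ.pos _ (P.scale_pos _)).le _)]
      have h7 : ENNReal.ofReal C * 2⁻¹ ^ (j + 1) = ENNReal.ofReal (C * (1 / 2) ^ (j + 1)) := by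
        rw [ENNReal.ofReal_mul hC.le, ENNReal.ofReal_pow (by norm_num), one_div,
          ENNReal.ofReal_inv_of_pos two_pos]
        norm_num
      rw [h7]
      refine ENNReal.ofReal_le_ofReal (le_trans ?_ h5)
      gcongr
      exact hAC (j + 1)
    simp only [Z.cutoff_succ]
    calc _ ≤ ENNReal.ofReal (κ R ^ t) * (C₁ * ENNReal.ofReal ((R ^ 2) ^ m) * Q) := by
          gcongr
          exact h2.trans (by gcongr)
      _ = (ENNReal.ofReal (κ R ^ t) * ENNReal.ofReal ((R ^ 2) ^ m)) * (C₁ * Q) := by ring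
      _ ≤ (ENNReal.ofReal C * 2⁻¹ ^ (j + 1)) * (C₁ * Q) := by gcongr
      _ = ENNReal.ofReal C * C₁ * 2⁻¹ ^ (j + 1) * Q := by ring
      _ ≤ _ := by gcongr; exact le_add_self

end LittlewoodPaleyPieces

/-! ### Comparison of the two norms on Schwartz functions, and properties of the generalized norm -/

section Norms

variable {d N : ℕ} {κ l : ℝ → ℝ} {σ : ℝ} {μ : Measure (Rd d)}

theorem convolution_kernel (P : LittlewoodPaley d N) (j : ℕ) (v : 𝓢'(Rd d, ℂ)) :
    convolution (P.kernel j) v = multiplierConv (P.hatSchwartz j) v := by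
  ext x
  rw [convolution, multiplierConv]
  congr 1
  ext y
  rw [reflectTranslate_apply, LittlewoodPaley.kernel, SchwartzMap.compSubConstCLM_apply,
    SchwartzMap.fourier_coe, fourier_eq_fourierInv_neg, neg_sub, SchwartzMap.fourierInv_coe]

/-- The `j`-th weighted Littlewood–Paley piece of `genBesovNorm`. -/
noncomputable def genPiece (κ : ℝ → ℝ) (P : LittlewoodPaley d N) (s p : ℝ) (v : 𝓢'(Rd d, ℂ))
    (j : ℕ) : ℝ≥0∞ :=
  ENNReal.ofReal (κ ((N : ℝ) ^ (-(j : ℤ))) ^ (-s)) *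
    eLpNorm (multiplierConv (P.hatSchwartz j) v) (ENNReal.ofReal p) volume

theorem genBesovNorm_eq (P : LittlewoodPaley d N) (hκ : IsScaling κ l) (s p : ℝ) {q : ℝ}
    (hq : 1 < q) (v : 𝓢'(Rd d, ℂ)) :
    genBesovNorm κ P s p q v = lqNorm q (genPiece κ P s p v) := by
  have h0 : 0 < q := by linarith
  rw [genBesovNorm, lqNorm]
  congr 2
  ext j
  have hpos := hκ.pos _ (P.scale_pos j)
  rw [genPiece, ENNReal.mul_rpow_of_nonneg _ _ h0.le, convolution_kernel,
    ENNReal.ofReal_rpow_of_nonneg (Real.rpow_nonneg hpos.le _) h0.le, ← Real.rpow_mul hpos.le,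
    neg_mul]

theorem ofReal_rpow_mul_ofReal_rpow_neg (P : LittlewoodPaley d N) (hκ : IsScaling κ l) (t : ℝ)
    (j : ℕ) : ENNReal.ofReal (κ ((N : ℝ) ^ (-(j : ℤ))) ^ t) *
      ENNReal.ofReal (κ ((N : ℝ) ^ (-(j : ℤ))) ^ (-t)) = 1 := by
  have hpos := hκ.pos _ (P.scale_pos j)
  rw [← ENNReal.ofReal_mul (Real.rpow_nonneg hpos.le _), ← Real.rpow_add hpos, add_neg_cancel,
    Real.rpow_zero, ENNReal.ofReal_one]

theorem besovSchwartzNorm_eq (P : LittlewoodPaley d N) (s p q : ℝ) (u : 𝓢(Rd d, ℝ)) :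
    besovSchwartzNorm σ μ P s p q u =
      lqNorm q fun j => eLpNorm (besselConvolution σ μ P s j u) (ENNReal.ofReal p) volume := rfl

theorem multiplierConv_toDistribution (a : 𝓢(Rd d, ℂ)) (u : 𝓢(Rd d, ℝ)) :
    multiplierConv a (toDistribution u) = 𝓕⁻ (fun ξ => a ξ * 𝓕 (toComplex u) ξ) :=
  funext fun x => multiplierConv_toTemperedDistribution a (toComplex u) x

theorem besselConvolution_eq (hμ : LevyClass σ μ) (P : LittlewoodPaley d N) (s : ℝ) (j : ℕ)
    (u : 𝓢(Rd d, ℝ)) : besselConvolution σ μ P s j u =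
      𝓕⁻ (fun ξ => (((1 + levyExp μ ξ) ^ s : ℝ) : ℂ) *
        schwartzMul (P.hatSchwartz j) (𝓕 (toComplex u)) ξ) := by
  rw [besselConvolution]
  congr 1
  ext ξ
  rw [one_sub_levySymbol_cpow hμ, mul_assoc]
  rfl

theorem hasCompactSupport_hatSchwartz (P : LittlewoodPaley d N) (j : ℕ) :
    HasCompactSupport (P.hatSchwartz j) :=
  (P.hasCompactSupport_hat j).comp_left Complex.ofReal_zero

theorem hasCompactSupport_schwartzMul {a b : 𝓢(Rd d, ℂ)} (ha : HasCompactSupport a) :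
    HasCompactSupport (schwartzMul a b) :=
  ha.mono fun x hx h => hx (by simp [h])

theorem continuous_rpow_levyExp (hμ : LevyClass σ μ) (s : ℝ) :
    Continuous fun ξ : Rd d => (((1 + levyExp μ ξ) ^ s : ℝ) : ℂ) := by
  refine Complex.continuous_ofReal.comp (Continuous.rpow_const
    (continuous_const.add (continuous_levyExp hμ.levy.ne)) fun ξ => Or.inl ?_)
  have := levyExp_nonneg μ ξ
  linarith

theorem integrable_rpow_levyExp_mul (hμ : LevyClass σ μ) (s : ℝ) {b : 𝓢(Rd d, ℂ)}
    (hb : HasCompactSupport b) :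
    Integrable fun ξ : Rd d => (((1 + levyExp μ ξ) ^ s : ℝ) : ℂ) * b ξ :=
  ((continuous_rpow_levyExp hμ s).mul b.continuous).integrable_of_hasCompactSupport
    (hb.mono fun x hx h => hx (by simp [h]))

theorem LittlewoodPaley.Companion.hasCompactSupport {P : LittlewoodPaley d N} (Z : P.Companion)
    (j : ℕ) : HasCompactSupport (Z.cutoff j) := by
  cases j with
  | zero => exact Z.hasCompactSupport_zero
  | succ j =>
    have : (Z.cutoff (j + 1) : Rd d → ℂ) = fun ξ =>
        Z.profile ((N : ℝ) ^ (-((j + 1 : ℕ) : ℤ)) • ξ) := funext fun ξ => Z.cutoff_succ j ξ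
    rw [this]
    exact Z.hasCompactSupport_profile.comp_smul (P.scale_pos _).ne'

/-- The Bessel potential pieces are controlled by the Littlewood–Paley pieces. -/
theorem exists_bessel_le_genPiece (P : LittlewoodPaley d N) (hκ : IsScaling κ l)
    (hμ : LevyClass σ μ) (hD : AssumptionD σ κ μ) (hB : AssumptionB σ κ μ) (s : ℝ) {p : ℝ}
    (hp : 1 < p) : ∃ C : ℝ≥0, ∀ (u : 𝓢(Rd d, ℝ)) (j : ℕ),
      eLpNorm (besselConvolution σ μ P s j u) (ENNReal.ofReal p) volume ≤
        C * genPiece κ P s p (toDistribution u) j := by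
  obtain ⟨Z⟩ := P.exists_companion
  obtain ⟨C, hC⟩ := exists_kernelNorm_rpow_cutoff_le Z hκ hμ hD hB s
  refine ⟨C, fun u j => ?_⟩
  set b := schwartzMul (P.hatSchwartz j) (𝓕 (toComplex u)) with hb
  -- The companion cutoff is one where `φ̂_j` lives. It may be inserted freely and makes the power
  -- of the symbol an admissible multiplier.
  have h1 := eLpNorm_fourierInv_mul_le (integrable_rpow_levyExp_mul hμ s (Z.hasCompactSupport j))
    b.continuous b.integrable (kernelNorm_schwartz_ne_top b) hp.le
  have h2 : (fun ξ => (((1 + levyExp μ ξ) ^ s : ℝ) : ℂ) * Z.cutoff j ξ * b ξ) =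
      fun ξ => (((1 + levyExp μ ξ) ^ s : ℝ) : ℂ) * b ξ := by
    ext ξ
    rw [mul_assoc, hb, schwartzMul_apply, ← mul_assoc (Z.cutoff j ξ),
      LittlewoodPaley.hatSchwartz_apply, Z.cutoff_mul_hat]
  have h5 := besselConvolution_eq hμ P s j u
  rw [← hb] at h5
  rw [h2, ← h5] at h1
  refine h1.trans ?_
  rw [genPiece, multiplierConv_toDistribution, ← mul_assoc]
  gcongr
  · exact hC j
  · rfl

/-- The Littlewood–Paley pieces are controlled by the Bessel potential pieces. -/
theorem exists_genPiece_le_bessel (P : LittlewoodPaley d N) (hκ : IsScaling κ l)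
    (hμ : LevyClass σ μ) (hD : AssumptionD σ κ μ) (hB : AssumptionB σ κ μ) (s : ℝ) {p : ℝ}
    (hp : 1 < p) : ∃ C : ℝ≥0, ∀ (u : 𝓢(Rd d, ℝ)) (j : ℕ),
      genPiece κ P s p (toDistribution u) j ≤
        C * eLpNorm (besselConvolution σ μ P s j u) (ENNReal.ofReal p) volume := by
  obtain ⟨Z⟩ := P.exists_companion
  obtain ⟨C, hC⟩ := exists_kernelNorm_rpow_cutoff_le Z hκ hμ hD hB (-s)
  refine ⟨C, fun u j => ?_⟩
  set b := schwartzMul (P.hatSchwartz j) (𝓕 (toComplex u)) with hb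
  have hbc : HasCompactSupport b :=
    hasCompactSupport_schwartzMul (hasCompactSupport_hatSchwartz P j)
  -- The localized power `-s` undoes the power `s`. Its kernel has size `κ(N^{-j})^{s}`, exactly
  -- inverse to the weight of the piece.
  have h1 := eLpNorm_fourierInv_mul_le (h := fun ξ => (((1 + levyExp μ ξ) ^ s : ℝ) : ℂ) * b ξ)
    (integrable_rpow_levyExp_mul hμ (-s) (Z.hasCompactSupport j))
    ((continuous_rpow_levyExp hμ s).mul b.continuous) (integrable_rpow_levyExp_mul hμ s hbc)
    (kernelNorm_rpow_mul_ne_top hμ s (b.smooth ⊤) hbc) hp.le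
  have h2 : (fun ξ => (((1 + levyExp μ ξ) ^ (-s) : ℝ) : ℂ) * Z.cutoff j ξ *
      ((((1 + levyExp μ ξ) ^ s : ℝ) : ℂ) * b ξ)) = fun ξ => P.hatSchwartz j ξ *
        𝓕 (toComplex u) ξ := by
    ext ξ
    have h3 : (((1 + levyExp μ ξ) ^ (-s) : ℝ) : ℂ) * (((1 + levyExp μ ξ) ^ s : ℝ) : ℂ) = 1 := by
      have := levyExp_nonneg μ ξ
      rw [← Complex.ofReal_mul, ← Real.rpow_add (by linarith), neg_add_cancel, Real.rpow_zero,
        Complex.ofReal_one]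
    have h4 : Z.cutoff j ξ * b ξ = P.hatSchwartz j ξ * 𝓕 (toComplex u) ξ := by
      rw [hb, schwartzMul_apply, ← mul_assoc (Z.cutoff j ξ), LittlewoodPaley.hatSchwartz_apply,
        Z.cutoff_mul_hat]
    rw [mul_mul_mul_comm, h3, h4, one_mul]
  have h5 := besselConvolution_eq hμ P s j u
  rw [← hb] at h5
  rw [h2, ← multiplierConv_toDistribution, ← h5] at h1
  rw [genPiece]
  calc _ ≤ ENNReal.ofReal (κ ((N : ℝ) ^ (-(j : ℤ))) ^ (-s)) *
        ((C * ENNReal.ofReal (κ ((N : ℝ) ^ (-(j : ℤ))) ^ (-(-s)))) *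
          eLpNorm (besselConvolution σ μ P s j u) (ENNReal.ofReal p) volume) := by
        gcongr
        exact h1.trans (by gcongr; exact hC j)
    _ = C * (ENNReal.ofReal (κ ((N : ℝ) ^ (-(j : ℤ))) ^ (-s)) *
          ENNReal.ofReal (κ ((N : ℝ) ^ (-(j : ℤ))) ^ (-(-s)))) *
          eLpNorm (besselConvolution σ μ P s j u) (ENNReal.ofReal p) volume := by ring
    _ = _ := by rw [ofReal_rpow_mul_ofReal_rpow_neg P hκ, mul_one]

theorem exists_besovSchwartzNorm_le (P : LittlewoodPaley d N) (hκ : IsScaling κ l)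
    (hμ : LevyClass σ μ) (hD : AssumptionD σ κ μ) (hB : AssumptionB σ κ μ) (s : ℝ) {p q : ℝ}
    (hp : 1 < p) (hq : 1 < q) : ∃ C : ℝ≥0, ∀ u : 𝓢(Rd d, ℝ),
      besovSchwartzNorm σ μ P s p q u ≤ C * genBesovNorm κ P s p q (toDistribution u) := by
  obtain ⟨C, hC⟩ := exists_bessel_le_genPiece P hκ hμ hD hB s hp
  refine ⟨C, fun u => ?_⟩
  rw [genBesovNorm_eq P hκ s p hq, besovSchwartzNorm_eq, ← lqNorm_const_mul hq]
  exact lqNorm_mono hq (hC u)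

theorem exists_genBesovNorm_le (P : LittlewoodPaley d N) (hκ : IsScaling κ l)
    (hμ : LevyClass σ μ) (hD : AssumptionD σ κ μ) (hB : AssumptionB σ κ μ) (s : ℝ) {p q : ℝ}
    (hp : 1 < p) (hq : 1 < q) : ∃ C : ℝ≥0, ∀ u : 𝓢(Rd d, ℝ),
      genBesovNorm κ P s p q (toDistribution u) ≤ C * besovSchwartzNorm σ μ P s p q u := by
  obtain ⟨C, hC⟩ := exists_genPiece_le_bessel P hκ hμ hD hB s hp
  refine ⟨C, fun u => ?_⟩
  rw [genBesovNorm_eq P hκ s p hq, besovSchwartzNorm_eq, ← lqNorm_const_mul hq]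
  exact lqNorm_mono hq (hC u)

/-- Schwartz functions have finite generalized Besov norm. -/
theorem genBesovNorm_toDistribution_lt_top (P : LittlewoodPaley d N) (hκ : IsScaling κ l) (s : ℝ)
    {p q : ℝ} (hp : 1 < p) (hq : 1 < q) (u : 𝓢(Rd d, ℝ)) :
    genBesovNorm κ P s p q (toDistribution u) < ⊤ := by
  obtain ⟨Z⟩ := P.exists_companion
  obtain ⟨S, C, h⟩ := exists_eLpNorm_cutoff_le Z hκ (-s) hp.le
  obtain ⟨D, hD⟩ := P.exists_kernelNorm_hat_le
  rw [genBesovNorm_eq P hκ s p hq]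
  set w : 𝓢(Rd d, ℂ) := 𝓕 (toComplex u) with hw
  refine lqNorm_lt_top_of_le_geometric hq (C := D * C *
    ENNReal.ofReal (S.sup (schwartzSeminormFamily ℂ (Rd d) ℂ) w))
    (ENNReal.mul_ne_top (ENNReal.mul_ne_top (by simp) (by simp)) (by simp)) fun j => ?_
  set b := schwartzMul (Z.cutoff j) w with hb
  have h1 := eLpNorm_fourierInv_mul_le (P.hatSchwartz j).integrable b.continuous b.integrable
    (kernelNorm_schwartz_ne_top b) hp.le
  have h2 : (fun ξ => P.hatSchwartz j ξ * b ξ) = fun ξ => P.hatSchwartz j ξ * w ξ := by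
    ext ξ
    rw [hb, schwartzMul_apply, ← mul_assoc, mul_comm (P.hatSchwartz j ξ),
      LittlewoodPaley.hatSchwartz_apply, Z.cutoff_mul_hat]
  rw [h2] at h1
  rw [genPiece, multiplierConv_toDistribution]
  calc _ ≤ ENNReal.ofReal (κ ((N : ℝ) ^ (-(j : ℤ))) ^ (-s)) *
        (D * eLpNorm (𝓕⁻ (b : Rd d → ℂ)) (ENNReal.ofReal p) volume) := by
        gcongr
        exact h1.trans (by gcongr; exact hD j)
    _ = D * (ENNReal.ofReal (κ ((N : ℝ) ^ (-(j : ℤ))) ^ (-s)) *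
          eLpNorm (𝓕⁻ (b : Rd d → ℂ)) (ENNReal.ofReal p) volume) := by ring
    _ ≤ D * (C * 2⁻¹ ^ j * ENNReal.ofReal (S.sup (schwartzSeminormFamily ℂ (Rd d) ℂ) w)) := by
        exact mul_le_mul_right (h j w) _
    _ = _ := by ring

/-- The partial sums of the partition telescope to dilates of its first member, which equals one
near the origin. -/
theorem tendsto_sum_schwartzMul_hat (P : LittlewoodPaley d N) (w : 𝓢(Rd d, ℂ)) :
    Tendsto (fun n => ∑ j ∈ Finset.range (n + 1), schwartzMul (P.hatSchwartz j) w) atTop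
      (𝓝 w) := by
  have hε : Tendsto (fun n : ℕ => (N : ℝ) ^ (-(n : ℤ))) atTop (𝓝 0) := by
    simp only [P.scale_eq_inv_pow, ← inv_pow]
    exact tendsto_pow_atTop_nhds_zero_of_lt_one (by positivity) (inv_lt_one_of_one_lt₀ P.one_lt_cast)
  have h := tendsto_cutoff_mul ((P.hatSchwartz 0).smooth ⊤) (hasCompactSupport_hatSchwartz P 0)
    one_pos (fun ξ hξ => by
      rw [LittlewoodPaley.hatSchwartz_apply, P.hat_zero_eq_one hξ, Complex.ofReal_one]) hε
    (fun n => ∑ j ∈ Finset.range (n + 1), P.hatSchwartz j) (fun n ξ => by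
      rw [sum_apply]
      simp only [LittlewoodPaley.hatSchwartz_apply]
      rw [← P.sum_hat, Complex.ofReal_sum]) w
  refine h.congr fun n => ?_
  ext ξ
  simp [Finset.sum_mul]

theorem eLpNorm_fourier_eq (b : 𝓢(Rd d, ℂ)) (r : ℝ≥0∞) :
    eLpNorm (𝓕 b : 𝓢(Rd d, ℂ)) r volume = eLpNorm (𝓕⁻ (b : Rd d → ℂ)) r volume := by
  rw [← eLpNorm_comp_measurePreserving (f := fun x : Rd d => -x) (g := 𝓕⁻ (b : Rd d → ℂ))
    (continuous_fourierInv b.integrable).aestronglyMeasurable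
    (Measure.measurePreserving_neg volume)]
  congr 1
  ext x
  rw [SchwartzMap.fourier_coe, fourier_eq_fourierInv_neg]
  rfl

/-- A distribution of finite generalized Besov norm is bounded on test functions by that norm. -/
theorem exists_enorm_apply_le (P : LittlewoodPaley d N) (hκ : IsScaling κ l) (s : ℝ)
    {p q : ℝ} (hp : 1 < p) (hq : 1 < q) :
    ∃ (S : Finset (ℕ × ℕ)) (C : ℝ≥0), ∀ (v : 𝓢'(Rd d, ℂ)) (g : 𝓢(Rd d, ℂ)),
      ‖v g‖ₑ ≤ C * ENNReal.ofReal (S.sup (schwartzSeminormFamily ℂ (Rd d) ℂ) (𝓕⁻ g)) *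
        genBesovNorm κ P s p q v := by
  obtain ⟨Z⟩ := P.exists_companion
  have hpq : p.HolderConjugate (p / (p - 1)) := Real.HolderConjugate.conjExponent hp
  -- The dual weight `κ^{s}` and the conjugate exponent `p/(p - 1)`: each piece of `v` is paired by
  -- Hölder's inequality with a piece of the test function that decays geometrically.
  obtain ⟨S, C, h⟩ := exists_eLpNorm_cutoff_le Z hκ s hpq.symm.lt.le
  -- The factor `2` is the sum of `2^{-j}`. Bounding every piece of `v` by the whole `ℓ^q` norm
  -- suffices, since summability comes from the test function.
  refine ⟨S, C * 2, fun v g => ?_⟩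
  rw [genBesovNorm_eq P hκ s p hq]
  set w : 𝓢(Rd d, ℂ) := 𝓕⁻ g with hw
  set Q := ENNReal.ofReal (S.sup (schwartzSeminormFamily ℂ (Rd d) ℂ) w) with hQ
  have hpiece : ∀ j, ‖v (𝓕 (schwartzMul (P.hatSchwartz j) w))‖ₑ ≤
      C * 2⁻¹ ^ j * Q * lqNorm q (genPiece κ P s p v) := by
    intro j
    set b := schwartzMul (Z.cutoff j) w with hb
    have h1 : schwartzMul (P.hatSchwartz j) w = schwartzMul b (P.hatSchwartz j) := by
      ext ξ
      rw [hb, schwartzMul_apply, schwartzMul_apply, schwartzMul_apply, mul_right_comm,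
        LittlewoodPaley.hatSchwartz_apply, Z.cutoff_mul_hat]
    rw [h1, ← schwartzConv_fourier, apply_schwartzConv_fourier]
    set m := multiplierConv (P.hatSchwartz j) v with hm
    have hmc : Continuous m := continuous_multiplierConv _ _
    have h2 : ∫⁻ x, ‖(𝓕 b : 𝓢(Rd d, ℂ)) x * m x‖ₑ ≤
        eLpNorm (𝓕⁻ (b : Rd d → ℂ)) (ENNReal.ofReal (p / (p - 1))) volume *
          eLpNorm m (ENNReal.ofReal p) volume := by
      have h3 := ENNReal.lintegral_mul_le_Lp_mul_Lq (volume : Measure (Rd d)) hpq.symm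
        (f := fun x => ‖(𝓕 b : 𝓢(Rd d, ℂ)) x‖ₑ) (g := fun x => ‖m x‖ₑ)
        ((𝓕 b : 𝓢(Rd d, ℂ)).continuous.enorm.aemeasurable) (hmc.enorm.aemeasurable)
      rw [← eLpNorm_fourier_eq, eLpNorm_eq_lintegral_rpow_enorm_toReal
        (by simpa using hpq.symm.pos) (by simp), eLpNorm_eq_lintegral_rpow_enorm_toReal
        (by simpa using hpq.pos) (by simp), ENNReal.toReal_ofReal hpq.symm.pos.le,
        ENNReal.toReal_ofReal hpq.pos.le]
      simpa only [Pi.mul_apply, ← enorm_mul] using h3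
    refine (enorm_integral_le_lintegral_enorm _).trans (h2.trans ?_)
    have h4 := h j w
    have h5 := le_lqNorm hq (genPiece κ P s p v) j
    calc _ = (ENNReal.ofReal (κ ((N : ℝ) ^ (-(j : ℤ))) ^ s) *
          ENNReal.ofReal (κ ((N : ℝ) ^ (-(j : ℤ))) ^ (-s))) *
          (eLpNorm (𝓕⁻ (b : Rd d → ℂ)) (ENNReal.ofReal (p / (p - 1))) volume *
          eLpNorm m (ENNReal.ofReal p) volume) := by
          rw [ofReal_rpow_mul_ofReal_rpow_neg P hκ, one_mul]
      _ = (ENNReal.ofReal (κ ((N : ℝ) ^ (-(j : ℤ))) ^ s) *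
          eLpNorm (𝓕⁻ (b : Rd d → ℂ)) (ENNReal.ofReal (p / (p - 1))) volume) *
          genPiece κ P s p v j := by
          rw [genPiece]
          ring
      _ ≤ _ := mul_le_mul' h4 h5
  have hlim : Tendsto (fun n => ‖v (𝓕 (∑ j ∈ Finset.range (n + 1),
      schwartzMul (P.hatSchwartz j) w))‖ₑ) atTop (𝓝 ‖v g‖ₑ) := by
    have h1 := ((FourierTransform.fourierCLM ℂ 𝓢(Rd d, ℂ)).continuous.tendsto w).comp
      (tendsto_sum_schwartzMul_hat P w)
    have h2 : (FourierTransform.fourierCLM ℂ 𝓢(Rd d, ℂ)) w = g := by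
      simp [hw]
    rw [h2] at h1
    have h3 := ((ContinuousLinearMap.continuous v).tendsto g).comp h1
    exact (continuous_enorm.tendsto (v g)).comp h3
  refine le_of_tendsto' hlim fun n => ?_
  have h1 : v (𝓕 (∑ j ∈ Finset.range (n + 1), schwartzMul (P.hatSchwartz j) w)) =
      ∑ j ∈ Finset.range (n + 1), v (𝓕 (schwartzMul (P.hatSchwartz j) w)) := by
    have h2 := map_sum (FourierTransform.fourierCLM ℂ 𝓢(Rd d, ℂ))
      (fun j => schwartzMul (P.hatSchwartz j) w) (Finset.range (n + 1))
    simp only [FourierTransform.fourierCLM_apply] at h2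
    rw [h2, map_sum]
  rw [h1]
  calc _ ≤ ∑ j ∈ Finset.range (n + 1), ‖v (𝓕 (schwartzMul (P.hatSchwartz j) w))‖ₑ :=
        enorm_sum_le _ _
    _ ≤ ∑ j ∈ Finset.range (n + 1), C * 2⁻¹ ^ j * Q * lqNorm q (genPiece κ P s p v) :=
        Finset.sum_le_sum fun j _ => hpiece j
    _ ≤ ∑' j : ℕ, C * 2⁻¹ ^ j * Q * lqNorm q (genPiece κ P s p v) := ENNReal.sum_le_tsum _
    _ = _ := by
        rw [ENNReal.tsum_mul_right, ENNReal.tsum_mul_right, ENNReal.tsum_mul_left,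
          ENNReal.tsum_geometric, ENNReal.one_sub_inv_two, inv_inv, ENNReal.coe_mul]
        rfl

theorem genBesovNorm_add_le (P : LittlewoodPaley d N) (hκ : IsScaling κ l) (s : ℝ)
    {p q : ℝ} (hp : 1 < p) (hq : 1 < q) (v w : 𝓢'(Rd d, ℂ)) :
    genBesovNorm κ P s p q (v + w) ≤ genBesovNorm κ P s p q v + genBesovNorm κ P s p q w := by
  simp only [genBesovNorm_eq P hκ s p hq]
  refine le_trans (lqNorm_mono hq fun j => ?_) (lqNorm_add_le hq _ _)
  rw [genPiece, genPiece, genPiece, ← mul_add, multiplierConv_add]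
  gcongr
  exact eLpNorm_add_le (continuous_multiplierConv _ _).aestronglyMeasurable
    (continuous_multiplierConv _ _).aestronglyMeasurable (by simpa using hp.le)

/-- Convergence of distributions makes each piece converge pointwise. Fatou's lemma is then applied
twice, in `L_p` and in `ℓ^q`. -/
theorem genBesovNorm_le_of_tendsto (P : LittlewoodPaley d N) (hκ : IsScaling κ l) (s : ℝ)
    {p q : ℝ} (hq : 1 < q) {v : ℕ → 𝓢'(Rd d, ℂ)} {w : 𝓢'(Rd d, ℂ)}
    (hv : Tendsto v atTop (𝓝 w)) {M : ℝ≥0∞}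
    (hM : ∀ᶠ n in atTop, genBesovNorm κ P s p q (v n) ≤ M) : genBesovNorm κ P s p q w ≤ M := by
  simp only [genBesovNorm_eq P hκ s p hq] at hM ⊢
  refine lqNorm_le_of_le_liminf hq (fun j => ?_) hM
  simp only [genPiece]
  rw [ENNReal.liminf_const_mul_of_ne_top ENNReal.ofReal_ne_top]
  gcongr
  exact Lp.eLpNorm_lim_le_liminf_eLpNorm
    (fun n => (continuous_multiplierConv _ _).aestronglyMeasurable) _
    (ae_of_all _ fun x => tendsto_multiplierConv hv _ x)

end Norms

/-! ### Real distributions -/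

section RealStructure

variable {d N : ℕ}

theorem fourierInv_im_eq_zero {V : Type*} [NormedAddCommGroup V] [InnerProductSpace ℝ V]
    [FiniteDimensional ℝ V] [MeasurableSpace V] [BorelSpace V] {f : V → ℂ}
    (hr : ∀ ξ, star (f ξ) = f ξ) (he : ∀ ξ, f (-ξ) = f ξ) (x : V) : (𝓕⁻ f x).im = 0 := by
  rw [← Complex.conj_eq_iff_im, fourierInv_apply, ← integral_conj,
    ← integral_neg_eq_self (fun ξ => (Real.fourierChar ⟪ξ, x⟫ : ℂ) * f ξ)]
  refine integral_congr_ae (ae_of_all _ fun ξ => ?_)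
  have h1 : (starRingEnd ℂ) (f ξ) = f ξ := hr ξ
  simp only [map_mul, h1, he, inner_neg_left, AddChar.map_neg_eq_inv, Circle.coe_inv_eq_conj]

/-- The real part of a complex-valued Schwartz function. -/
noncomputable def schwartzRe (f : 𝓢(Rd d, ℂ)) : 𝓢(Rd d, ℝ) := f.postcompCLM Complex.reCLM

theorem schwartzRe_apply (f : 𝓢(Rd d, ℂ)) (x : Rd d) : schwartzRe f x = (f x).re := rfl

theorem toComplex_apply (u : 𝓢(Rd d, ℝ)) (x : Rd d) : toComplex u x = (u x : ℂ) := rfl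

theorem toComplex_schwartzRe {f : 𝓢(Rd d, ℂ)} (hf : ∀ x, (f x).im = 0) :
    toComplex (schwartzRe f) = f := by
  ext x
  rw [toComplex_apply, schwartzRe_apply]
  exact Complex.ext (by simp) (by simp [hf x])

theorem toDistribution_sub (u w : 𝓢(Rd d, ℝ)) :
    toDistribution (u - w) = toDistribution u - toDistribution w := by
  have h : toComplex (u - w) = toComplex u - toComplex w := by
    ext x
    simp [toComplex_apply]
  rw [toDistribution, h, map_sub]
  rfl

theorem toDistribution_apply (u : 𝓢(Rd d, ℝ)) (f : 𝓢(Rd d, ℂ)) :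
    toDistribution u f = ∫ x, f x * (u x : ℂ) :=
  SchwartzMap.toTemperedDistributionCLM_apply_apply volume (toComplex u) f

theorem isRealDistribution_toDistribution (u : 𝓢(Rd d, ℝ)) :
    IsRealDistribution (toDistribution u) := by
  intro f
  rw [toDistribution_apply]
  have h : ∀ x, toComplex f x * (u x : ℂ) = ((f x * u x : ℝ) : ℂ) := fun x => by
    rw [toComplex_apply, Complex.ofReal_mul]
  simp only [h, integral_complex_ofReal, Complex.ofReal_im]

theorem IsRealDistribution.of_tendsto {v : ℕ → 𝓢'(Rd d, ℂ)} {w : 𝓢'(Rd d, ℂ)}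
    (hv : ∀ n, IsRealDistribution (v n)) (h : Tendsto v atTop (𝓝 w)) : IsRealDistribution w := by
  intro f
  have h1 := (PointwiseConvergenceCLM.tendsto_iff_forall_tendsto.1 h) (toComplex f)
  have h2 := (Complex.continuous_im.tendsto _).comp h1
  refine tendsto_nhds_unique h2 ?_
  simp only [Function.comp_def, hv _ f]
  exact tendsto_const_nhds

/-- A real even multiplier has a real kernel, so a real distribution is tested on a real function.
-/
theorem IsRealDistribution.multiplierConv_im {v : 𝓢'(Rd d, ℂ)} (hv : IsRealDistribution v)
    {a : 𝓢(Rd d, ℂ)} (hr : ∀ ξ, star (a ξ) = a ξ) (he : ∀ ξ, a (-ξ) = a ξ) (x : Rd d) :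
    (multiplierConv a v x).im = 0 := by
  have h : ∀ y, (SchwartzMap.compSubConstCLM ℂ x (𝓕 a) y).im = 0 := fun y => by
    rw [SchwartzMap.compSubConstCLM_apply, SchwartzMap.fourier_coe, fourier_eq_fourierInv_neg]
    exact fourierInv_im_eq_zero hr he _
  rw [multiplierConv, ← toComplex_schwartzRe h]
  exact hv _

end RealStructure

/-! ### Density of real Schwartz functions -/

section Density

variable {d N : ℕ} {κ l : ℝ → ℝ}

/-- The Littlewood–Paley functions are not assumed even, so truncating with them could destroy
realness. These separate cutoffs are even, and their kernels are uniformly bounded because they are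
dilates of one function. -/
theorem LittlewoodPaley.exists_even_cutoff (P : LittlewoodPaley d N) :
    ∃ (θ : ℕ → 𝓢(Rd d, ℂ)) (K : ℝ≥0), (∀ n ξ, star (θ n ξ) = θ n ξ) ∧
      (∀ n ξ, θ n (-ξ) = θ n ξ) ∧ (∀ n ξ, ‖ξ‖ ≤ (N : ℝ) ^ n → θ n ξ = 1) ∧
      (∀ n ξ, (N : ℝ) ^ (n + 1) ≤ ‖ξ‖ → θ n ξ = 0) ∧ ∀ n, kernelNorm (θ n) ≤ K := by
  have hN := P.cast_pos
  -- As `N ≥ 2`, the radii `1` and `2` of the bump fit between `N^n` and `N^{n+1}` after dilation.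
  have hN2 : (2 : ℝ) ≤ N := by exact_mod_cast P.one_lt
  let B : ContDiffBump (0 : Rd d) := ⟨1, 2, one_pos, one_lt_two⟩
  set f : Rd d → ℂ := fun ξ => (B ξ : ℂ) with hf
  have h1 : ContDiff ℝ ∞ f := Complex.ofRealCLM.contDiff.comp B.contDiff
  have h2 : HasCompactSupport f := B.hasCompactSupport.mono fun x hx h => hx (by simp [hf, h])
  have hcs : ∀ n : ℕ, HasCompactSupport fun ξ : Rd d => f ((N : ℝ) ^ (-(n : ℤ)) • ξ) := fun n =>
    h2.comp_smul (P.scale_pos n).ne'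
  have hcd : ∀ n : ℕ, ContDiff ℝ ∞ fun ξ : Rd d => f ((N : ℝ) ^ (-(n : ℤ)) • ξ) := fun n =>
    h1.comp (contDiff_const_smul _)
  have hθ : ∀ n ξ, (hcs n).toSchwartzMap (hcd n) ξ = (B ((N : ℝ) ^ (-(n : ℤ)) • ξ) : ℂ) :=
    fun n ξ => rfl
  refine ⟨fun n => (hcs n).toSchwartzMap (hcd n), (kernelNorm f).toNNReal, fun n ξ => ?_,
    fun n ξ => ?_, fun n ξ hξ => ?_, fun n ξ hξ => ?_, fun n => ?_⟩
  · rw [hθ]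
    exact Complex.conj_ofReal _
  · rw [hθ, hθ, smul_neg, B.neg]
  · rw [hθ, B.one_of_mem_closedBall, Complex.ofReal_one]
    rw [mem_closedBall_zero_iff, P.norm_zpow_smul, P.scale_eq_inv_pow]
    exact inv_mul_le_one_of_le₀ hξ (by positivity)
  · rw [hθ, B.zero_of_le_dist, Complex.ofReal_zero]
    rw [dist_zero_right, P.norm_zpow_smul, P.scale_eq_inv_pow]
    change (2 : ℝ) ≤ _
    rw [le_inv_mul_iff₀ (by positivity)]
    refine le_trans ?_ hξ
    rw [pow_succ]
    gcongr
  · rw [ENNReal.coe_toNNReal (kernelNorm_compactSupport_ne_top h1 h2)]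
    exact (kernelNorm_comp_smul (P.scale_pos n) f).le

theorem lqNorm_lt_top_of_finite_support {q : ℝ} (hq : 1 < q) {x : ℕ → ℝ≥0∞} {n : ℕ}
    (hx : ∀ j, x j ≠ ⊤) (h0 : ∀ j, n ≤ j → x j = 0) : lqNorm q x < ⊤ := by
  have hq0 : 0 < q := by linarith
  rw [lqNorm, tsum_eq_sum (s := Finset.range n) fun j hj => by
    rw [h0 j (by simpa using hj), ENNReal.zero_rpow_of_pos hq0]]
  refine ENNReal.rpow_lt_top_of_nonneg (by positivity) (ENNReal.sum_ne_top.2 fun j _ => ?_)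
  exact (ENNReal.rpow_lt_top_of_nonneg hq0.le (hx j)).ne

/-- Used with `b a = b`: the effect of replacing `v` by `f` in a piece is then governed by the `L_p`
distance between `f` and the function obtained from `v` through `a`. -/
theorem integral_fourierInv_sub_eq (b a : 𝓢(Rd d, ℂ)) (f : 𝓢(Rd d, ℝ)) (v : 𝓢'(Rd d, ℂ))
    (x : Rd d) :
    multiplierConv b (toDistribution f) x - multiplierConv (schwartzMul b a) v x =
      ∫ y, 𝓕⁻ (b : Rd d → ℂ) (x - y) * ((f y : ℂ) - multiplierConv a v y) := by
  have h1 : multiplierConv b (toDistribution f) x =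
      ∫ y, 𝓕⁻ (b : Rd d → ℂ) (x - y) * (f y : ℂ) := by
    rw [multiplierConv_toDistribution, SchwartzMap.fourier_coe,
      fourierInv_mul_fourier b.integrable (toComplex f).integrable]
    rfl
  have hS : ∀ y, 𝓕⁻ (b : Rd d → ℂ) (x - y) = SchwartzMap.compSubConstCLM ℂ x (𝓕 b) y := fun y => by
    rw [SchwartzMap.compSubConstCLM_apply, SchwartzMap.fourier_coe, fourier_eq_fourierInv_neg,
      neg_sub]
  rw [h1, multiplierConv_mul]
  simp only [hS, mul_sub]
  refine (integral_sub ?_ (integrable_mul_multiplierConv _ a v)).symm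
  exact (schwartzMul (SchwartzMap.compSubConstCLM ℂ x (𝓕 b)) (toComplex f)).integrable

/-- Schwartz functions are dense in the generalized Besov space. -/
theorem exists_genBesovNorm_sub_lt (P : LittlewoodPaley d N) (hκ : IsScaling κ l) (s : ℝ)
    {p q : ℝ} (hp : 1 < p) (hq : 1 < q) {v : 𝓢'(Rd d, ℂ)} (hv : IsRealDistribution v)
    (hG : genBesovNorm κ P s p q v < ⊤) {ε : ℝ≥0∞} (hε : 0 < ε) :
    ∃ u : 𝓢(Rd d, ℝ), genBesovNorm κ P s p q (toDistribution u - v) < ε := by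
  obtain ⟨θ, K, hθr, hθe, hθ1, hθ0, hθK⟩ := P.exists_even_cutoff
  have hp1 : (1 : ℝ≥0∞) ≤ ENNReal.ofReal p := by simpa using hp.le
  rw [genBesovNorm_eq P hκ s p hq] at hG
  have hε2 : 0 < ε / 2 := ENNReal.half_pos hε.ne'
  -- Level of the frequency truncation. Truncating by `θ n` changes only the pieces `j ≥ n`, each by
  -- at most the factor `K + 1`.
  obtain ⟨n, hn⟩ : ∃ n : ℕ, (K + 1 : ℝ≥0∞) *
      lqNorm q (fun j => if n ≤ j then genPiece κ P s p v j else 0) < ε / 2 := by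
    have h1 := ENNReal.Tendsto.const_mul (tendsto_lqNorm_tail hq hG) (a := (K + 1 : ℝ≥0∞))
      (Or.inr (by finiteness))
    rw [mul_zero] at h1
    exact (h1.eventually_lt_const hε2).exists
  set b : ℕ → 𝓢(Rd d, ℂ) := fun j => schwartzMul (P.hatSchwartz j) (θ n) with hb
  set D : ℕ → ℝ≥0∞ := fun j => ENNReal.ofReal (κ ((N : ℝ) ^ (-(j : ℤ))) ^ (-s)) *
    kernelNorm (b j) with hD
  have hDfin : lqNorm q D < ⊤ := by
    refine lqNorm_lt_top_of_finite_support hq (n := n + 2)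
      (fun j => ENNReal.mul_ne_top (by simp) (kernelNorm_schwartz_ne_top _)) fun j hj => ?_
    -- Zero is written as `0 * 0` so that the rule for constant multiples gives a vanishing kernel
    -- norm.
    have : (b j : Rd d → ℂ) = fun _ => (0 : ℂ) * 0 := by
      ext ξ
      simp only [hb, schwartzMul_apply, LittlewoodPaley.hatSchwartz_apply, mul_zero]
      rcases lt_or_ge ‖ξ‖ ((N : ℝ) ^ (n + 1)) with h | h
      · rw [P.hat_eq_zero_of_norm_lt hj h]; simp
      · rw [hθ0 n ξ h, mul_zero]
    simp only [hD, this, kernelNorm_const_mul]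
    simp
  obtain ⟨δ, hδ0, hδ⟩ : ∃ δ : ℝ, 0 < δ ∧ ENNReal.ofReal δ * lqNorm q D < ε / 2 := by
    have h1 : Tendsto (fun δ : ℝ => ENNReal.ofReal δ * lqNorm q D) (𝓝[>] 0) (𝓝 0) := by
      have h2 : Tendsto (fun δ : ℝ => ENNReal.ofReal δ) (𝓝[>] 0) (𝓝 0) := by
        have := (ENNReal.continuous_ofReal.tendsto 0).mono_left
          (nhdsWithin_le_nhds (s := Ioi (0 : ℝ)))
        simpa using this
      simpa using ENNReal.Tendsto.mul_const h2 (Or.inr hDfin.ne)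
    obtain ⟨δ, h3, h4⟩ := ((h1.eventually_lt_const hε2).and self_mem_nhdsWithin).exists
    exact ⟨δ, h4, h3⟩
  -- The truncation of `v` one level higher is a genuine real function in `L_p`, and `θ n θ (n + 1)
  -- = θ n`, so nothing needed below is lost.
  set w := multiplierConv (θ (n + 1)) v with hw
  have hwc : Continuous w := continuous_multiplierConv _ _
  have hwim : ∀ x, (w x).im = 0 := fun x => hv.multiplierConv_im (hθr _) (hθe _) x
  have hwLp : eLpNorm w (ENNReal.ofReal p) volume < ⊤ := by
    -- The first `n + 3` pieces sum to one where `‖ξ‖ < N^{n+2}`, and `θ (n + 1)` vanishes beyond.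
    -- So `w` is a finite sum of pieces already known to lie in `L_p`.
    have h1 : θ (n + 1) = ∑ j ∈ Finset.range (n + 2 + 1),
        schwartzMul (θ (n + 1)) (P.hatSchwartz j) := by
      ext ξ
      rw [sum_apply]
      simp only [schwartzMul_apply, LittlewoodPaley.hatSchwartz_apply]
      rw [← Finset.mul_sum, ← Complex.ofReal_sum, P.sum_hat]
      rcases lt_or_ge ‖ξ‖ ((N : ℝ) ^ (n + 2)) with h | h
      · rw [P.hat_zero_eq_one, Complex.ofReal_one, mul_one]
        have hN := P.cast_pos
        rwa [P.norm_zpow_smul, P.scale_eq_inv_pow, inv_mul_lt_iff₀ (by positivity), mul_one]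
      · rw [hθ0 (n + 1) ξ h, zero_mul]
    rw [hw, h1, multiplierConv_sum]
    refine lt_of_le_of_lt (eLpNorm_sum_le
      (fun j _ => (continuous_multiplierConv _ _).aestronglyMeasurable) hp1) ?_
    refine ENNReal.sum_lt_top.2 fun j _ => lt_of_le_of_lt
      (eLpNorm_multiplierConv_mul_le _ _ _ hp.le) (ENNReal.mul_lt_top
        (kernelNorm_schwartz_ne_top _).lt_top ?_)
    have h2 : genPiece κ P s p v j < ⊤ := (le_lqNorm hq _ j).trans_lt hG
    rw [genPiece] at h2
    refine lt_top_iff_ne_top.2 fun h => h2.ne ?_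
    rw [h, ENNReal.mul_top]
    exact (ENNReal.ofReal_pos.2 (Real.rpow_pos_of_pos (hκ.pos _ (P.scale_pos j)) _)).ne'
  have hre : MemLp (fun x => (w x).re) (ENNReal.ofReal p) volume :=
    MemLp.re ⟨hwc.aestronglyMeasurable, hwLp⟩
  obtain ⟨g, hg1, hg2, hg3⟩ := hre.exist_eLpNorm_sub_le ENNReal.ofReal_ne_top hp1 hδ0
  set f : 𝓢(Rd d, ℝ) := hg1.toSchwartzMap hg2 with hf
  have hfw : eLpNorm (fun x => (f x : ℂ) - w x) (ENNReal.ofReal p) volume ≤ ENNReal.ofReal δ := by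
    refine le_trans (le_of_eq ?_) hg3
    refine eLpNorm_congr_norm_ae (ae_of_all _ fun x => ?_)
    have h1 : w x = ((w x).re : ℂ) := Complex.ext (by simp) (by simp [hwim x])
    rw [h1, ← Complex.ofReal_sub, Complex.norm_real, Pi.sub_apply, norm_sub_rev]
    rfl
  -- The `L_p` approximant `f` may have arbitrarily high frequencies, whose weights are not
  -- controlled. Truncating it again leaves only finitely many pieces, so the error is `δ` times a
  -- finite quantity.
  set U : 𝓢(Rd d, ℂ) := 𝓕⁻ (schwartzMul (θ n) (𝓕 (toComplex f))) with hU
  have hUim : ∀ x, (U x).im = 0 := fun x => by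
    have h1 : U x = multiplierConv (θ n) (toDistribution f) x := by
      rw [multiplierConv_toDistribution, hU, SchwartzMap.fourierInv_coe]
      rfl
    rw [h1]
    exact (isRealDistribution_toDistribution f).multiplierConv_im (hθr n) (hθe n) x
  refine ⟨schwartzRe U, ?_⟩
  have hu : ∀ j, multiplierConv (P.hatSchwartz j) (toDistribution (schwartzRe U)) =
      multiplierConv (b j) (toDistribution f) := fun j => by
    rw [multiplierConv_toDistribution, multiplierConv_toDistribution, toComplex_schwartzRe hUim]
    congr 1
    ext ξ
    have : 𝓕 U = schwartzMul (θ n) (𝓕 (toComplex f)) := by simp [hU]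
    rw [this]
    simp only [hb, schwartzMul_apply, mul_assoc]
  have hbθ : ∀ j, schwartzMul (b j) (θ (n + 1)) = b j := fun j => by
    ext ξ
    simp only [hb, schwartzMul_apply]
    rcases lt_or_ge ‖ξ‖ ((N : ℝ) ^ (n + 1)) with h | h
    · rw [hθ1 (n + 1) ξ h.le, mul_one]
    · rw [hθ0 n ξ h]; simp
  have herr1 : ∀ j, eLpNorm (multiplierConv (b j) (toDistribution f) - multiplierConv (b j) v)
      (ENNReal.ofReal p) volume ≤ kernelNorm (b j) * ENNReal.ofReal δ := fun j => by
    have h1 : multiplierConv (b j) (toDistribution f) - multiplierConv (b j) v = fun x =>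
        ∫ y, 𝓕⁻ (b j : Rd d → ℂ) (x - y) * ((f y : ℂ) - w y) := by
      ext x
      rw [hw, ← integral_fourierInv_sub_eq, hbθ, Pi.sub_apply]
    rw [h1]
    refine (eLpNorm_integral_sub_mul_le (continuous_fourierInv (b j).integrable)
      ((Complex.continuous_ofReal.comp f.continuous).sub hwc) hp.le).trans ?_
    exact mul_le_mul_right hfw _
  have herr2 : ∀ j : ℕ, ENNReal.ofReal (κ ((N : ℝ) ^ (-(j : ℤ))) ^ (-s)) *
      eLpNorm (multiplierConv (b j) v - multiplierConv (P.hatSchwartz j) v)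
        (ENNReal.ofReal p) volume ≤
      (K + 1 : ℝ≥0∞) * (if n ≤ j then genPiece κ P s p v j else 0) := fun j => by
    split_ifs with hj
    · have hcomm : b j = schwartzMul (θ n) (P.hatSchwartz j) := by
        ext ξ
        simp only [hb, schwartzMul_apply, mul_comm]
      have h1 : eLpNorm (multiplierConv (b j) v - multiplierConv (P.hatSchwartz j) v)
          (ENNReal.ofReal p) volume ≤ (K + 1 : ℝ≥0∞) *
            eLpNorm (multiplierConv (P.hatSchwartz j) v) (ENNReal.ofReal p) volume := by
        refine (eLpNorm_sub_le (continuous_multiplierConv _ _).aestronglyMeasurable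
          (continuous_multiplierConv _ _).aestronglyMeasurable hp1).trans ?_
        rw [add_mul, one_mul, hcomm]
        gcongr
        exact (eLpNorm_multiplierConv_mul_le _ _ _ hp.le).trans (by gcongr; exact hθK n)
      rw [genPiece, mul_left_comm]
      gcongr
    · have h1 : b j = P.hatSchwartz j := by
        ext ξ
        simp only [hb, schwartzMul_apply, LittlewoodPaley.hatSchwartz_apply]
        rcases lt_or_ge ((N : ℝ) ^ (j + 1)) ‖ξ‖ with h | h
        · rw [P.hat_eq_zero h]; simp
        · rw [hθ1 n ξ (h.trans (pow_le_pow_right₀ P.one_lt_cast.le (by omega))), mul_one]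
      rw [h1, sub_self]
      simp
  rw [genBesovNorm_eq P hκ s p hq]
  have hpiece : ∀ j, genPiece κ P s p (toDistribution (schwartzRe U) - v) j ≤
      ENNReal.ofReal δ * D j +
        (K + 1 : ℝ≥0∞) * (if n ≤ j then genPiece κ P s p v j else 0) := fun j => by
    have h1 : multiplierConv (P.hatSchwartz j) (toDistribution (schwartzRe U) - v) =
        (multiplierConv (b j) (toDistribution f) - multiplierConv (b j) v) +
          (multiplierConv (b j) v - multiplierConv (P.hatSchwartz j) v) := by
      rw [multiplierConv_sub, hu, sub_add_sub_cancel]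
    rw [genPiece, h1]
    refine (mul_le_mul_right (eLpNorm_add_le
      ((continuous_multiplierConv _ _).sub (continuous_multiplierConv _ _)).aestronglyMeasurable
      ((continuous_multiplierConv _ _).sub (continuous_multiplierConv _ _)).aestronglyMeasurable
      hp1) _).trans ?_
    rw [mul_add]
    refine add_le_add ((mul_le_mul_right (herr1 j) _).trans_eq ?_) (herr2 j)
    simp only [hD]
    ring
  calc _ ≤ _ := lqNorm_mono hq hpiece
    _ ≤ _ := lqNorm_add_le hq _ _
    _ = ENNReal.ofReal δ * lqNorm q D + (K + 1 : ℝ≥0∞) *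
          lqNorm q (fun j => if n ≤ j then genPiece κ P s p v j else 0) := by
        rw [lqNorm_const_mul hq, lqNorm_const_mul hq]
    _ < ε / 2 + ε / 2 := ENNReal.add_lt_add hδ hn
    _ = ε := ENNReal.add_halves ε

end Density

/-! ### The closure of the Schwartz space inside tempered distributions -/

section Closure

variable {d N : ℕ} {κ l : ℝ → ℝ} {σ : ℝ} {μ : Measure (Rd d)}

theorem besovSchwartzNorm_add_le (hμ : LevyClass σ μ) (P : LittlewoodPaley d N) (s : ℝ)
    {p q : ℝ} (hp : 1 < p) (hq : 1 < q) (u w : 𝓢(Rd d, ℝ)) :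
    besovSchwartzNorm σ μ P s p q (u + w) ≤
      besovSchwartzNorm σ μ P s p q u + besovSchwartzNorm σ μ P s p q w := by
  simp only [besovSchwartzNorm_eq]
  refine le_trans (lqNorm_mono hq fun j => ?_) (lqNorm_add_le hq _ _)
  simp only [besselConvolution_eq hμ]
  have hi : ∀ u : 𝓢(Rd d, ℝ), Integrable fun ξ : Rd d => (((1 + levyExp μ ξ) ^ s : ℝ) : ℂ) *
      schwartzMul (P.hatSchwartz j) (𝓕 (toComplex u)) ξ := fun u =>
    integrable_rpow_levyExp_mul hμ s
      (hasCompactSupport_schwartzMul (hasCompactSupport_hatSchwartz P j))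
  have h1 : 𝓕 (toComplex (u + w)) = 𝓕 (toComplex u) + 𝓕 (toComplex w) := by
    rw [← FourierTransform.fourier_add]
    congr 1
    ext x
    simp [toComplex_apply]
  have h2 : 𝓕⁻ (fun ξ => (((1 + levyExp μ ξ) ^ s : ℝ) : ℂ) *
      schwartzMul (P.hatSchwartz j) (𝓕 (toComplex (u + w))) ξ) =
      𝓕⁻ (fun ξ => (((1 + levyExp μ ξ) ^ s : ℝ) : ℂ) *
        schwartzMul (P.hatSchwartz j) (𝓕 (toComplex u)) ξ) +
      𝓕⁻ (fun ξ => (((1 + levyExp μ ξ) ^ s : ℝ) : ℂ) *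
        schwartzMul (P.hatSchwartz j) (𝓕 (toComplex w)) ξ) := by
    ext x
    rw [Pi.add_apply, ← fourierInv_add (hi u) (hi w), h1]
    simp only [schwartzMul_apply, add_apply, mul_add]
  rw [h2]
  exact eLpNorm_add_le (continuous_fourierInv (hi u)).aestronglyMeasurable
    (continuous_fourierInv (hi w)).aestronglyMeasurable (by simpa using hp.le)

theorem genBesovNorm_neg (P : LittlewoodPaley d N) (hκ : IsScaling κ l) (s p : ℝ) {q : ℝ}
    (hq : 1 < q) (v : 𝓢'(Rd d, ℂ)) :
    genBesovNorm κ P s p q (-v) = genBesovNorm κ P s p q v := by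
  simp only [genBesovNorm_eq P hκ s p hq]
  congr 1
  ext j
  have h : multiplierConv (P.hatSchwartz j) (-v) = -multiplierConv (P.hatSchwartz j) v := rfl
  rw [genPiece, genPiece, h, eLpNorm_neg]

theorem genBesovNorm_sub_le (P : LittlewoodPaley d N) (hκ : IsScaling κ l) (s : ℝ)
    {p q : ℝ} (hp : 1 < p) (hq : 1 < q) (v w : 𝓢'(Rd d, ℂ)) :
    genBesovNorm κ P s p q (v - w) ≤ genBesovNorm κ P s p q v + genBesovNorm κ P s p q w := by
  rw [sub_eq_add_neg, ← genBesovNorm_neg P hκ s p hq w]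
  exact genBesovNorm_add_le P hκ s hp hq _ _

/-- Convergence in the generalized Besov norm implies convergence of distributions. -/
theorem tendsto_of_genBesovNorm_sub (P : LittlewoodPaley d N) (hκ : IsScaling κ l) (s : ℝ)
    {p q : ℝ} (hp : 1 < p) (hq : 1 < q) {v : ℕ → 𝓢'(Rd d, ℂ)} {w : 𝓢'(Rd d, ℂ)}
    (h : Tendsto (fun n => genBesovNorm κ P s p q (v n - w)) atTop (𝓝 0)) :
    Tendsto v atTop (𝓝 w) := by
  obtain ⟨S, C, hC⟩ := exists_enorm_apply_le P hκ s hp hq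
  refine PointwiseConvergenceCLM.tendsto_iff_forall_tendsto.2 fun g => ?_
  rw [tendsto_iff_edist_tendsto_0]
  have h1 := ENNReal.Tendsto.const_mul h (a := C *
    ENNReal.ofReal (S.sup (schwartzSeminormFamily ℂ (Rd d) ℂ) (𝓕⁻ g))) (Or.inr (by finiteness))
  rw [mul_zero] at h1
  refine tendsto_of_tendsto_of_tendsto_of_le_of_le tendsto_const_nhds h1 (fun _ => bot_le)
    fun n => ?_
  rw [edist_eq_enorm_sub]
  exact hC (v n - w) g

theorem IsBesovCauchy.exists_bound (hμ : LevyClass σ μ) {P : LittlewoodPaley d N} {s : ℝ}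
    {p q : ℝ} (hp : 1 < p) (hq : 1 < q) {u : ℕ → 𝓢(Rd d, ℝ)} (hu : IsBesovCauchy σ μ P s p q u)
    (hfin : ∀ u : 𝓢(Rd d, ℝ), besovSchwartzNorm σ μ P s p q u < ⊤) :
    ∃ B : ℝ≥0, ∀ᶠ n in atTop, besovSchwartzNorm σ μ P s p q (u n) ≤ B := by
  obtain ⟨n₀, h⟩ := hu 1 one_pos
  refine ⟨(besovSchwartzNorm σ μ P s p q (u n₀) + 1).toNNReal, ?_⟩
  rw [ENNReal.coe_toNNReal (ENNReal.add_ne_top.2 ⟨(hfin _).ne, ENNReal.one_ne_top⟩)]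
  filter_upwards [eventually_ge_atTop n₀] with n hn
  have h1 := besovSchwartzNorm_add_le hμ P s hp hq (u n₀) (u n - u n₀)
  rw [add_sub_cancel] at h1
  exact h1.trans (add_le_add_right (h n n₀ hn le_rfl).le _)

/-- A Cauchy sequence of Schwartz functions converges as a sequence of tempered distributions. -/
theorem IsBesovCauchy.exists_tendsto (hκ : IsScaling κ l) (hμ : LevyClass σ μ)
    (hD : AssumptionD σ κ μ) (hB : AssumptionB σ κ μ) {P : LittlewoodPaley d N} {s : ℝ} {p q : ℝ}
    (hp : 1 < p) (hq : 1 < q) {u : ℕ → 𝓢(Rd d, ℝ)} (hu : IsBesovCauchy σ μ P s p q u)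
    (hfin : ∀ u : 𝓢(Rd d, ℝ), besovSchwartzNorm σ μ P s p q u < ⊤) :
    ∃ v : 𝓢'(Rd d, ℂ), Tendsto (fun n => toDistribution (u n)) atTop (𝓝 v) := by
  obtain ⟨S, C, hC⟩ := exists_enorm_apply_le P hκ s hp hq
  obtain ⟨A, hA⟩ := exists_genBesovNorm_le P hκ hμ hD hB s hp hq
  set Q : 𝓢(Rd d, ℂ) → ℝ := fun g => S.sup (schwartzSeminormFamily ℂ (Rd d) ℂ) (𝓕⁻ g) with hQ
  have hQc : Continuous Q :=
    (continuous_sup_seminorm S).comp (FourierTransform.fourierInvCLM ℂ 𝓢(Rd d, ℂ)).continuous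
  have hbound : ∀ (w : 𝓢(Rd d, ℝ)) g, ‖toDistribution w g‖ₑ ≤
      C * ENNReal.ofReal (Q g) * (A * besovSchwartzNorm σ μ P s p q w) := fun w g =>
    (hC _ g).trans (mul_le_mul_right (hA w) _)
  -- Tested on a fixed `g`, the sequence is Cauchy because the norm dominates the pairing. The
  -- tolerance is divided by `c + 1` to allow `c = 0`.
  have hcauchy : ∀ g, CauchySeq fun n => toDistribution (u n) g := by
    intro g
    rw [EMetric.cauchySeq_iff]
    intro ε hε
    set c : ℝ≥0∞ := C * ENNReal.ofReal (Q g) * A with hc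
    have hc' : c ≠ ⊤ := by finiteness
    obtain ⟨n₀, h⟩ := hu (ε / (c + 1)) (ENNReal.div_pos hε.ne' (by finiteness))
    refine ⟨n₀, fun m hm n hn => ?_⟩
    have h1 := hbound (u m - u n) g
    rw [toDistribution_sub] at h1
    rw [edist_eq_enorm_sub]
    refine lt_of_le_of_lt h1 ?_
    rw [← mul_assoc, ← hc]
    rcases eq_or_ne c 0 with h0 | h0
    · rw [h0, zero_mul]
      exact hε
    · calc c * besovSchwartzNorm σ μ P s p q (u m - u n) < c * (ε / (c + 1)) :=
            ENNReal.mul_lt_mul_right h0 hc' (h m n hm hn)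
        _ ≤ (c + 1) * (ε / (c + 1)) := by gcongr; exact le_self_add
        _ ≤ ε := ENNReal.mul_div_le
  choose L hL using fun g => cauchySeq_tendsto_of_complete (hcauchy g)
  obtain ⟨B, hBd⟩ := hu.exists_bound hμ hp hq hfin
  -- Cauchy sequences are eventually bounded in norm. This yields one seminorm dominating the
  -- pointwise limit, hence its continuity, with no uniform boundedness principle.
  have hLb : ∀ g, ‖L g‖ ≤ C * A * B * Q g := by
    intro g
    have hQ0 : 0 ≤ Q g := apply_nonneg _ _
    have h1 : ‖L g‖ₑ ≤ C * ENNReal.ofReal (Q g) * (A * B) := by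
      refine le_of_tendsto ((continuous_enorm.tendsto (L g)).comp (hL g)) ?_
      filter_upwards [hBd] with n hn
      exact (hbound (u n) g).trans (by gcongr)
    have h2 : (C * ENNReal.ofReal (Q g) * (A * B) : ℝ≥0∞) =
        ENNReal.ofReal (C * A * B * Q g) := by
      rw [ENNReal.ofReal_mul (by positivity), ENNReal.ofReal_mul (by positivity),
        ENNReal.ofReal_mul (by positivity)]
      simp only [ENNReal.ofReal_coe_nnreal]
      ring
    rw [h2, ← ofReal_norm] at h1
    exact (ENNReal.ofReal_le_ofReal_iff (by positivity)).1 h1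
  set T : 𝓢(Rd d, ℂ) →ₗ[ℂ] ℂ := linearMapOfTendsto (l := atTop) L
    (fun n => ((toDistribution (u n) : 𝓢(Rd d, ℂ) →L[ℂ] ℂ) : 𝓢(Rd d, ℂ) →ₗ[ℂ] ℂ))
    (tendsto_pi_nhds.2 hL) with hT
  have hTL : ∀ g, T g = L g := fun g => rfl
  have hTc : Continuous T := by
    refine continuous_of_continuousAt_zero T ?_
    rw [ContinuousAt, map_zero]
    have h1 : Tendsto (fun g => (C * A * B : ℝ) * Q g) (𝓝 0) (𝓝 0) := by
      have h2 : Continuous fun g => (C * A * B : ℝ) * Q g := continuous_const.mul hQc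
      have h3 := h2.tendsto 0
      have h4 : Q 0 = 0 := by
        have : (𝓕⁻ (0 : 𝓢(Rd d, ℂ))) = 0 := (FourierTransform.fourierInvCLM ℂ 𝓢(Rd d, ℂ)).map_zero
        simp only [hQ, this, map_zero]
      simpa [h4] using h3
    exact squeeze_zero_norm hLb h1
  refine ⟨(⟨T, hTc⟩ : 𝓢(Rd d, ℂ) →L[ℂ] ℂ), ?_⟩
  exact PointwiseConvergenceCLM.tendsto_iff_forall_tendsto.2 hL

/-- This is closability of the norm: a Cauchy sequence tending to zero as distributions tends to
zero in norm. For fixed `m` the difference `u_m - w_m` is the distributional limit, as `n → ∞`, of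
`(u_m - w_m) - (u_n - w_n)`. The norms of these are small by the Cauchy property, and lower
semicontinuity passes the bound to the limit. -/
theorem BesovApproximates.tendsto_sub (hκ : IsScaling κ l) (hμ : LevyClass σ μ)
    (hD : AssumptionD σ κ μ) (hB : AssumptionB σ κ μ) {P : LittlewoodPaley d N} {s : ℝ} {p q : ℝ}
    (hp : 1 < p) (hq : 1 < q) {u w : ℕ → 𝓢(Rd d, ℝ)} {v : 𝓢'(Rd d, ℂ)}
    (hu : BesovApproximates σ μ P s p q u v) (hw : BesovApproximates σ μ P s p q w v) :
    Tendsto (fun n => besovSchwartzNorm σ μ P s p q (u n - w n)) atTop (𝓝 0) := by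
  obtain ⟨A, hA⟩ := exists_genBesovNorm_le P hκ hμ hD hB s hp hq
  obtain ⟨A', hA'⟩ := exists_besovSchwartzNorm_le P hκ hμ hD hB s hp hq
  have hkey : ∀ ε : ℝ≥0∞, 0 < ε → ∀ᶠ n in atTop,
      besovSchwartzNorm σ μ P s p q (u n - w n) ≤ A' * (A * (ε + ε)) := by
    intro ε hε
    obtain ⟨n₁, h₁⟩ := hu.1 ε hε
    obtain ⟨n₂, h₂⟩ := hw.1 ε hε
    filter_upwards [eventually_ge_atTop (max n₁ n₂)] with m hm
    refine (hA' _).trans (mul_le_mul_right ?_ _)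
    have hlim : Tendsto (fun n => toDistribution ((u m - w m) - (u n - w n))) atTop
        (𝓝 (toDistribution (u m - w m))) := by
      have h3 := (tendsto_const_nhds (x := toDistribution (u m - w m))).sub (hu.2.sub hw.2)
      rw [sub_self, sub_zero] at h3
      refine h3.congr fun n => ?_
      rw [toDistribution_sub (u m - w m), toDistribution_sub (u n)]
    refine genBesovNorm_le_of_tendsto P hκ s hq hlim ?_
    filter_upwards [eventually_ge_atTop (max n₁ n₂)] with n hn
    refine (hA _).trans (mul_le_mul_right ?_ _)
    have h4 : u m - w m - (u n - w n) = (u m - u n) + (w n - w m) := by abel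
    rw [h4]
    refine (besovSchwartzNorm_add_le hμ P s hp hq _ _).trans (add_le_add ?_ ?_)
    · exact (h₁ m n (le_of_max_le_left hm) (le_of_max_le_left hn)).le
    · exact (h₂ n m (le_of_max_le_right hn) (le_of_max_le_right hm)).le
  rw [ENNReal.tendsto_nhds_zero]
  intro ε hε
  have h1 : Tendsto (fun δ : ℝ≥0∞ => (A' : ℝ≥0∞) * (A * (δ + δ))) (𝓝[>] 0) (𝓝 0) := by
    have h2 : Continuous fun δ : ℝ≥0∞ => (A' : ℝ≥0∞) * (A * (δ + δ)) :=
      (ENNReal.continuous_const_mul (by simp)).comp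
        ((ENNReal.continuous_const_mul (by simp)).comp (continuous_id.add continuous_id))
    simpa using (h2.tendsto 0).mono_left (nhdsWithin_le_nhds (s := Ioi (0 : ℝ≥0∞)))
  obtain ⟨δ, h3, h4⟩ := ((h1.eventually_lt_const hε).and self_mem_nhdsWithin).exists
  filter_upwards [hkey δ h4] with n hn
  exact hn.trans h3.le

theorem limsup_le_of_le_add {a b e : ℕ → ℝ≥0∞} (h : ∀ n, a n ≤ b n + e n)
    (he : Tendsto e atTop (𝓝 0)) : limsup a atTop ≤ limsup b atTop := by
  refine ENNReal.le_of_forall_pos_le_add fun ε hε _ => ?_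
  rw [← tsub_le_iff_right, ← ENNReal.limsup_sub_const]
  refine limsup_le_limsup ?_
  filter_upwards [he.eventually_lt_const (show (0 : ℝ≥0∞) < ε by exact_mod_cast hε)] with n hn
  rw [tsub_le_iff_right]
  exact (h n).trans (add_le_add_right hn.le _)

/-- The norm of a limit is the limit of the norms. -/
theorem BesovApproximates.tendsto_norm (hκ : IsScaling κ l) (hμ : LevyClass σ μ)
    (hD : AssumptionD σ κ μ) (hB : AssumptionB σ κ μ) {P : LittlewoodPaley d N} {s : ℝ} {p q : ℝ}
    (hp : 1 < p) (hq : 1 < q) {u : ℕ → 𝓢(Rd d, ℝ)} {v : 𝓢'(Rd d, ℂ)}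
    (hu : BesovApproximates σ μ P s p q u v) :
    Tendsto (fun n => besovSchwartzNorm σ μ P s p q (u n)) atTop
      (𝓝 (besovNorm σ μ P s p q v)) := by
  set a : ℕ → ℝ≥0∞ := fun n => besovSchwartzNorm σ μ P s p q (u n) with ha
  -- All approximating sequences have the same upper limit, so the infimum defining the norm is
  -- attained at each of them.
  have hlim : besovNorm σ μ P s p q v = limsup a atTop := by
    refine le_antisymm (iInf₂_le u hu) (le_iInf₂ fun w hw => ?_)
    refine limsup_le_of_le_add (fun n => ?_) (hu.tendsto_sub hκ hμ hD hB hp hq hw)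
    have h1 := besovSchwartzNorm_add_le hμ P s hp hq (w n) (u n - w n)
    rwa [add_sub_cancel] at h1
  rw [hlim]
  refine tendsto_of_le_liminf_of_limsup_le ?_ le_rfl
  refine ENNReal.le_of_forall_pos_le_add fun ε hε _ => ?_
  obtain ⟨n₀, h⟩ := hu.1 ε (by exact_mod_cast hε)
  -- By the Cauchy property a late norm is within `ε` of all later ones, so the upper limit does not
  -- exceed the lower one.
  have h1 : ∀ᶠ m in atTop, limsup a atTop ≤ a m + ε := by
    filter_upwards [eventually_ge_atTop n₀] with m hm
    refine limsup_le_of_le (by isBoundedDefault) ?_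
    filter_upwards [eventually_ge_atTop n₀] with n hn
    have h2 := besovSchwartzNorm_add_le hμ P s hp hq (u m) (u n - u m)
    rw [add_sub_cancel] at h2
    exact h2.trans (add_le_add_right (h n m hn hm).le _)
  rw [← tsub_le_iff_right]
  refine le_liminf_of_le (by isBoundedDefault) ?_
  filter_upwards [h1] with m hm
  rwa [tsub_le_iff_right]

/-- Distributions of finite generalized Besov norm are approximated by Schwartz functions. -/
theorem exists_besovApproximates (hκ : IsScaling κ l) (hμ : LevyClass σ μ)
    (hD : AssumptionD σ κ μ) (hB : AssumptionB σ κ μ) (P : LittlewoodPaley d N) (s : ℝ) {p q : ℝ}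
    (hp : 1 < p) (hq : 1 < q) {v : 𝓢'(Rd d, ℂ)} (hv : v ∈ genBesovSpace κ P s p q) :
    ∃ u : ℕ → 𝓢(Rd d, ℝ), BesovApproximates σ μ P s p q u v ∧
      Tendsto (fun n => genBesovNorm κ P s p q (toDistribution (u n) - v)) atTop (𝓝 0) := by
  obtain ⟨A', hA'⟩ := exists_besovSchwartzNorm_le P hκ hμ hD hB s hp hq
  -- The tolerance is `1/n`; at `n = 0` it is `⊤`, still positive.
  choose u hu using fun n : ℕ => exists_genBesovNorm_sub_lt P hκ s hp hq hv.1 hv.2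
    (ε := ((n : ℝ≥0∞))⁻¹) (by simp)
  have hlim : Tendsto (fun n => genBesovNorm κ P s p q (toDistribution (u n) - v)) atTop (𝓝 0) :=
    tendsto_of_tendsto_of_tendsto_of_le_of_le tendsto_const_nhds
      ENNReal.tendsto_inv_nat_nhds_zero (fun _ => bot_le) fun n => (hu n).le
  refine ⟨u, ⟨fun ε hε => ?_, tendsto_of_genBesovNorm_sub P hκ s hp hq hlim⟩, hlim⟩
  have h1 : Tendsto (fun δ : ℝ≥0∞ => (A' : ℝ≥0∞) * (δ + δ)) (𝓝[>] 0) (𝓝 0) := by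
    have h2 : Continuous fun δ : ℝ≥0∞ => (A' : ℝ≥0∞) * (δ + δ) :=
      (ENNReal.continuous_const_mul (by simp)).comp (continuous_id.add continuous_id)
    simpa using (h2.tendsto 0).mono_left (nhdsWithin_le_nhds (s := Ioi (0 : ℝ≥0∞)))
  obtain ⟨δ, h3, h4⟩ := ((h1.eventually_lt_const hε).and self_mem_nhdsWithin).exists
  obtain ⟨n₀, hn₀⟩ := eventually_atTop.1 (hlim.eventually_lt_const h4)
  refine ⟨n₀, fun m n hm hn => lt_of_le_of_lt ?_ h3⟩
  refine (hA' _).trans (mul_le_mul_right ?_ _)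
  have h5 : toDistribution (u m - u n) = (toDistribution (u m) - v) - (toDistribution (u n) - v) := by
    rw [toDistribution_sub, sub_sub_sub_cancel_right]
  rw [h5]
  exact (genBesovNorm_sub_le P hκ s hp hq _ _).trans (add_le_add (hn₀ m hm).le (hn₀ n hn).le)

end Closure

end LevyBesov

/-! ### Equality of the spaces and equivalence of the norms -/

theorem proposition1 (d N : ℕ) (σ : ℝ) (μ : MeasureTheory.Measure (LevyBesov.Rd d))
    (κ l : ℝ → ℝ) (P : LevyBesov.LittlewoodPaley d N) (s p q : ℝ)
    (hκ : LevyBesov.IsScaling κ l) (hμ : LevyBesov.LevyClass σ μ)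
    (hD : LevyBesov.AssumptionD σ κ μ) (hB : LevyBesov.AssumptionB σ κ μ)
    (hl : l ((N : ℝ)⁻¹) < 1) (hp : 1 < p) (hq : 1 < q) :
    (∀ u : 𝓢(LevyBesov.Rd d, ℝ), LevyBesov.besovSchwartzNorm σ μ P s p q u < ⊤) ∧
    (∀ u : ℕ → 𝓢(LevyBesov.Rd d, ℝ), LevyBesov.IsBesovCauchy σ μ P s p q u →
      ∃ v : 𝓢'(LevyBesov.Rd d, ℂ),
        Tendsto (fun n => LevyBesov.toDistribution (u n)) atTop (𝓝 v)) ∧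
    (∀ (u : ℕ → 𝓢(LevyBesov.Rd d, ℝ)) (v : 𝓢'(LevyBesov.Rd d, ℂ)),
      LevyBesov.BesovApproximates σ μ P s p q u v →
        Tendsto (fun n => LevyBesov.besovSchwartzNorm σ μ P s p q (u n)) atTop
          (𝓝 (LevyBesov.besovNorm σ μ P s p q v))) ∧
    LevyBesov.genBesovSpace κ P s p q = LevyBesov.besovSpace σ μ P s p q ∧
    ∃ C : ℝ≥0, ∀ v ∈ LevyBesov.besovSpace σ μ P s p q,
      LevyBesov.besovNorm σ μ P s p q v ≤ C * LevyBesov.genBesovNorm κ P s p q v ∧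
      LevyBesov.genBesovNorm κ P s p q v ≤ C * LevyBesov.besovNorm σ μ P s p q v := by
  open LevyBesov in
  obtain ⟨A, hA⟩ := exists_genBesovNorm_le P hκ hμ hD hB s hp hq
  obtain ⟨A', hA'⟩ := exists_besovSchwartzNorm_le P hκ hμ hD hB s hp hq
  have hfin : ∀ u : 𝓢(Rd d, ℝ), besovSchwartzNorm σ μ P s p q u < ⊤ := fun u =>
    (hA' u).trans_lt (ENNReal.mul_lt_top ENNReal.coe_lt_top
      (genBesovNorm_toDistribution_lt_top P hκ s hp hq u))
  have hspace : genBesovSpace κ P s p q = besovSpace σ μ P s p q := by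
    ext v
    constructor
    · intro hv
      obtain ⟨u, hu, -⟩ := exists_besovApproximates hκ hμ hD hB P s hp hq hv
      exact ⟨u, hu⟩
    · rintro ⟨u, hu⟩
      refine ⟨IsRealDistribution.of_tendsto (fun n => isRealDistribution_toDistribution (u n)) hu.2,
        ?_⟩
      obtain ⟨B, hBd⟩ := hu.1.exists_bound hμ hp hq hfin
      -- A Cauchy sequence is eventually bounded by `B`, so lower semicontinuity gives the finite
      -- bound `A * B` at the limit.
      refine lt_of_le_of_lt (genBesovNorm_le_of_tendsto P hκ s hq hu.2 (M := A * B) ?_)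
        (ENNReal.mul_lt_top ENNReal.coe_lt_top ENNReal.coe_lt_top)
      filter_upwards [hBd] with n hn
      exact (hA _).trans (mul_le_mul_right hn _)
  refine ⟨hfin, fun u hu => hu.exists_tendsto hκ hμ hD hB hp hq hfin,
    fun u v hu => hu.tendsto_norm hκ hμ hD hB hp hq, hspace, max A A', fun v hv => ⟨?_, ?_⟩⟩
  · rw [← hspace] at hv
    obtain ⟨u, hu, hlim⟩ := exists_besovApproximates hκ hμ hD hB P s hp hq hv
    -- For the first inequality the approximants converge in the generalized norm as well, so the
    -- estimate for Schwartz functions and the triangle inequality pass to the limit.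
    have h1 : Tendsto (fun n => (A' : ℝ≥0∞) * (genBesovNorm κ P s p q (toDistribution (u n) - v) +
        genBesovNorm κ P s p q v)) atTop (𝓝 (A' * genBesovNorm κ P s p q v)) := by
      have h2 := ENNReal.Tendsto.const_mul (hlim.add_const (genBesovNorm κ P s p q v))
        (a := (A' : ℝ≥0∞)) (Or.inr ENNReal.coe_ne_top)
      rwa [zero_add] at h2
    refine (le_of_tendsto_of_tendsto' (hu.tendsto_norm hκ hμ hD hB hp hq) h1 fun n => ?_).trans ?_
    · refine (hA' _).trans (mul_le_mul_right ?_ _)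
      have h3 := genBesovNorm_add_le P hκ s hp hq (toDistribution (u n) - v) v
      rwa [sub_add_cancel] at h3
    · gcongr
      exact le_max_right _ _
  · obtain ⟨u, hu⟩ := hv
    have hlim := hu.tendsto_norm hκ hμ hD hB hp hq
    obtain ⟨B, hBd⟩ := hu.1.exists_bound hμ hp hq hfin
    have hne : besovNorm σ μ P s p q v ≠ ⊤ :=
      ne_top_of_le_ne_top ENNReal.coe_ne_top (le_of_tendsto hlim hBd)
    have h1 : genBesovNorm κ P s p q v ≤ A * besovNorm σ μ P s p q v := by
      -- Lower semicontinuity needs an eventual bound, and the norms of the approximants are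
      -- eventually below their limit plus `δ` only because that limit is finite. Then `δ` tends to
      -- zero.
      have h2 : Tendsto (fun δ : ℝ≥0∞ => (A : ℝ≥0∞) * (besovNorm σ μ P s p q v + δ)) (𝓝[>] 0)
          (𝓝 (A * besovNorm σ μ P s p q v)) := by
        have h3 : Continuous fun δ : ℝ≥0∞ => (A : ℝ≥0∞) * (besovNorm σ μ P s p q v + δ) :=
          (ENNReal.continuous_const_mul (by simp)).comp (continuous_const.add continuous_id)
        simpa using (h3.tendsto 0).mono_left (nhdsWithin_le_nhds (s := Ioi (0 : ℝ≥0∞)))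
      refine ge_of_tendsto h2 ?_
      filter_upwards [self_mem_nhdsWithin] with δ hδ
      refine genBesovNorm_le_of_tendsto P hκ s hq hu.2 ?_
      filter_upwards [hlim.eventually_lt_const (ENNReal.lt_add_right hne (ne_of_gt hδ))] with n hn
      exact (hA _).trans (mul_le_mul_right hn.le _)
    refine h1.trans ?_
    gcongr
    exact le_max_left _ _
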